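/- **Setting.** Let $\Gamma=\mathrm{SL}_2(\mathbb Z)$, let $r\in\mathbb R$, and let $v:\Gamma\to\mathbb C^\ast$ be a multiplier system for the weight $r$: there is a non-zero holomorphic $F$ on the upper half-plane $\mathfrak H^+$ with $F(\gamma z)=v(\gamma)(cz+d)^rF(z)$ for all $\gamma=\begin{pmatrix}a&b\\c&d\end{pmatrix}\in\Gamma$. Let $\mathfrak H^-$ be the lower half-plane. $\Gamma$ acts on functions $h$ on $\mathfrak H^+$ and $f$ on $\mathfrak H^-$ by $$h|\gamma(z)=v(\gamma)^{-1}(cz+d)^{-r}h(\gamma z),\qquad f|\gamma(t)=v(\gamma)(ct+d)^{-r}f(\gamma t),$$ with $\arg(cz+d)\in(-\pi,\pi]$ and $\arg(ct+d)\in[-\pi,\pi)$. Put $h^+(z)=(-i-z)^rh(z)$ and $f^-(t)=(i-t)^rf(t)$ (principal powers), $w=w(z)=\frac{z-i}{z+i}$, and $(r)_n=r(r+1)\cdots(r+n-1)$. * $\mathcal D^{-\omega}_+$: all holomorphic $h$ on $\mathfrak H^+$. * $\mathcal D^{\omega}_-$: the $f$ for which $f^-$ extends holomorphically to a neighbourhood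 of $\mathfrak H^-\cup\mathbb P^1(\mathbb R)$ in $\mathbb P^1(\mathbb C)$. * $\mathcal D^{\infty}_-$: the holomorphic $f$ on $\mathfrak H^-$ for which $f^-$ extends to a $C^\infty$ function on $\mathfrak H^-\cup\mathbb P^1(\mathbb R)$, with the topology of uniform convergence on $\mathbb P^1(\mathbb R)$ of all derivatives of $f^-$ with respect to $\theta$, where $t=-\cot\theta$. * If $r\in\mathbb Z_{\le0}$: $\mathcal D^{\rm pol}_\pm$, the polynomial functions of degree $\le|r|$ on $\mathfrak H^\pm$. If $r\notin\mathbb Z_{\le0}$ and $f\in\mathcal D^\omega_-$, let $\varrho_0\in(0,1)$ be such that $f^-$ is holomorphic on $|w|>\varrho_0$, and put $$\sigma_rf^-(z)=\frac1\pi\,\frac{z+i}{z-i}\int_{C_1}f^-(\tau)\;{}_2F_1\Bigl(1,1;r;\tfrac{(\tau-i)(z+i)}{(\tau+i)(z-i)}\Bigr)\frac{d\tau}{\tau^2+1},$$ where $C_1$ is a closed contour in $\{\varrho_0<|w|<\varrho\}$, for some $\varrho<1$, that encircles $i$ once positively, and $|w(z)|>\varrho$. If $r\in\mathbb Z_{\le0}$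 and $f\in\mathcal D^{\rm pol}_-$, then $f^-$ is a polynomial of degree $\le|r|$ in $w^{-1}$, and $\sigma_r$ is the linear operator with $\sigma_r(w^{-n})=\frac{n!}{(r)_n}w^{-n-1}$, $0\le n\le|r|$. Consider $$[h,f]_r=\frac1\pi\int_Ch^+(z)\,\sigma_rf^-(z)\,\frac{dz}{(z+i)^2},\tag{1}$$ where $C\subset\mathfrak H^+$ is a closed contour that encircles $i$ once positively, and runs in $\varrho<|w|<1$ if $r\notin\mathbb Z_{\le0}$, and in $\mathfrak H^+\setminus\{i\}$ if $r\in\mathbb Z_{\le0}$. **Theorem.** 1. Let $r\notin\mathbb Z_{\le0}$. Formula (1) gives a well-defined (independent of all choices) non-degenerate bilinear form on $\mathcal D^{-\omega}_+\times\mathcal D^\omega_-$. Both spaces are preserved by $\Gamma$, and $[h|\gamma,f|\gamma]_r=[h,f]_r$ for all $\gamma\in\Gamma$. The value of (1) does not change if a holomorphic function on $\mathfrak H^+$ is added to $\sigma_rf^-$. 2. Let $r\notin\mathbb Z_{\le0}$, and let $h\in\mathcal D^{-\omega}_+$ have polynomial growth: for some $B>0$, $h^+(z)=O\bigl((\operatorname{Im}z)^{-B}+|z|^B\bigr)$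 on $\mathfrak H^+$. Then the linear form $f\mapsto[h,f]_r$ on $\mathcal D^\omega_-$ extends to a continuous linear form on $\mathcal D^\infty_-$. 3. Let $r\in\mathbb Z_{\le0}$. Formula (1) gives a well-defined bilinear form on $\mathcal D^{-\omega}_+\times\mathcal D^{\rm pol}_-$. The spaces $\mathcal D^{\rm pol}_\pm$ are preserved by $\Gamma$, and the restriction of the form to $\mathcal D^{\rm pol}_+\times\mathcal D^{\rm pol}_-$ is $\Gamma$-invariant and non-degenerate. 4. If $h^+(z)=\sum_{n\ge0}c_nw^n$ on $\mathfrak H^+$ and $f^-(t)=\sum_{n\ge0}d_{-n}w^{-n}$ on $\mathfrak H^-$ (with $d_{-n}=0$ for $n>|r|$ if $r\in\mathbb Z_{\le0}$), then $$[h,f]_r=\sum_{n\ge0}\frac{n!}{(r)_n}\,c_n\,d_{-n},$$ a convergent series if $r\notin\mathbb Z_{\le 0}$, and the sum over $0\le n\le|r|$ if $r\in\mathbb Z_{\le0}$. In part 2 the same formula holds for the continuous extension to $f\in\mathcal D^\infty_-$. 5. (Principal series version.) Let $\tilde G$ be the universal covering group of $\mathrm{SL}_2(\mathbb R)$. For $g=\begin{pmatrix}a&b\\c&d\end{pmatrix}\in\mathrm{SL}_2(\mathbb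 R)$ with $\arg(ci+d)\in(-\pi,\pi)$ let $\tilde g\in\tilde G$ be its canonical lift. In the principal series with parameters $(s,p)$ it acts by $$\varphi|_{s,p}\,\tilde g(t)=(a-ic)^{p/2-s}\Bigl(\tfrac{t-i}{t-g^{-1}i}\Bigr)^{s-p/2}(a+ic)^{-s-p/2}\Bigl(\tfrac{t+i}{t-g^{-1}(-i)}\Bigr)^{s+p/2}\varphi(gt),$$ and the central generator above $-1$ acts as $e^{-\pi ip}$; these elements generate $\tilde G$, each element being a product of a power of the central generator and some $\tilde g$. Let $\tilde{\mathcal D}^{-\omega}_+$ be the space of hyperfunctions on $\mathbb P^1(\mathbb R)$ with a representative that is a holomorphic function $h^+$ on $\mathfrak H^+$ and zero on $\mathfrak H^-$, with parameters $(r/2,r)$. Let $\tilde{\mathcal D}^\omega_-$ be the space of those with a representative that is zero on $\mathfrak H^+$ and on $\mathfrak H^-$ a function $f^-$ that extends holomorphically to a neighbourhood of $\mathfrak H^-\cup\mathbb P^1(\mathbb R)$, with parameters $(r/2,-r)$. For $r\in\mathbb Z_{\le 0}$ let $\tilde{\mathcal D}^{\rm pol}_\pm$ be the subspaces for which $h^+$,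 respectively $f^-$, is a polynomial of degree $\le|r|$ in $w$, respectively $w^{-1}$. If $r\notin\mathbb Z_{\le0}$, formula (1) gives a non-degenerate $\tilde G$-invariant bilinear form on $\tilde{\mathcal D}^{-\omega}_+\times\tilde{\mathcal D}^\omega_-$, unchanged if a holomorphic function on $\mathfrak H^+$ is added to $\sigma_rf^-$. If $r\in\mathbb Z_{\le0}$, it gives a bilinear form on $\tilde{\mathcal D}^{-\omega}_+\times\tilde{\mathcal D}^{\rm pol}_-$ whose restriction to $\tilde{\mathcal D}^{\rm pol}_+\times\tilde{\mathcal D}^{\rm pol}_-$ is $\tilde G$-invariant and non-degenerate. These forms correspond to $[\cdot,\cdot]_r$ under $h\mapsto h^+$, $f\mapsto f^-$. -/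

import Mathlib

open Complex MeasureTheory
open UpperHalfPlane hiding I
open scoped MatrixGroups ContDiff ComplexConjugate

noncomputable section

namespace WeightDuality

/-! ### Half-planes, coordinates, Möbius actions -/

/-- The lower half-plane. -/
abbrev LHP : Type := {t : ℂ // t.im < 0}

/-- The disk coordinate `w = (z - i) / (z + i)` on the complex projective line. The upper half-plane
is `|w| < 1`, the real projective line is `|w| = 1`. -/
def cay (z : ℂ) : ℂ := (z - I) / (z + I)

/-- The inverse disk coordinate `w⁻¹ = (t + i) / (t - i)`. The lower half-plane is `|w⁻¹| < 1` (its
point `-i` is the centre), the real projective line is `|w⁻¹| = 1`. -/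
def cayInv (t : ℂ) : ℂ := (t + I) / (t - I)

/-- `c z + d` for a real matrix with lower row `(c, d)`. -/
def autFactor (g : SL(2, ℝ)) (z : ℂ) : ℂ := ((g 1 0 : ℝ) : ℂ) * z + ((g 1 1 : ℝ) : ℂ)

/-- The fractional linear transformation `z ↦ (a z + b) / (c z + d)`. -/
def moebius (g : SL(2, ℝ)) (z : ℂ) : ℂ :=
  (((g 0 0 : ℝ) : ℂ) * z + ((g 0 1 : ℝ) : ℂ)) / autFactor g z

theorem moebius_im_neg (g : SL(2, ℝ)) {t : ℂ} (ht : t.im < 0) : (moebius g t).im < 0 := by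
  have hdet : g 0 0 * g 1 1 - g 0 1 * g 1 0 = 1 := by
    have := g.det_coe
    rwa [Matrix.det_fin_two] at this
  have hden : autFactor g t ≠ 0 := by
    intro h
    have h1 := congrArg Complex.im h
    have h2 := congrArg Complex.re h
    simp [autFactor] at h1 h2
    rcases h1 with h1 | h1
    · rw [h1] at h2 hdet
      simp at h2
      rw [h2] at hdet
      simp at hdet
    · exact ht.ne h1
  have hpos : 0 < Complex.normSq (autFactor g t) := Complex.normSq_pos.mpr hden
  have key : (moebius g t).im = t.im / Complex.normSq (autFactor g t) := by
    rw [moebius, Complex.div_im, ← sub_div]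
    congr 1
    simp [autFactor]
    linear_combination t.im * hdet
  rw [key]
  exact div_neg_of_neg_of_pos ht hpos

/-- The action of `SL₂(ℝ)` on the lower half-plane. -/
def lowerMoebius (g : SL(2, ℝ)) (t : LHP) : LHP := ⟨moebius g t, moebius_im_neg g t.2⟩

/-! ### Multiplier systems and the weight `r` actions of the modular group -/

/-- Holomorphic functions on the upper half-plane. -/
def holUpper : Submodule ℂ (ℍ → ℂ) where
  carrier := {h | DifferentiableOn ℂ (h ∘ ofComplex) {z | 0 < z.im}}
  zero_mem' := differentiableOn_const (0 : ℂ)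
  add_mem' := fun ha hb => DifferentiableOn.add ha hb
  smul_mem' := fun c _ ha => DifferentiableOn.const_smul ha c

/-- `v : SL₂(ℤ) → ℂˣ` is a multiplier system for the weight `r`: there are non-zero holomorphic
functions with `f (γ z) = v(γ) (c z + d) ^ r f(z)`, where `arg (c z + d) ∈ (-π, π]`. -/
def IsMultiplierSystem (r : ℝ) (v : SL(2, ℤ) → ℂˣ) : Prop :=
  ∃ f ∈ holUpper, f ≠ 0 ∧ ∀ (γ : SL(2, ℤ)) (z : ℍ),
    f ((γ : SL(2, ℝ)) • z) = (v γ : ℂ) * autFactor γ z ^ (r : ℂ) * f z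

/-- The action `h |_{v,r} γ` on functions on the upper half-plane; `arg (c z + d) ∈ (-π, π]`. -/
def slashUpper (v : SL(2, ℤ) → ℂˣ) (r : ℝ) (γ : SL(2, ℤ)) (h : ℍ → ℂ) : ℍ → ℂ := fun z =>
  ((v γ : ℂ))⁻¹ * autFactor γ z ^ (-(r : ℂ)) * h ((γ : SL(2, ℝ)) • z)

/-- The action `f |⁻_{v⁻¹,r} γ` on functions on the lower half-plane; here
`arg (c t + d) ∈ [-π, π)`, which is the choice obtained from the one on the upper half-plane
by complex conjugation. -/
def slashLower (v : SL(2, ℤ) → ℂˣ) (r : ℝ) (γ : SL(2, ℤ)) (f : LHP → ℂ) : LHP → ℂ := fun t =>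
  (v γ : ℂ) * conj (autFactor γ (conj (t : ℂ)) ^ (-(r : ℂ))) * f (lowerMoebius γ t)

/-! ### The normalized functions `h⁺`, `f⁻` and the modules -/

/-- `h⁺(z) = (-i - z) ^ r h(z)` on the upper half-plane. -/
def plusMap (r : ℝ) : (ℍ → ℂ) →ₗ[ℂ] (ℍ → ℂ) where
  toFun h := fun z => (-I - (z : ℂ)) ^ (r : ℂ) * h z
  map_add' h k := by ext z; simp [mul_add]
  map_smul' c h := by ext z; simp [mul_left_comm]

/-- `f⁻(t) = (i - t) ^ r f(t)` on the lower half-plane. -/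
def minusMap (r : ℝ) : (LHP → ℂ) →ₗ[ℂ] (LHP → ℂ) where
  toFun f := fun t => (I - (t : ℂ)) ^ (r : ℂ) * f t
  map_add' h k := by ext z; simp [mul_add]
  map_smul' c h := by ext z; simp [mul_left_comm]

/-- `Φ`, holomorphic on `|w⁻¹| < R` with `R > 1`, is (in the coordinate `w⁻¹`) a holomorphic
extension of the function `φ` on the lower half-plane to a neighbourhood of the union of the lower
half-plane and the real projective line. -/
structure ExtendsTo (φ : LHP → ℂ) (R : ℝ) (Φ : ℂ → ℂ) : Prop where
  one_lt : 1 < R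
  diff : DifferentiableOn ℂ Φ (Metric.ball 0 R)
  eq : ∀ t : LHP, φ t = Φ (cayInv t)

/-- Functions on the lower half-plane that extend holomorphically to a neighbourhood in
the complex projective line of the union of the lower half-plane and the real projective line. -/
def analyticLower : Submodule ℂ (LHP → ℂ) where
  carrier := {φ | ∃ R Φ, ExtendsTo φ R Φ}
  zero_mem' := ⟨2, 0, by norm_num, differentiableOn_const (0 : ℂ), fun _ => rfl⟩
  add_mem' := by
    rintro a b ⟨R, Φ, h1, h2, h3⟩ ⟨R', Φ', h1', h2', h3'⟩
    exact ⟨min R R', Φ + Φ', lt_min h1 h1',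
      (h2.mono (Metric.ball_subset_ball (min_le_left _ _))).add
        (h2'.mono (Metric.ball_subset_ball (min_le_right _ _))),
      fun t => by simp [h3 t, h3' t]⟩
  smul_mem' := by
    rintro c a ⟨R, Φ, h1, h2, h3⟩
    exact ⟨R, c • Φ, h1, h2.const_smul c, fun t => by simp [h3 t]⟩

/-- Holomorphic functions on the lower half-plane that extend to a `C^∞` function on the union of
the lower half-plane and the real projective line (in the coordinate `w⁻¹`: the closed disk). -/
def smoothLower : Submodule ℂ (LHP → ℂ) where
  carrier := {φ | ∃ Φ : ℂ → ℂ, DifferentiableOn ℂ Φ (Metric.ball 0 1) ∧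
    ContDiffOn ℝ ∞ Φ (Metric.closedBall 0 1) ∧ ∀ t : LHP, φ t = Φ (cayInv t)}
  zero_mem' := ⟨0, differentiableOn_const (0 : ℂ), contDiffOn_const, fun _ => rfl⟩
  add_mem' := by
    rintro a b ⟨Φ, h1, h2, h3⟩ ⟨Φ', h1', h2', h3'⟩
    exact ⟨Φ + Φ', h1.add h1', h2.add h2', fun t => by simp [h3 t, h3' t]⟩
  smul_mem' := by
    rintro c a ⟨Φ, h1, h2, h3⟩
    exact ⟨c • Φ, h1.const_smul c, h2.const_smul c, fun t => by simp [h3 t]⟩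

theorem analyticLower_le_smoothLower : analyticLower ≤ smoothLower := by
  rintro φ ⟨R, Φ, h1, h2, h3⟩
  refine ⟨Φ, h2.mono (Metric.ball_subset_ball h1.le), ?_, h3⟩
  have h4 : ContDiffOn ℂ ∞ Φ (Metric.ball 0 R) := h2.contDiffOn Metric.isOpen_ball
  exact (h4.restrict_scalars ℝ).mono (Metric.closedBall_subset_ball h1)

/-- The space of the module of analytic vectors of weight `r` on the lower half-plane. -/
def DOmega (r : ℝ) : Submodule ℂ (LHP → ℂ) := analyticLower.comap (minusMap r)

/-- The space of the module of smooth vectors of weight `r` on the lower half-plane. -/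
def DSmooth (r : ℝ) : Submodule ℂ (LHP → ℂ) := smoothLower.comap (minusMap r)

theorem DOmega_le_DSmooth (r : ℝ) : DOmega r ≤ DSmooth r :=
  Submodule.comap_mono analyticLower_le_smoothLower

/-- At most polynomial growth at the boundary of the upper half-plane. -/
def HasPolyGrowth (φ : ℍ → ℂ) : Prop :=
  ∃ B : ℝ, 0 < B ∧ ∃ C : ℝ, ∀ z : ℍ, ‖φ z‖ ≤ C * (z.im ^ (-B) + ‖(z : ℂ)‖ ^ B)

/-- Polynomial functions of degree at most `a` on the upper half-plane. -/
def polUpper (a : ℕ) : Submodule ℂ (ℍ → ℂ) where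
  carrier := {h | ∃ P : Polynomial ℂ, P.natDegree ≤ a ∧ ∀ z : ℍ, h z = P.eval (z : ℂ)}
  zero_mem' := ⟨0, by simp, by simp⟩
  add_mem' := by
    rintro x y ⟨P, h1, h2⟩ ⟨Q, h1', h2'⟩
    exact ⟨P + Q, Polynomial.natDegree_add_le_of_degree_le h1 h1', fun t => by simp [h2, h2']⟩
  smul_mem' := by
    rintro c x ⟨P, h1, h2⟩
    exact ⟨c • P, (Polynomial.natDegree_smul_le c P).trans h1, fun t => by simp [h2]⟩

/-- Polynomial functions of degree at most `a` on the lower half-plane. -/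
def polLower (a : ℕ) : Submodule ℂ (LHP → ℂ) where
  carrier := {f | ∃ P : Polynomial ℂ, P.natDegree ≤ a ∧ ∀ t : LHP, f t = P.eval (t : ℂ)}
  zero_mem' := ⟨0, by simp, by simp⟩
  add_mem' := by
    rintro x y ⟨P, h1, h2⟩ ⟨Q, h1', h2'⟩
    exact ⟨P + Q, Polynomial.natDegree_add_le_of_degree_le h1 h1', fun t => by simp [h2, h2']⟩
  smul_mem' := by
    rintro c x ⟨P, h1, h2⟩
    exact ⟨c • P, (Polynomial.natDegree_smul_le c P).trans h1, fun t => by simp [h2]⟩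

theorem polUpper_le_holUpper (a : ℕ) : polUpper a ≤ holUpper := by
  rintro h ⟨P, -, hP⟩
  refine (P.differentiable.differentiableOn (s := {z : ℂ | 0 < z.im})).congr ?_
  intro z hz
  simp [hP, ofComplex_apply_of_im_pos (show 0 < z.im from hz)]

/-! ### The topology on smooth vectors -/

/-- The smooth extension of `f⁻` to the real projective line, as a function of the angle `θ`, where
`t = -cot θ`, so that `w = exp (2 i θ)`. -/
def boundaryFun (r : ℝ) (f : DSmooth r) : ℝ → ℂ := fun θ =>
  Classical.choose (show minusMap r f ∈ smoothLower from f.2) (exp (-2 * I * (θ : ℂ)))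

/-- The natural topology on smooth vectors: uniform convergence on the real projective line
of the extension of `f⁻` and of all its derivatives with respect to `θ`. -/
abbrev smoothTopology (r : ℝ) : TopologicalSpace (DSmooth r) :=
  TopologicalSpace.induced
    (fun f (k : ℕ) => (UniformFun.ofFun (iteratedDeriv k (boundaryFun r f)) : UniformFun ℝ ℂ))
    inferInstance

/-! ### Contour integrals and the operator `σ_r` -/

/-- Closed contours `γ : [0, 1] → ℂ`: continuous, differentiable up to finitely many
points, with integrable derivative. Every closed piecewise `C¹` curve is of this type. -/
structure IsContour (γ : ℝ → ℂ) : Prop where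
  cont : ContinuousOn γ (Set.Icc 0 1)
  closed : γ 0 = γ 1
  diff : ∃ s : Finset ℝ, ∀ x ∈ Set.Ioo (0 : ℝ) 1, x ∉ s → DifferentiableAt ℝ γ x
  integrable : IntervalIntegrable (deriv γ) volume 0 1

/-- `∫_γ F(z) dz`. -/
def contourIntegral (γ : ℝ → ℂ) (F : ℂ → ℂ) : ℂ := ∫ x in (0 : ℝ)..1, F (γ x) * deriv γ x

/-- `γ` is a closed contour in the part `lo < |w| < hi` of the upper half-plane that encircles
the point `i` once in the positive direction. -/
structure Encircles (lo hi : ℝ) (γ : ℝ → ℂ) : Prop where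
  contour : IsContour γ
  mem : ∀ x ∈ Set.Icc (0 : ℝ) 1, 0 < (γ x).im ∧ lo < ‖cay (γ x)‖ ∧ ‖cay (γ x)‖ < hi
  winding : contourIntegral γ (fun z => (z - I)⁻¹) = 2 * Real.pi * I

/-- The function `σ_r f⁻` at a point `z` outside the contour `γ`, if `Φ` is, in the
coordinate `w⁻¹`, the holomorphic extension of `f⁻`, and `r` is not in `ℤ_{≤ 0}`. -/
def sigmaInt (r : ℝ) (Φ : ℂ → ℂ) (γ : ℝ → ℂ) (z : ℂ) : ℂ :=
  1 / Real.pi * ((z + I) / (z - I)) * contourIntegral γ (fun τ =>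
    Φ (cayInv τ) *
      ordinaryHypergeometric (1 : ℂ) 1 (r : ℂ) (((τ - I) * (z + I)) / ((τ + I) * (z - I))) /
      (τ ^ 2 + 1))

/-- `val = (1/π) ∫_C h⁺(z) σ_r f⁻(z) dz / (z + i)²` for all contours `C` around the singularities
of `σ_r f⁻` in the upper half-plane, and the value is the same if any holomorphic function
on the upper half-plane is added to `σ_r f⁻`. The extension `Φ` of `f⁻` is
holomorphic on `|w| > 1/R`; the contour `γ₁` in the definition of `σ_r f⁻` runs
in `1/R < |w| < ρ`, and `C = γ₂` runs in `ρ < |w| < 1`. -/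
def ContourFormula (r : ℝ) (hp : ℍ → ℂ) (fm : LHP → ℂ) (val : ℂ) : Prop :=
  ∀ (R : ℝ) (Φ : ℂ → ℂ), ExtendsTo fm R Φ →
    ∀ (ρ : ℝ) (γ₁ γ₂ : ℝ → ℂ), Encircles R⁻¹ ρ γ₁ → Encircles ρ 1 γ₂ →
      val = 1 / Real.pi * contourIntegral γ₂
        (fun z => hp (ofComplex z) * sigmaInt r Φ γ₁ z / (z + I) ^ 2) ∧
      ∀ k ∈ holUpper, val = 1 / Real.pi * contourIntegral γ₂
        (fun z => hp (ofComplex z) * (sigmaInt r Φ γ₁ z + k (ofComplex z)) / (z + I) ^ 2)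

/-- The factor `n! / (r)_n`, with the Pochhammer symbol `(r)_n = r (r + 1) ⋯ (r + n - 1)`. -/
def coeff (r : ℝ) (n : ℕ) : ℂ := (n.factorial : ℂ) / (ascPochhammer ℂ n).eval (r : ℂ)

/-- The expansion `h⁺(z) = ∑_{n ≥ 0} c_n w ^ n` on the upper half-plane. -/
def ExpansionUpper (hp : ℍ → ℂ) (c : ℕ → ℂ) : Prop :=
  ∀ z : ℍ, HasSum (fun n => c n * cay z ^ n) (hp z)

/-- The expansion `f⁻(t) = ∑_{n ≥ 0} d_n w ^ (-n)` on the lower half-plane. -/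
def ExpansionLower (fm : LHP → ℂ) (d : ℕ → ℂ) : Prop :=
  ∀ t : LHP, HasSum (fun n => d n * cayInv t ^ n) (fm t)

/-- A finite expansion `f⁻(t) = ∑_{0 ≤ n ≤ a} d_n w ^ (-n)` on the lower half-plane. -/
def ExpansionPol (a : ℕ) (fm : LHP → ℂ) (d : ℕ → ℂ) : Prop :=
  ∀ t : LHP, fm t = ∑ n ∈ Finset.range (a + 1), d n * cayInv t ^ n

/-- `σ_r f⁻` for `r = -a ∈ ℤ_{≤ 0}` and `f⁻ = ∑_{0 ≤ n ≤ a} d_n w ^ (-n)`: the linear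
operator determined by `w ^ (-n) ↦ n! / (r)_n w ^ (-n-1)`. -/
def sigmaPol (a : ℕ) (d : ℕ → ℂ) (z : ℂ) : ℂ :=
  ∑ n ∈ Finset.range (a + 1), coeff (-(a : ℝ)) n * d n * cayInv z ^ (n + 1)

/-- The function `f⁻` is a polynomial of degree at most `a` in `w⁻¹`, and
`val = (1/π) ∫_C h⁺(z) σ_r f⁻(z) dz / (z + i)²` with `r = -a`. -/
def PolContourFormula (a : ℕ) (hp : ℍ → ℂ) (fm : LHP → ℂ) (val : ℂ) : Prop :=
  (∃ d, ExpansionPol a fm d) ∧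
  ∀ d, ExpansionPol a fm d → ∀ γ : ℝ → ℂ, Encircles 0 1 γ →
    val = 1 / Real.pi * contourIntegral γ
      (fun z => hp (ofComplex z) * sigmaPol a d z / (z + I) ^ 2)

/-! ### Hyperfunctions and principal series of the universal covering group -/

/-- Points off the real projective line, in the neighbourhood `c < |w| < 1/c` of it. -/
def nearLine (c : ℝ) : Set ℂ := {z | z.im ≠ 0 ∧ c < ‖cay z‖ ∧ ‖cay z‖ < c⁻¹}

theorem nearLine_mono {c c' : ℝ} (hc : 0 < c) (h : c ≤ c') : nearLine c' ⊆ nearLine c :=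
  fun _ hz => ⟨hz.1, h.trans_lt hz.2.1, hz.2.2.trans_le (inv_anti₀ hc h)⟩

/-- Representatives of hyperfunctions: functions that are holomorphic on `U \ ℙ¹(ℝ)`
for some neighbourhood `U` of `ℙ¹(ℝ)`. -/
def hyperReps : Submodule ℂ (ℂ → ℂ) where
  carrier := {H | ∃ c, 0 < c ∧ c < 1 ∧ DifferentiableOn ℂ H (nearLine c)}
  zero_mem' := ⟨1 / 2, by norm_num, by norm_num, differentiableOn_const (0 : ℂ)⟩
  add_mem' := by
    rintro H K ⟨c, h0, h1, h2⟩ ⟨c', h0', h1', h2'⟩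
    exact ⟨max c c', lt_max_of_lt_left h0, max_lt h1 h1',
      (h2.mono (nearLine_mono h0 (le_max_left _ _))).add
        (h2'.mono (nearLine_mono h0' (le_max_right _ _)))⟩
  smul_mem' := by
    rintro x H ⟨c, h0, h1, h2⟩
    exact ⟨c, h0, h1, h2.const_smul x⟩

/-- Functions that are, near `ℙ¹(ℝ)`, the restriction to `U \ ℙ¹(ℝ)` of a holomorphic
function on a neighbourhood `U` of `ℙ¹(ℝ)` (written in the disk coordinate `w`). -/
def hyperNull : Submodule ℂ (ℂ → ℂ) where
  carrier := {H | ∃ c, 0 < c ∧ c < 1 ∧ ∃ G : ℂ → ℂ,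
    DifferentiableOn ℂ G {w | c < ‖w‖ ∧ ‖w‖ < c⁻¹} ∧ ∀ z ∈ nearLine c, H z = G (cay z)}
  zero_mem' := ⟨1 / 2, by norm_num, by norm_num, 0, differentiableOn_const (0 : ℂ),
    fun _ _ => rfl⟩
  add_mem' := by
    rintro H K ⟨c, h0, h1, G, h2, h3⟩ ⟨c', h0', h1', G', h2', h3'⟩
    refine ⟨max c c', lt_max_of_lt_left h0, max_lt h1 h1', G + G', ?_, ?_⟩
    · refine (h2.mono ?_).add (h2'.mono ?_)
      · exact fun w hw => ⟨(le_max_left _ _).trans_lt hw.1,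
          hw.2.trans_le (inv_anti₀ h0 (le_max_left _ _))⟩
      · exact fun w hw => ⟨(le_max_right _ _).trans_lt hw.1,
          hw.2.trans_le (inv_anti₀ h0' (le_max_right _ _))⟩
    · intro z hz
      simp [h3 z (nearLine_mono h0 (le_max_left _ _) hz),
        h3' z (nearLine_mono h0' (le_max_right _ _) hz)]
  smul_mem' := by
    rintro x H ⟨c, h0, h1, G, h2, h3⟩
    exact ⟨c, h0, h1, x • G, h2.const_smul x, fun z hz => by simp [h3 z hz]⟩

/-- Hyperfunctions on the real projective line. -/
abbrev Hyperfunction : Type := hyperReps ⧸ hyperNull.submoduleOf hyperReps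

/-- `α` is the hyperfunction with the representative equal to `hp` on the upper half-plane and to
zero on the lower half-plane, where `hp` is in the space `W` of functions on the upper
half-plane. -/
def RepPlus (W : Submodule ℂ (ℍ → ℂ)) (α : Hyperfunction) (hp : ℍ → ℂ) : Prop :=
  hp ∈ W ∧ ∃ H : hyperReps, Submodule.Quotient.mk H = α ∧
    (∀ z : ℍ, (H : ℂ → ℂ) z = hp z) ∧ ∀ t : LHP, (H : ℂ → ℂ) t = 0

/-- `β` is the hyperfunction with the representative equal to `fm` on the lower half-plane and to
zero on the upper half-plane, where `fm` is in the space `W` of functions on the lower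
half-plane. -/
def RepMinus (W : Submodule ℂ (LHP → ℂ)) (β : Hyperfunction) (fm : LHP → ℂ) : Prop :=
  fm ∈ W ∧ ∃ H : hyperReps, Submodule.Quotient.mk H = β ∧
    (∀ z : ℍ, (H : ℂ → ℂ) z = 0) ∧ ∀ t : LHP, (H : ℂ → ℂ) t = fm t

/-- The hyperfunctions with a representative in the space `W` of functions on the upper half-plane,
and zero on the lower half-plane. -/
def plusHyper (W : Submodule ℂ (ℍ → ℂ)) : Submodule ℂ Hyperfunction where
  carrier := {α | ∃ hp, RepPlus W α hp}
  zero_mem' := ⟨0, W.zero_mem, 0, rfl, fun _ => rfl, fun _ => rfl⟩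
  add_mem' := by
    rintro _ _ ⟨h, hh, H, rfl, h1, h2⟩ ⟨k, hk, K, rfl, k1, k2⟩
    exact ⟨h + k, W.add_mem hh hk, H + K, rfl, fun z => by simp [h1, k1],
      fun t => by simp [h2, k2]⟩
  smul_mem' := by
    rintro x _ ⟨h, hh, H, rfl, h1, h2⟩
    exact ⟨x • h, W.smul_mem x hh, x • H, rfl, fun z => by simp [h1], fun t => by simp [h2]⟩

/-- The hyperfunctions with a representative in the space `W` of functions on the lower half-plane,
and zero on the upper half-plane. -/
def minusHyper (W : Submodule ℂ (LHP → ℂ)) : Submodule ℂ Hyperfunction where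
  carrier := {β | ∃ fm, RepMinus W β fm}
  zero_mem' := ⟨0, W.zero_mem, 0, rfl, fun _ => rfl, fun _ => rfl⟩
  add_mem' := by
    rintro _ _ ⟨h, hh, H, rfl, h1, h2⟩ ⟨k, hk, K, rfl, k1, k2⟩
    exact ⟨h + k, W.add_mem hh hk, H + K, rfl, fun z => by simp [h1, k1],
      fun t => by simp [h2, k2]⟩
  smul_mem' := by
    rintro x _ ⟨h, hh, H, rfl, h1, h2⟩
    exact ⟨x • h, W.smul_mem x hh, x • H, rfl, fun z => by simp [h1], fun t => by simp [h2]⟩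

/-- Polynomials of degree at most `a` in `w` on the upper half-plane. -/
def diskPolUpper (a : ℕ) : Submodule ℂ (ℍ → ℂ) where
  carrier := {h | ∃ P : Polynomial ℂ, P.natDegree ≤ a ∧ ∀ z : ℍ, h z = P.eval (cay z)}
  zero_mem' := ⟨0, by simp, by simp⟩
  add_mem' := by
    rintro x y ⟨P, h1, h2⟩ ⟨Q, h1', h2'⟩
    exact ⟨P + Q, Polynomial.natDegree_add_le_of_degree_le h1 h1', fun t => by simp [h2, h2']⟩
  smul_mem' := by
    rintro c x ⟨P, h1, h2⟩
    exact ⟨c • P, (Polynomial.natDegree_smul_le c P).trans h1, fun t => by simp [h2]⟩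

/-- Polynomials of degree at most `a` in `w⁻¹` on the lower half-plane. -/
def diskPolLower (a : ℕ) : Submodule ℂ (LHP → ℂ) where
  carrier := {f | ∃ P : Polynomial ℂ, P.natDegree ≤ a ∧ ∀ t : LHP, f t = P.eval (cayInv t)}
  zero_mem' := ⟨0, by simp, by simp⟩
  add_mem' := by
    rintro x y ⟨P, h1, h2⟩ ⟨Q, h1', h2'⟩
    exact ⟨P + Q, Polynomial.natDegree_add_le_of_degree_le h1 h1', fun t => by simp [h2, h2']⟩
  smul_mem' := by
    rintro c x ⟨P, h1, h2⟩
    exact ⟨c • P, (Polynomial.natDegree_smul_le c P).trans h1, fun t => by simp [h2]⟩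

theorem diskPolUpper_le_holUpper (a : ℕ) : diskPolUpper a ≤ holUpper := by
  rintro h ⟨P, -, hP⟩
  have hc : DifferentiableOn ℂ cay {z : ℂ | 0 < z.im} := by
    refine DifferentiableOn.div (by fun_prop) (by fun_prop) ?_
    intro z hz h0
    have h1 := congrArg Complex.im h0
    have h2 : 0 < z.im := hz
    simp at h1
    linarith
  refine (P.differentiable.comp_differentiableOn hc).congr ?_
  intro z hz
  simp [hP, ofComplex_apply_of_im_pos (show 0 < z.im from hz)]

theorem plusHyper_mono {W W' : Submodule ℂ (ℍ → ℂ)} (h : W ≤ W') :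
    plusHyper W ≤ plusHyper W' := by
  rintro α ⟨hp, h1, h2⟩
  exact ⟨hp, h h1, h2⟩

/-- The factor in the principal series action with parameters `(s, p)` of the canonical lift
to the universal covering group of a matrix `g` with `arg (c i + d) ∈ (-π, π)`. The powers
of `(t - x₁) / (t - x₂)` are holomorphic outside the segment from `x₁` to `x₂`, with argument
`0` at `t = ∞`. -/
def psFactor (s p : ℝ) (g : SL(2, ℝ)) (t : ℂ) : ℂ :=
  (((g 0 0 : ℝ) : ℂ) - I * ((g 1 0 : ℝ) : ℂ)) ^ ((p : ℂ) / 2 - s) *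
  ((t - I) / (t - moebius g⁻¹ I)) ^ ((s : ℂ) - p / 2) *
  (((g 0 0 : ℝ) : ℂ) + I * ((g 1 0 : ℝ) : ℂ)) ^ (-(s : ℂ) - p / 2) *
  ((t + I) / (t - moebius g⁻¹ (-I))) ^ ((s : ℂ) + p / 2)

/-- Every element of the universal covering group of `SL₂(ℝ)` is the product of the `k`-th
power, `k ∈ ℤ`, of the generator of its centre over `-1`, which acts as `exp (-π i p)`, and the
canonical lift of some `g` with `arg (c i + d) ∈ (-π, π)`. This is its action in the
principal series with parameters `(r/2, r)`, on the functions on the upper half-plane. -/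
def psUpper (r : ℝ) (k : ℤ) (g : SL(2, ℝ)) (hp : ℍ → ℂ) : ℍ → ℂ := fun z =>
  exp (-(Real.pi * I * r * k)) * psFactor (r / 2) r g z * hp (g • z)

/-- The action of the same elements of the universal covering group in the principal series with
parameters `(r/2, -r)`, on the functions on the lower half-plane. -/
def psLower (r : ℝ) (k : ℤ) (g : SL(2, ℝ)) (fm : LHP → ℂ) : LHP → ℂ := fun t =>
  exp (Real.pi * I * r * k) * psFactor (r / 2) (-r) g t * fm (lowerMoebius g t)

/-- The canonical neighbourhood `arg (c i + d) ∈ (-π, π)` of the identity in `SL₂(ℝ)`. -/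
def G0 : Set SL(2, ℝ) := {g | arg (autFactor g I) ≠ Real.pi}

end WeightDuality

end

open WeightDuality

/-!
In the coordinates `w` on the upper and `w⁻¹` on the lower half-plane all functions are power series
on the unit disk, `h⁺ = ∑ c_n w ^ n` and `f⁻ = ∑ d_n w ^ (-n)`, and all forms in the theorem are
restrictions of one form, `pairing r`, that sends `(h⁺, f⁻)` to `∑ n! / (r)_n c_n d_n`. The factors
`n! / (r)_n` grow at most polynomially (`coeff_growth`), and `d_n` decays exponentially if `f⁻` is
holomorphic beyond the unit circle, so the series converges. Non-degeneracy is visible on the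
monomials.

The contour integrals reduce to the statement that `∮ w ^ k dw / w` is `2 π i` for `k = 0` and zero
otherwise, for every contour that winds once around the origin (`WindsOnce.contourIntegral_mul`). As
`₂F₁(1, 1; r; x) = ∑ n! / (r)_n x ^ n`, the integral for `σ_r f⁻` multiplies the coefficients `d_n`
by `n! / (r)_n` (`hasSum_sigmaInt`), and the second integral pairs the result with `h⁺`
(`contourFormula_pairing`).

Invariance is proved for all `g ∈ SL₂(ℝ)` at once. In the disk coordinate `g` is a Möbius
transformation `M w = (B̄ + Ā w) / (A + B w)`, and each of the actions in the theorem multiplies by a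
holomorphic factor whose absolute value is known to be `|A + B w| ^ (-r)`; by the maximum modulus
principle it is a constant times `(1 + B / A w) ^ (-r)` (`isCocycle_of_norm`). For the functions
`k_s(w) = (1 - s w) ^ (-r) = ∑ (r)_n / n! s ^ n w ^ n` the form reproduces the value of `f⁻` at
`w⁻¹ = s`, and `g` sends `k_s` to a multiple of some `k_{s'}`, so that the invariance is an explicit
computation. Comparing the coefficients of `s ^ n` gives the invariance for all monomials with
`(r)_n ≠ 0`, and continuity in `h` gives the general case (`tsum_transform_eq`).
For `r = -a ∈ ℤ_{≤ 0}` this applies to polynomials of degree at most `a`, which have coefficients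
only in places where `(r)_n ≠ 0`.

On hyperfunctions the form is defined with the help of representatives that vanish on one of the two
half-planes; these are unique by the identity theorem on an annulus (`RepPlus.unique`,
`RepMinus.unique`).

For smooth vectors `d_n` is a Fourier coefficient of the boundary function, and integration by parts
bounds `n ^ k d_n` by the supremum norm of the `k`-th derivative (`norm_fourierInt_sub_mul_le`). If
`h⁺` has polynomial growth, then `c_n` grows polynomially by Cauchy's estimate
(`HasPolyGrowth.coeff_bound`). So the series still converges, and it depends continuously on finitely
many of the seminorms that define the topology (`continuous_smoothForm`).
-/

noncomputable section

namespace WeightDuality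

open Filter Topology

/-! ### Power series on disks -/

/-- `F(w) = ∑ a_n w ^ n` on the disk `‖w‖ < R`. -/
def HasExpansion (R : ℝ) (a : ℕ → ℂ) (F : ℂ → ℂ) : Prop :=
  ∀ w : ℂ, ‖w‖ < R → HasSum (fun n => a n * w ^ n) (F w)

theorem exists_hasExpansion {R : ℝ} {F : ℂ → ℂ} (hF : DifferentiableOn ℂ F (Metric.ball 0 R)) :
    ∃ a, HasExpansion R a F := by
  refine ⟨fun n => ((n.factorial : ℂ))⁻¹ * iteratedDeriv n F 0, fun w hw => ?_⟩
  convert! hasSum_taylorSeries_on_ball hF (z := w) (by simpa using hw) using 2 with n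
  simp only [sub_zero, smul_eq_mul]
  ring

/-- The power series `∑ a_n w ^ n` converges absolutely on the disk `‖w‖ < R`. -/
def DecayAt (R : ℝ) (a : ℕ → ℂ) : Prop :=
  ∀ x : ℝ, 0 ≤ x → x < R → Summable fun n => ‖a n‖ * x ^ n

theorem HasExpansion.decay {R : ℝ} {a : ℕ → ℂ} {F : ℂ → ℂ} (h : HasExpansion R a F) :
    DecayAt R a := by
  intro x hx hxR
  have := (h x (by simpa [abs_of_nonneg hx] using hxR)).summable.norm
  simpa [abs_of_nonneg hx] using this

theorem DecayAt.hasExpansion {R : ℝ} {a : ℕ → ℂ} (h : DecayAt R a) :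
    HasExpansion R a (fun w => ∑' n, a n * w ^ n) := by
  intro w hw
  have := h ‖w‖ (norm_nonneg _) hw
  exact (Summable.of_norm (by simpa using this)).hasSum

theorem HasExpansion.mono {R R' : ℝ} {a : ℕ → ℂ} {F : ℂ → ℂ} (h : HasExpansion R a F)
    (hR : R' ≤ R) : HasExpansion R' a F := fun w hw => h w (hw.trans_le hR)

theorem HasExpansion.congr {R : ℝ} {a : ℕ → ℂ} {F G : ℂ → ℂ} (h : HasExpansion R a F)
    (hFG : ∀ w, ‖w‖ < R → F w = G w) : HasExpansion R a G :=
  fun w hw => hFG w hw ▸ h w hw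

theorem HasExpansion.hasFPowerSeriesOnBall {R : ℝ} (hR : 0 < R) {a : ℕ → ℂ} {F : ℂ → ℂ}
    (h : HasExpansion R a F) :
    HasFPowerSeriesOnBall F (FormalMultilinearSeries.ofScalars ℂ a) 0 (ENNReal.ofReal R) where
  r_le := by
    refine ENNReal.le_of_forall_nnreal_lt fun x hx => ?_
    refine FormalMultilinearSeries.le_radius_of_summable_norm _ ?_
    have hx' : (x : ℝ) < R := by
      rw [ENNReal.lt_ofReal_iff_toReal_lt (by simp)] at hx
      simpa using hx
    simpa using h.decay x x.2 hx'
  r_pos := by simpa using hR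
  hasSum := by
    intro y hy
    have hy' : ‖y‖ < R := by
      rw [Metric.eball_ofReal] at hy
      simpa using hy
    simpa [FormalMultilinearSeries.ofScalars_apply_eq, mul_comm] using h y hy'

theorem HasExpansion.unique {R : ℝ} (hR : 0 < R) {a b : ℕ → ℂ} {F : ℂ → ℂ}
    (ha : HasExpansion R a F) (hb : HasExpansion R b F) : a = b := by
  have := (ha.hasFPowerSeriesOnBall hR).hasFPowerSeriesAt.eq_formalMultilinearSeries
    (hb.hasFPowerSeriesOnBall hR).hasFPowerSeriesAt
  exact FormalMultilinearSeries.ofScalars_series_injective ℂ ℂ this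

theorem HasExpansion.differentiableOn {R : ℝ} {a : ℕ → ℂ} {F : ℂ → ℂ}
    (h : HasExpansion R a F) : DifferentiableOn ℂ F (Metric.ball 0 R) := by
  rcases le_or_gt R 0 with hR | hR
  · rw [Metric.ball_eq_empty.2 hR]
    exact fun x hx => hx.elim
  have := (h.hasFPowerSeriesOnBall hR).differentiableOn
  rwa [Metric.eball_ofReal] at this

theorem hasExpansion_monomial (m : ℕ) (R : ℝ) :
    HasExpansion R (Pi.single m 1) (fun w => w ^ m) := by
  intro w _
  convert hasSum_single (f := fun n => (Pi.single m 1 : ℕ → ℂ) n * w ^ n) m ?_ using 1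
  · simp
  · intro n hn
    simp [Pi.single_eq_of_ne hn]

theorem hasExpansion_sum_range (N : ℕ) (d : ℕ → ℂ) (R : ℝ) :
    HasExpansion R (fun n => if n ∈ Finset.range N then d n else 0)
      (fun w => ∑ n ∈ Finset.range N, d n * w ^ n) := by
  intro w _
  have h := hasSum_sum_of_ne_finset_zero (L := SummationFilter.unconditional ℕ)
    (f := fun n => (if n ∈ Finset.range N then d n else 0) * w ^ n) (s := Finset.range N)
    (fun n hn => by simp [hn])
  convert h using 1
  exact Finset.sum_congr rfl fun n hn => by simp [hn]

theorem hasExpansion_polynomial (P : Polynomial ℂ) (R : ℝ) :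
    HasExpansion R P.coeff (fun w => P.eval w) := by
  intro w _
  simp only [Polynomial.eval_eq_sum, Polynomial.sum]
  refine hasSum_sum_of_ne_finset_zero fun n hn => ?_
  rw [Polynomial.notMem_support_iff.1 hn, zero_mul]

/-! ### The coefficients `n! / (r)_n` -/

theorem ascPochhammer_eval_eq_prod (r : ℂ) (n : ℕ) :
    (ascPochhammer ℂ n).eval r = ∏ j ∈ Finset.range n, (r + j) := by
  induction n with
  | zero => simp
  | succ n ih => rw [ascPochhammer_succ_eval, Finset.prod_range_succ, ih]

theorem ascPochhammer_eval_eq_zero_iff (r : ℝ) (n : ℕ) :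
    (ascPochhammer ℂ n).eval (r : ℂ) = 0 ↔ ∃ j < n, r = -(j : ℝ) := by
  rw [ascPochhammer_eval_eq_prod, Finset.prod_eq_zero_iff]
  simp only [Finset.mem_range]
  refine exists_congr fun j => and_congr_right fun _ => ?_
  rw [add_eq_zero_iff_eq_neg]
  norm_cast

theorem coeff_ne_zero {r : ℝ} {n : ℕ} (h : ∀ j < n, r ≠ -(j : ℝ)) : coeff r n ≠ 0 := by
  have : (ascPochhammer ℂ n).eval (r : ℂ) ≠ 0 := by
    rw [Ne, ascPochhammer_eval_eq_zero_iff]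
    push Not
    exact h
  exact div_ne_zero (by exact_mod_cast n.factorial_ne_zero) this

/-- At most polynomial growth, from Euler's limit formula for `1 / Γ(r)`. -/
theorem coeff_growth (r : ℝ) : ∃ C : ℝ, 0 < C ∧ ∃ K : ℕ, ∀ n : ℕ,
    ‖coeff r n‖ ≤ C * ((n : ℝ) + 1) ^ K := by
  obtain ⟨K, hK⟩ := exists_nat_gt |r|
  have hb := (Complex.GammaSeq_tendsto_Gamma r).norm.isBoundedUnder_le
  obtain ⟨C₀, hC₀⟩ := hb
  rw [eventually_map] at hC₀
  have key : ∀ᶠ n : ℕ in atTop, ‖coeff r n‖ ≤ (|C₀| + 1) * ((n : ℝ) + 1) ^ (2 * K) := by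
    obtain ⟨N, hN⟩ := exists_nat_gt (|r| + 1)
    filter_upwards [hC₀, eventually_ge_atTop (N + 1)] with n hn hnN
    have hnN' : (N : ℝ) + 1 ≤ n := by exact_mod_cast hnN
    have hn0 : (0 : ℝ) < n := by linarith [abs_nonneg r]
    have hrn : 1 ≤ r + n := by linarith [neg_abs_le r]
    rw [GammaSeq, norm_div, norm_mul, Finset.prod_range_succ, norm_mul,
      ← ascPochhammer_eval_eq_prod] at hn
    have e1 : ‖(n : ℂ) ^ (r : ℂ)‖ = (n : ℝ) ^ r := by
      simp
    have e2 : ‖(r : ℂ) + n‖ = r + n := by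
      have : (r : ℂ) + n = ((r + n : ℝ) : ℂ) := by push_cast; rfl
      rw [this, Complex.norm_real, Real.norm_of_nonneg (by linarith)]
    have e3 : ‖coeff r n‖ = ‖((n.factorial : ℕ) : ℂ)‖ / ‖(ascPochhammer ℂ n).eval (r : ℂ)‖ := by
      rw [coeff, norm_div]
    have e4 : (n : ℝ) ^ r * ‖coeff r n‖ / (r + n) ≤ |C₀| + 1 := by
      rw [e1, e2] at hn
      rw [e3]
      calc _ = _ := ?_
        _ ≤ C₀ := hn
        _ ≤ |C₀| + 1 := by linarith [le_abs_self C₀]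
      by_cases h0 : ‖(ascPochhammer ℂ n).eval (r : ℂ)‖ = 0
      · simp [h0]
      · field_simp
    have hr0 : 0 < (n : ℝ) ^ r := Real.rpow_pos_of_pos hn0 _
    rw [div_le_iff₀ (by linarith)] at e4
    have e5 : ‖coeff r n‖ ≤ (|C₀| + 1) * (r + n) * (n : ℝ) ^ (-r) := by
      rw [Real.rpow_neg hn0.le, ← div_eq_mul_inv, le_div_iff₀ hr0]
      linarith
    refine e5.trans ?_
    have hK1 : 1 ≤ K := by
      have : (0 : ℝ) < K := (abs_nonneg r).trans_lt hK
      exact_mod_cast this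
    have e6 : (n : ℝ) ^ (-r) ≤ ((n : ℝ) + 1) ^ K := by
      calc (n : ℝ) ^ (-r) ≤ (n : ℝ) ^ (K : ℝ) :=
            Real.rpow_le_rpow_of_exponent_le (by linarith [abs_nonneg r])
              (by linarith [neg_le_abs r])
        _ = (n : ℝ) ^ K := Real.rpow_natCast _ _
        _ ≤ _ := by gcongr; linarith
    have e7 : r + n ≤ ((n : ℝ) + 1) ^ K := by
      have a1 : 1 + (K : ℝ) * n ≤ (1 + (n : ℝ)) ^ K := one_add_mul_le_pow (by linarith) K
      have a2 : r + n ≤ 1 + (K : ℝ) * n := by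
        have : (1 : ℝ) ≤ K := by exact_mod_cast hK1
        nlinarith [le_abs_self r, abs_nonneg r]
      rw [add_comm (1 : ℝ) (n : ℝ)] at a1
      exact a2.trans a1
    rw [two_mul, pow_add, mul_assoc]
    gcongr
  obtain ⟨N, hN⟩ := eventually_atTop.1 key
  refine ⟨|C₀| + 1 + ∑ n ∈ Finset.range N, ‖coeff r n‖, by positivity, 2 * K, fun n => ?_⟩
  have h1 : (1 : ℝ) ≤ ((n : ℝ) + 1) ^ (2 * K) := one_le_pow₀ (by linarith [n.cast_nonneg (α := ℝ)])
  rcases lt_or_ge n N with h | h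
  · have h2 : ‖coeff r n‖ ≤ ∑ n ∈ Finset.range N, ‖coeff r n‖ :=
      Finset.single_le_sum (f := fun n => ‖coeff r n‖) (fun _ _ => norm_nonneg _) (by simpa using h)
    have h3 : ‖coeff r n‖ ≤ |C₀| + 1 + ∑ n ∈ Finset.range N, ‖coeff r n‖ := by
      linarith [abs_nonneg C₀]
    refine h3.trans (le_mul_of_one_le_right (by positivity) h1)
  · refine (hN n h).trans ?_
    have : 0 ≤ ∑ n ∈ Finset.range N, ‖coeff r n‖ := Finset.sum_nonneg fun _ _ => norm_nonneg _
    exact mul_le_mul_of_nonneg_right (by linarith) (by positivity)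

theorem exists_pow_mul_geometric_le (K : ℕ) {q : ℝ} (hq0 : 0 ≤ q) (hq : q < 1) :
    ∃ C : ℝ, 0 < C ∧ ∀ n : ℕ, ((n : ℝ) + 1) ^ K * q ^ n ≤ C := by
  have h := (summable_pow_mul_geometric_of_norm_lt_one K
    (r := q) (by rwa [Real.norm_of_nonneg hq0])).tendsto_atTop_zero
  rcases hq0.eq_or_lt with rfl | hq0
  · refine ⟨1, one_pos, fun n => ?_⟩
    rcases n with _ | n <;> simp
  have h' := ((tendsto_add_atTop_iff_nat 1).2 h).div_const q
  obtain ⟨C, hC⟩ := h'.isBoundedUnder_le.bddAbove_range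
  refine ⟨|C| + 1, by positivity, fun n => ?_⟩
  have := hC ⟨n, rfl⟩
  simp only [pow_succ q, Nat.cast_add, Nat.cast_one] at this
  have e : ((n : ℝ) + 1) ^ K * (q ^ n * q) / q = ((n : ℝ) + 1) ^ K * q ^ n := by field_simp
  rw [e] at this
  linarith [le_abs_self C]

/-- Multiplication by `n! / (r)_n` does not change the disk of convergence. -/
theorem DecayAt.coeff_mul {R : ℝ} {a : ℕ → ℂ} (h : DecayAt R a) (r : ℝ) :
    DecayAt R (fun n => coeff r n * a n) := by
  intro x hx hxR
  obtain ⟨C, hC, K, hK⟩ := coeff_growth r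
  obtain ⟨y, hxy, hyR⟩ := exists_between hxR
  have hy : 0 < y := hx.trans_lt hxy
  obtain ⟨D, hD, hKD⟩ := exists_pow_mul_geometric_le K (div_nonneg hx hy.le)
    ((div_lt_one hy).2 hxy)
  refine Summable.of_nonneg_of_le (fun n => by positivity) (fun n => ?_)
    ((h y hy.le hyR).mul_left (C * D))
  rw [norm_mul]
  have e : x ^ n = (x / y) ^ n * y ^ n := by rw [div_pow]; field_simp
  calc ‖coeff r n‖ * ‖a n‖ * x ^ n ≤ C * ((n : ℝ) + 1) ^ K * ‖a n‖ * x ^ n := by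
        gcongr; exact hK n
    _ = C * (((n : ℝ) + 1) ^ K * (x / y) ^ n) * (‖a n‖ * y ^ n) := by rw [e]; ring
    _ ≤ C * D * (‖a n‖ * y ^ n) := by gcongr; exact hKD n

/-- The Hadamard product of expansions on the unit disk and on a larger disk converges at `1`. -/
theorem DecayAt.summable_mul {R : ℝ} (hR : 1 < R) {a b : ℕ → ℂ} (ha : DecayAt 1 a)
    (hb : DecayAt R b) : Summable fun n => ‖a n‖ * ‖b n‖ := by
  obtain ⟨x, hx1, hxR⟩ := exists_between hR
  have hx0 : 0 < x := one_pos.trans hx1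
  have h1 := (ha x⁻¹ (by positivity) (inv_lt_one_of_one_lt₀ hx1))
  have h2 := hb x hx0.le hxR
  refine (h1.mul_of_nonneg h2 (fun _ => by positivity) (fun _ => by positivity)).comp_injective
    (i := fun n : ℕ => (n, n)) (fun m n h => (Prod.ext_iff.1 h).1) |>.congr fun n => ?_
  simp only [Function.comp, inv_pow]
  field_simp

/-- The binomial series, with coefficients `(r)_n / n!`. -/
theorem hasExpansion_one_sub_cpow (r : ℝ) :
    HasExpansion 1 (fun n => (ascPochhammer ℂ n).eval (r : ℂ) / n.factorial)
      (fun w => (1 - w) ^ (-(r : ℂ))) := by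
  intro w hw
  have h := (one_div_one_sub_cpow_hasFPowerSeriesOnBall_zero (r : ℂ)).hasSum
    (y := w) (by
      rw [← ENNReal.ofReal_one, Metric.eball_ofReal]
      simpa using hw)
  simp only [FormalMultilinearSeries.ofScalars_apply_eq, zero_add, smul_eq_mul] at h
  rw [one_div, ← cpow_neg] at h
  have e : (fun n : ℕ => Ring.choose ((r : ℂ) + n - 1) n * w ^ n) =
      fun n : ℕ => (ascPochhammer ℂ n).eval (r : ℂ) / n.factorial * w ^ n := by
    funext n
    have := Ring.factorial_nsmul_multichoose_eq_ascPochhammer (r : ℂ) n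
    rw [Polynomial.ascPochhammer_smeval_eq_eval] at this
    rw [← Ring.multichoose_eq, ← this, nsmul_eq_mul,
      mul_div_cancel_left₀ _ (by exact_mod_cast n.factorial_ne_zero)]
  rw [e] at h
  exact h

/-! ### Contour integrals in the disk coordinate -/

theorem contourIntegral_congr {γ : ℝ → ℂ} {F G : ℂ → ℂ}
    (h : ∀ x ∈ Set.Icc (0 : ℝ) 1, F (γ x) = G (γ x)) :
    contourIntegral γ F = contourIntegral γ G := by
  refine intervalIntegral.integral_congr fun x hx => ?_
  rw [Set.uIcc_of_le zero_le_one] at hx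
  simp only [h x hx]

theorem contourIntegral_const_mul (γ : ℝ → ℂ) (c : ℂ) (F : ℂ → ℂ) :
    contourIntegral γ (fun z => c * F z) = c * contourIntegral γ F := by
  simp only [contourIntegral, mul_assoc, intervalIntegral.integral_const_mul]

theorem IsContour.intervalIntegrable {γ : ℝ → ℂ} (hγ : IsContour γ) {F : ℂ → ℂ}
    (hF : ContinuousOn F (γ '' Set.Icc 0 1)) :
    IntervalIntegrable (fun x => F (γ x) * deriv γ x) volume 0 1 := by
  refine hγ.integrable.continuousOn_mul ?_
  rw [Set.uIcc_of_le zero_le_one]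
  exact hF.comp hγ.cont (Set.mapsTo_image _ _)

theorem IsContour.contourIntegral_add {γ : ℝ → ℂ} (hγ : IsContour γ) {F G : ℂ → ℂ}
    (hF : ContinuousOn F (γ '' Set.Icc 0 1)) (hG : ContinuousOn G (γ '' Set.Icc 0 1)) :
    contourIntegral γ (fun z => F z + G z) = contourIntegral γ F + contourIntegral γ G := by
  simp only [contourIntegral, add_mul]
  exact intervalIntegral.integral_add (hγ.intervalIntegrable hF) (hγ.intervalIntegrable hG)

theorem IsContour.contourIntegral_eq_zero {γ : ℝ → ℂ} (hγ : IsContour γ) {P F : ℂ → ℂ}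
    (hP : ∀ x ∈ Set.Icc (0 : ℝ) 1, HasDerivAt P (F (γ x)) (γ x))
    (hF : ContinuousOn F (γ '' Set.Icc 0 1)) : contourIntegral γ F = 0 := by
  obtain ⟨s, hs⟩ := hγ.diff
  rw [contourIntegral, integral_eq_of_hasDerivAt_off_countable_of_le (P ∘ γ) _ zero_le_one
    s.countable_toSet ?_ ?_ (hγ.intervalIntegrable hF)]
  · simp [hγ.closed]
  · exact fun x hx => (hP x hx).continuousAt.comp_continuousWithinAt (hγ.cont x hx)
  · rintro x ⟨hx, hxs⟩
    exact (hP x (Set.Ioo_subset_Icc_self hx)).comp x (hs x hx hxs).hasDerivAt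

/-- Termwise integration of a series that converges normally on a contour. -/
theorem IsContour.hasSum_contourIntegral {γ : ℝ → ℂ} (hγ : IsContour γ) {ι : Type*} [Countable ι]
    {F : ι → ℂ → ℂ} {G : ℂ → ℂ} (hF : ∀ i, ContinuousOn (F i) (γ '' Set.Icc 0 1))
    {u : ι → ℝ} (hu : Summable u) (hb : ∀ i, ∀ x ∈ Set.Icc (0 : ℝ) 1, ‖F i (γ x)‖ ≤ u i)
    (hs : ∀ x ∈ Set.Icc (0 : ℝ) 1, HasSum (fun i => F i (γ x)) (G (γ x))) :
    HasSum (fun i => contourIntegral γ (F i)) (contourIntegral γ G) := by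
  have hsub : ∀ x ∈ Set.uIoc (0 : ℝ) 1, x ∈ Set.Icc (0 : ℝ) 1 := fun x hx => by
    rw [Set.uIoc_of_le zero_le_one] at hx
    exact Set.Ioc_subset_Icc_self hx
  refine intervalIntegral.hasSum_integral_of_dominated_convergence
    (fun i x => u i * ‖deriv γ x‖) (fun i => ?_) (fun i => ?_) ?_ ?_ ?_
  · rw [Set.uIoc_of_le zero_le_one]
    exact (hγ.intervalIntegrable (hF i)).aestronglyMeasurable
  · refine .of_forall fun x hx => ?_
    rw [norm_mul]
    gcongr
    exact hb i x (hsub x hx)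
  · exact .of_forall fun x _ => hu.mul_right _
  · simp only [tsum_mul_right]
    exact hγ.integrable.norm.const_mul _
  · exact .of_forall fun x hx => (hs x (hsub x hx)).mul_right _

/-- A contour in the punctured plane that encircles the origin once in the positive direction. -/
structure WindsOnce (δ : ℝ → ℂ) : Prop where
  contour : IsContour δ
  ne_zero : ∀ x ∈ Set.Icc (0 : ℝ) 1, δ x ≠ 0
  winding : contourIntegral δ (fun w => w⁻¹) = 2 * Real.pi * I

theorem WindsOnce.continuousOn_inv {δ : ℝ → ℂ} (hδ : WindsOnce δ) :
    ContinuousOn (fun w : ℂ => w⁻¹) (δ '' Set.Icc 0 1) := by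
  refine continuousOn_inv₀.mono ?_
  rintro _ ⟨x, hx, rfl⟩
  exact hδ.ne_zero x hx

theorem WindsOnce.contourIntegral_zpow {δ : ℝ → ℂ} (hδ : WindsOnce δ) (k : ℤ) :
    contourIntegral δ (fun w => w ^ k * w⁻¹) = if k = 0 then 2 * Real.pi * I else 0 := by
  split_ifs with hk
  · simp [hk, hδ.winding]
  refine hδ.contour.contourIntegral_eq_zero (P := fun w => w ^ k / k) (fun x hx => ?_) ?_
  · have h := (hasDerivAt_zpow k (δ x) (.inl (hδ.ne_zero x hx))).div_const (k : ℂ)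
    convert! h using 1
    have : (k : ℂ) ≠ 0 := by exact_mod_cast hk
    rw [zpow_sub_one₀ (hδ.ne_zero x hx)]
    field_simp
  · refine ContinuousOn.mul ?_ hδ.continuousOn_inv
    refine (continuousOn_zpow₀ k).mono ?_
    rintro _ ⟨x, hx, rfl⟩
    exact hδ.ne_zero x hx

/-- The constant term of the product of a power series in `w` and a power series in `w⁻¹`. -/
theorem WindsOnce.contourIntegral_mul {δ : ℝ → ℂ} (hδ : WindsOnce δ) {m M : ℝ} (hm : 0 < m)
    (hmM : ∀ x ∈ Set.Icc (0 : ℝ) 1, m ≤ ‖δ x‖ ∧ ‖δ x‖ ≤ M) {a b : ℕ → ℂ} {F G : ℂ → ℂ}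
    (ha : Summable fun n => ‖a n‖ * M ^ n) (hb : Summable fun n => ‖b n‖ * m⁻¹ ^ n)
    (hF : ∀ x ∈ Set.Icc (0 : ℝ) 1, HasSum (fun n => a n * δ x ^ n) (F (δ x)))
    (hG : ∀ x ∈ Set.Icc (0 : ℝ) 1, HasSum (fun n => b n * (δ x)⁻¹ ^ n) (G (δ x))) :
    HasSum (fun n => a n * b n)
      (1 / (2 * Real.pi * I) * contourIntegral δ (fun w => F w * G w * w⁻¹)) := by
  have hM : 0 < M := by
    obtain ⟨h1, h2⟩ := hmM 0 (by simp)
    linarith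
  have key := hδ.contour.hasSum_contourIntegral
    (F := fun (p : ℕ × ℕ) w => (a p.1 * w ^ p.1) * (b p.2 * w⁻¹ ^ p.2) * w⁻¹)
    (G := fun w => F w * G w * w⁻¹)
    (u := fun p => (‖a p.1‖ * M ^ p.1) * (‖b p.2‖ * m⁻¹ ^ p.2) * m⁻¹) ?_ ?_ ?_ ?_
  · have e : (fun p : ℕ × ℕ => contourIntegral δ
        (fun w => (a p.1 * w ^ p.1) * (b p.2 * w⁻¹ ^ p.2) * w⁻¹)) =
        fun p => if p.1 = p.2 then a p.1 * b p.2 * (2 * Real.pi * I) else 0 := by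
      funext p
      have e1 : contourIntegral δ (fun w => (a p.1 * w ^ p.1) * (b p.2 * w⁻¹ ^ p.2) * w⁻¹) =
          contourIntegral δ (fun w => (a p.1 * b p.2) * (w ^ ((p.1 : ℤ) - p.2) * w⁻¹)) := by
        refine contourIntegral_congr fun x hx => ?_
        rw [zpow_sub₀ (hδ.ne_zero x hx), zpow_natCast, zpow_natCast, inv_pow]
        ring
      rw [e1, contourIntegral_const_mul, hδ.contourIntegral_zpow]
      simp only [sub_eq_zero, Nat.cast_inj, mul_ite, mul_zero]
    rw [e] at key
    have inj : Function.Injective fun n : ℕ => (n, n) := fun m n h => (Prod.ext_iff.1 h).1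
    rw [← inj.hasSum_iff] at key
    · have h2 : (2 * Real.pi * I : ℂ) ≠ 0 := Complex.two_pi_I_ne_zero
      convert! key.mul_left (1 / (2 * Real.pi * I)) using 2 with n
      simp only [Function.comp, if_true]
      field_simp
    · rintro ⟨i, j⟩ hij
      rw [if_neg]
      intro h
      exact hij ⟨i, Prod.ext rfl h⟩
  · intro p
    have h1 : ContinuousOn (fun w : ℂ => a p.1 * w ^ p.1) (δ '' Set.Icc 0 1) := by fun_prop
    exact (h1.mul (continuousOn_const.mul (hδ.continuousOn_inv.pow _))).mul hδ.continuousOn_inv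
  · exact (ha.mul_of_nonneg hb (fun _ => by positivity) (fun _ => by positivity)).mul_right _
  · intro p x hx
    obtain ⟨h1, h2⟩ := hmM x hx
    simp only [norm_mul, norm_pow, norm_inv]
    gcongr
  · intro x hx
    have hsum : Summable fun p : ℕ × ℕ => (a p.1 * δ x ^ p.1) * (b p.2 * (δ x)⁻¹ ^ p.2) :=
      summable_mul_of_summable_norm (f := fun n => a n * δ x ^ n)
        (g := fun n => b n * (δ x)⁻¹ ^ n) (hF x hx).summable.norm (hG x hx).summable.norm
    have h : HasSum (fun p : ℕ × ℕ => (a p.1 * δ x ^ p.1) * (b p.2 * (δ x)⁻¹ ^ p.2))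
        (F (δ x) * G (δ x)) := 
      HasSum.mul (f := fun n => a n * δ x ^ n) (g := fun n => b n * (δ x)⁻¹ ^ n)
        (hF x hx) (hG x hx) hsum
    exact h.mul_right _

theorem add_I_ne_zero {z : ℂ} (hz : 0 < z.im) : z + I ≠ 0 := by
  intro h
  have := congrArg Complex.im h
  simp at this
  linarith

theorem hasDerivAt_cay {z : ℂ} (hz : 0 < z.im) : HasDerivAt cay (2 * I / (z + I) ^ 2) z := by
  have h := ((hasDerivAt_id z).sub_const I).div ((hasDerivAt_id z).add_const I) (add_I_ne_zero hz)
  convert! h using 1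
  simp only [id]
  congr 1
  ring

/-- A contour in the upper half-plane and its image in the disk. -/
theorem contourIntegral_cay {γ : ℝ → ℂ} (hγ : IsContour γ)
    (him : ∀ x ∈ Set.Icc (0 : ℝ) 1, 0 < (γ x).im) (F : ℂ → ℂ) :
    contourIntegral (cay ∘ γ) F = contourIntegral γ (fun z => F (cay z) * (2 * I / (z + I) ^ 2)) := by
  obtain ⟨s, hs⟩ := hγ.diff
  refine intervalIntegral.integral_congr_ae ?_
  have h0 : ∀ᵐ x : ℝ, x ∉ (s ∪ {1} : Set ℝ) :=
    (s.countable_toSet.union (Set.countable_singleton 1)).ae_notMem _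
  filter_upwards [h0] with x hx hx'
  rw [Set.uIoc_of_le zero_le_one] at hx'
  simp only [Set.mem_union, Finset.mem_coe, Set.mem_singleton_iff, not_or] at hx
  have hxI : x ∈ Set.Ioo (0 : ℝ) 1 := ⟨hx'.1, lt_of_le_of_ne hx'.2 hx.2⟩
  have := ((hasDerivAt_cay (him x (Set.Ioo_subset_Icc_self hxI))).comp x
    (hs x hxI hx.1).hasDerivAt).deriv
  rw [this]
  simp only [Function.comp]
  ring

theorem Encircles.isContour_cay {lo hi : ℝ} {γ : ℝ → ℂ} (h : Encircles lo hi γ) :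
    IsContour (cay ∘ γ) := by
  have hc : ContinuousOn (cay ∘ γ) (Set.Icc 0 1) := fun x hx =>
    (hasDerivAt_cay (h.mem x hx).1).continuousAt.comp_continuousWithinAt (h.contour.cont x hx)
  obtain ⟨s, hs⟩ := h.contour.diff
  have hd : ∀ x ∈ Set.Ioo (0 : ℝ) 1, x ∉ s → HasDerivAt (cay ∘ γ)
      (2 * I / (γ x + I) ^ 2 * deriv γ x) x := fun x hx hxs =>
    (hasDerivAt_cay (h.mem x (Set.Ioo_subset_Icc_self hx)).1).comp x (hs x hx hxs).hasDerivAt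
  refine ⟨hc, by simp [h.contour.closed],
    ⟨s, fun x hx hxs => (hd x hx hxs).differentiableAt⟩, ?_⟩
  have hcont : ContinuousOn (fun z : ℂ => 2 * I / (z + I) ^ 2) (γ '' Set.Icc 0 1) := by
    refine ContinuousOn.div (by fun_prop) (by fun_prop) ?_
    rintro _ ⟨x, hx, rfl⟩
    exact pow_ne_zero 2 (add_I_ne_zero (h.mem x hx).1)
  refine (h.contour.intervalIntegrable hcont).congr_ae ?_
  rw [Set.uIoc_of_le zero_le_one]
  have h0 : ∀ᵐ x : ℝ, x ∉ (s ∪ {1} : Set ℝ) :=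
    (s.countable_toSet.union (Set.countable_singleton 1)).ae_notMem _
  filter_upwards [ae_restrict_mem measurableSet_Ioc, ae_restrict_of_ae h0] with x hx' hx
  simp only [Set.mem_union, Finset.mem_coe, Set.mem_singleton_iff, not_or] at hx
  exact ((hd x ⟨hx'.1, lt_of_le_of_ne hx'.2 hx.2⟩ hx.1).deriv).symm

theorem Encircles.windsOnce {lo hi : ℝ} (hlo : 0 ≤ lo) {γ : ℝ → ℂ} (h : Encircles lo hi γ) :
    WindsOnce (cay ∘ γ) := by
  have hne : ∀ x ∈ Set.Icc (0 : ℝ) 1, cay (γ x) ≠ 0 := fun x hx =>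
    norm_pos_iff.1 (hlo.trans_lt (h.mem x hx).2.1)
  refine ⟨h.isContour_cay, hne, ?_⟩
  rw [contourIntegral_cay h.contour (fun x hx => (h.mem x hx).1), ← h.winding]
  have hI : ∀ x ∈ Set.Icc (0 : ℝ) 1, γ x + I ≠ 0 := fun x hx => add_I_ne_zero (h.mem x hx).1
  have hI' : ∀ x ∈ Set.Icc (0 : ℝ) 1, γ x - I ≠ 0 := fun x hx h0 => hne x hx (by simp [cay, h0])
  have c1 : ContinuousOn (fun z : ℂ => (z - I)⁻¹) (γ '' Set.Icc 0 1) := by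
    refine ContinuousOn.inv₀ (by fun_prop) ?_
    rintro _ ⟨x, hx, rfl⟩
    exact hI' x hx
  have c2 : ContinuousOn (fun z : ℂ => -(z + I)⁻¹) (γ '' Set.Icc 0 1) := by
    refine ContinuousOn.neg (ContinuousOn.inv₀ (by fun_prop) ?_)
    rintro _ ⟨x, hx, rfl⟩
    exact hI x hx
  have hz : contourIntegral γ (fun z => -(z + I)⁻¹) = 0 := by
    refine h.contour.contourIntegral_eq_zero (P := fun z => -Complex.log (-I * (z + I)))
      (fun x hx => ?_) c2
    have h1 : HasDerivAt (fun z : ℂ => -I * (z + I)) (-I) (γ x) := by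
      simpa using ((hasDerivAt_id (γ x)).add_const I).const_mul (-I)
    have h2 : -I * (γ x + I) ∈ slitPlane := by
      refine .inl ?_
      simp
      linarith [(h.mem x hx).1]
    convert! (h1.clog h2).neg using 1
    rw [mul_comm, div_eq_mul_inv, mul_inv, ← mul_assoc]
    have : -I ≠ 0 := neg_ne_zero.2 I_ne_zero
    field_simp
  rw [← add_zero (contourIntegral γ fun z => (z - I)⁻¹), ← hz, ← h.contour.contourIntegral_add c1 c2]
  refine contourIntegral_congr fun x hx => ?_
  have h1 := hI x hx
  have h2 := hI' x hx
  rw [cay]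
  field_simp
  ring

/-- A contour strictly inside an annulus stays in a closed annulus inside it. -/
theorem Encircles.exists_bounds {lo hi : ℝ} {γ : ℝ → ℂ} (h : Encircles lo hi γ) :
    ∃ m M, lo < m ∧ M < hi ∧ ∀ x ∈ Set.Icc (0 : ℝ) 1, m ≤ ‖cay (γ x)‖ ∧ ‖cay (γ x)‖ ≤ M := by
  have hne : (Set.Icc (0 : ℝ) 1).Nonempty := ⟨0, by simp⟩
  have hc : ContinuousOn (fun x => ‖cay (γ x)‖) (Set.Icc 0 1) := h.isContour_cay.cont.norm
  obtain ⟨x, hx, hmin⟩ := isCompact_Icc.exists_isMinOn hne hc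
  obtain ⟨y, hy, hmax⟩ := isCompact_Icc.exists_isMaxOn hne hc
  exact ⟨_, _, (h.mem x hx).2.1, (h.mem y hy).2.2, fun z hz => ⟨hmin hz, hmax hz⟩⟩

theorem cayInv_eq_inv (z : ℂ) : cayInv z = (cay z)⁻¹ := by rw [cay, cayInv, inv_div]

/-- `σ_r f⁻(z) = w⁻¹ ∑ n! / (r)_n d_n w⁻ⁿ` outside the contour. -/
theorem hasSum_sigmaInt (r : ℝ) {R ρ : ℝ} (hR : 1 < R) {Φ : ℂ → ℂ} {d : ℕ → ℂ}
    (hd : HasExpansion R d Φ) {γ : ℝ → ℂ} (hγ : Encircles R⁻¹ ρ γ) {z : ℂ} (hz : ρ < ‖cay z‖) :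
    HasSum (fun n => coeff r n * d n * (cay z)⁻¹ ^ n) (cay z * sigmaInt r Φ γ z) := by
  obtain ⟨m, M, hm, hM, hmM⟩ := hγ.exists_bounds
  have hR0 : 0 < R⁻¹ := by positivity
  have hm0 : 0 < m := hR0.trans hm
  have hM0 : 0 < M := by
    obtain ⟨h1, h2⟩ := hmM 0 (by simp)
    linarith
  have hw0 : 0 < ‖cay z‖ := by linarith
  have hw : cay z ≠ 0 := norm_pos_iff.1 hw0
  have hδ := hγ.windsOnce hR0.le
  have dec1 : DecayAt 1 (coeff r) := by
    have : DecayAt 1 (fun _ => (1 : ℂ)) := fun x hx hx1 => by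
      simpa using summable_geometric_of_lt_one hx hx1
    simpa using this.coeff_mul r
  have hq : M / ‖cay z‖ < 1 := (div_lt_one hw0).2 (by linarith)
  have key := hδ.contourIntegral_mul (m := m) (M := M) hm0 hmM
    (a := fun n => coeff r n * (cay z)⁻¹ ^ n) (b := d)
    (F := fun w => ordinaryHypergeometric (1 : ℂ) 1 (r : ℂ) (w / cay z))
    (G := fun w => Φ w⁻¹) ?_ ?_ ?_ ?_
  · convert! key using 1
    · funext n
      ring
    · rw [contourIntegral_cay hγ.contour (fun x hx => (hγ.mem x hx).1), sigmaInt,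
        ← contourIntegral_const_mul, ← contourIntegral_const_mul, ← contourIntegral_const_mul]
      refine contourIntegral_congr fun x hx => ?_
      have h1 : γ x + I ≠ 0 := add_I_ne_zero (hγ.mem x hx).1
      have h2 : γ x - I ≠ 0 := fun h0 => hδ.ne_zero x hx (by simp [cay, h0])
      have h3 : z + I ≠ 0 := fun h0 => hw (by simp [cay, h0])
      have h4 : z - I ≠ 0 := fun h0 => hw (by simp [cay, h0])
      have h5 : (γ x) ^ 2 + 1 = (γ x - I) * (γ x + I) := by
        linear_combination Complex.I_sq
      have h6 : (γ x - I) * (z + I) / ((γ x + I) * (z - I)) = cay (γ x) / cay z := by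
        rw [cay, cay]
        field_simp
      rw [h5, h6, cayInv_eq_inv]
      have h7 : cay z * (1 / (Real.pi : ℂ) * ((z + I) / (z - I))) = 1 / Real.pi := by
        rw [cay]
        field_simp
      have hpi : (Real.pi : ℂ) ≠ 0 := by exact_mod_cast Real.pi_ne_zero
      rw [← mul_assoc, h7]
      have h8 : (cay (γ x))⁻¹ * (2 * I / (γ x + I) ^ 2) = 2 * I / ((γ x - I) * (γ x + I)) := by
        rw [cay]
        field_simp
      rw [mul_assoc (_ * _) ((cay (γ x))⁻¹), h8]
      field_simp
  · refine (dec1 _ (by positivity) hq).congr fun n => ?_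
    rw [norm_mul, norm_pow, norm_inv, div_pow, inv_pow]
    field_simp
  · exact hd.decay m⁻¹ (by positivity) (inv_lt_of_inv_lt₀ (by positivity) hm)
  · intro x hx
    have h1 : ‖cay (γ x) / cay z‖ < 1 := by
      rw [norm_div]
      exact lt_of_le_of_lt (by gcongr; exact (hmM x hx).2) hq
    have h2 := dec1.hasExpansion _ h1
    simp only [ordinaryHypergeometric_eq_tsum, ascPochhammer_eval_one, smul_eq_mul, Function.comp]
    convert h2 using 1
    · funext n
      rw [div_pow, inv_pow]
      ring
    · refine tsum_congr fun n => ?_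
      have : (n.factorial : ℂ) ≠ 0 := by exact_mod_cast n.factorial_ne_zero
      rw [coeff]
      field_simp
  · intro x hx
    refine hd _ ?_
    rw [norm_inv]
    exact inv_lt_of_inv_lt₀ (by positivity) (hm.trans_le (hmM x hx).1)

/-! ### Expansions on the half-planes -/

/-- The inverse of the disk coordinate `cay`. -/
def icay (w : ℂ) : ℂ := I * (1 + w) / (1 - w)

theorem one_sub_ne_zero_of_norm_lt {w : ℂ} (hw : ‖w‖ < 1) : 1 - w ≠ 0 := by
  intro h
  rw [sub_eq_zero] at h
  rw [← h] at hw
  simp at hw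

theorem icay_im_pos {w : ℂ} (hw : ‖w‖ < 1) : 0 < (icay w).im := by
  have h0 := one_sub_ne_zero_of_norm_lt hw
  have h1 : 0 < normSq (1 - w) := normSq_pos.2 h0
  have h2 : normSq w < 1 := by
    rw [normSq_eq_norm_sq]
    exact pow_lt_one₀ (norm_nonneg _) hw two_ne_zero
  have h3 : (icay w).im = (1 - normSq w) / normSq (1 - w) := by
    rw [icay, div_im, ← sub_div]
    congr 1
    simp [normSq_apply]
    ring
  rw [h3]
  exact div_pos (by linarith) h1

theorem cay_icay {w : ℂ} (hw : ‖w‖ < 1) : cay (icay w) = w := by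
  have h0 := one_sub_ne_zero_of_norm_lt hw
  have e1 : icay w - I = 2 * I * w / (1 - w) := by
    rw [icay]; field_simp; ring
  have e2 : icay w + I = 2 * I / (1 - w) := by
    rw [icay]; field_simp; ring
  rw [cay, e1, e2]
  field_simp

theorem icay_cay {z : ℂ} (hz : 0 < z.im) : icay (cay z) = z := by
  have h0 := add_I_ne_zero hz
  have e1 : 1 + cay z = 2 * z / (z + I) := by
    rw [cay]; field_simp; ring
  have e2 : 1 - cay z = 2 * I / (z + I) := by
    rw [cay]; field_simp; ring
  rw [icay, e1, e2]
  field_simp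

theorem norm_cay_lt_one {z : ℂ} (hz : 0 < z.im) : ‖cay z‖ < 1 := by
  rw [cay, norm_div, div_lt_one (norm_pos_iff.2 (add_I_ne_zero hz))]
  rw [← sq_lt_sq₀ (norm_nonneg _) (norm_nonneg _), ← normSq_eq_norm_sq, ← normSq_eq_norm_sq]
  simp [normSq_apply]
  nlinarith

theorem cayInv_eq_conj (t : ℂ) : cayInv t = conj (cay (conj t)) := by
  simp [cay, cayInv, sub_eq_add_neg]

theorem cayInv_conj (z : ℂ) : cayInv (conj z) = conj (cay z) := by
  simp [cay, cayInv, sub_eq_add_neg]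

theorem LHP.conj_im_pos (t : LHP) : 0 < (conj (t : ℂ)).im := by
  have := t.2
  simp only [conj_im]
  linarith

theorem norm_cayInv_lt_one (t : LHP) : ‖cayInv t‖ < 1 := by
  rw [cayInv_eq_conj, norm_conj]
  exact norm_cay_lt_one t.conj_im_pos

/-- The point of the upper half-plane with disk coordinate `w`. -/
def upperPt (w : ℂ) (hw : ‖w‖ < 1) : ℍ := ⟨icay w, icay_im_pos hw⟩

theorem cay_upperPt {w : ℂ} (hw : ‖w‖ < 1) : cay (upperPt w hw) = w := cay_icay hw

/-- The point of the lower half-plane with inverse disk coordinate `u`. -/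
def lowerPt (u : ℂ) (hu : ‖u‖ < 1) : LHP :=
  ⟨conj (icay (conj u)), by
    have := icay_im_pos (w := conj u) (by rwa [norm_conj])
    simp only [conj_im]
    linarith⟩

theorem cayInv_lowerPt {u : ℂ} (hu : ‖u‖ < 1) : cayInv (lowerPt u hu) = u := by
  rw [lowerPt, cayInv_conj, cay_icay (by rwa [norm_conj]), conj_conj]

theorem lowerPt_cayInv (t : LHP) : lowerPt (cayInv t) (norm_cayInv_lt_one t) = t := by
  apply Subtype.ext
  rw [lowerPt]
  simp only
  rw [cayInv_eq_conj, conj_conj, icay_cay t.conj_im_pos, conj_conj]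

/-- A function on the upper half-plane, in the disk coordinate. -/
def diskUpper (h : ℍ → ℂ) (w : ℂ) : ℂ := h (ofComplex (icay w))

theorem diskUpper_cay (h : ℍ → ℂ) (z : ℍ) : diskUpper h (cay z) = h z := by
  rw [diskUpper, icay_cay z.im_pos, ofComplex_apply]

theorem diskUpper_apply (h : ℍ → ℂ) {w : ℂ} (hw : ‖w‖ < 1) : diskUpper h w = h (upperPt w hw) := by
  rw [diskUpper, ofComplex_apply_of_im_pos (icay_im_pos hw)]
  rfl

open Classical in
/-- A function on the lower half-plane, in the inverse disk coordinate. -/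
def diskLower (f : LHP → ℂ) (u : ℂ) : ℂ := if hu : ‖u‖ < 1 then f (lowerPt u hu) else 0

theorem diskLower_apply (f : LHP → ℂ) {u : ℂ} (hu : ‖u‖ < 1) :
    diskLower f u = f (lowerPt u hu) := by
  rw [diskLower, dif_pos hu]

theorem diskLower_cayInv (f : LHP → ℂ) (t : LHP) : diskLower f (cayInv t) = f t := by
  rw [diskLower_apply f (norm_cayInv_lt_one t), lowerPt_cayInv]

theorem expansionUpper_iff {h : ℍ → ℂ} {c : ℕ → ℂ} :
    ExpansionUpper h c ↔ HasExpansion 1 c (diskUpper h) := by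
  constructor
  · intro H w hw
    have := H (upperPt w hw)
    rwa [cay_upperPt, ← diskUpper_apply h hw] at this
  · intro H z
    have := H (cay z) (norm_cay_lt_one z.im_pos)
    rwa [diskUpper_cay] at this

theorem expansionLower_iff {f : LHP → ℂ} {d : ℕ → ℂ} :
    ExpansionLower f d ↔ HasExpansion 1 d (diskLower f) := by
  constructor
  · intro H u hu
    have := H (lowerPt u hu)
    rwa [cayInv_lowerPt, ← diskLower_apply f hu] at this
  · intro H t
    have := H (cayInv t) (norm_cayInv_lt_one t)
    rwa [diskLower_cayInv] at this

theorem ExpansionUpper.unique {h : ℍ → ℂ} {c c' : ℕ → ℂ} (H : ExpansionUpper h c)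
    (H' : ExpansionUpper h c') : c = c' :=
  (expansionUpper_iff.1 H).unique one_pos (expansionUpper_iff.1 H')

theorem ExpansionLower.unique {f : LHP → ℂ} {d d' : ℕ → ℂ} (H : ExpansionLower f d)
    (H' : ExpansionLower f d') : d = d' :=
  (expansionLower_iff.1 H).unique one_pos (expansionLower_iff.1 H')

theorem mem_holUpper_iff_diskUpper {h : ℍ → ℂ} :
    h ∈ holUpper ↔ DifferentiableOn ℂ (diskUpper h) (Metric.ball 0 1) := by
  constructor
  · intro H
    have H' : DifferentiableOn ℂ (h ∘ ofComplex) {z | 0 < z.im} := H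
    have hd : DifferentiableOn ℂ icay (Metric.ball 0 1) := by
      refine DifferentiableOn.div (by fun_prop) (by fun_prop) ?_
      exact fun w hw => one_sub_ne_zero_of_norm_lt (by simpa using hw)
    exact H'.comp hd fun w hw => icay_im_pos (by simpa using hw)
  · intro H
    have hc : DifferentiableOn ℂ cay {z : ℂ | 0 < z.im} := fun z hz =>
      (hasDerivAt_cay hz).differentiableAt.differentiableWithinAt
    have H' := H.comp hc fun z hz => by simpa using norm_cay_lt_one hz
    refine DifferentiableOn.congr H' fun z hz => ?_
    have hz' : 0 < z.im := hz
    simp only [Function.comp, diskUpper, icay_cay hz']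

theorem mem_holUpper_iff {h : ℍ → ℂ} : h ∈ holUpper ↔ ∃ c, ExpansionUpper h c := by
  rw [mem_holUpper_iff_diskUpper]
  constructor
  · intro H
    obtain ⟨c, hc⟩ := exists_hasExpansion H
    exact ⟨c, expansionUpper_iff.2 hc⟩
  · rintro ⟨c, hc⟩
    exact (expansionUpper_iff.1 hc).differentiableOn

theorem ExtendsTo.expansionLower {f : LHP → ℂ} {R : ℝ} {Φ : ℂ → ℂ} (hΦ : ExtendsTo f R Φ)
    {d : ℕ → ℂ} (hd : HasExpansion R d Φ) : ExpansionLower f d := fun t => by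
  rw [hΦ.eq t]
  exact hd _ ((norm_cayInv_lt_one t).trans hΦ.one_lt)

theorem ExtendsTo.hasExpansion {f : LHP → ℂ} {R : ℝ} {Φ : ℂ → ℂ} (hΦ : ExtendsTo f R Φ)
    {d : ℕ → ℂ} (hd : ExpansionLower f d) : HasExpansion R d Φ := by
  obtain ⟨d', hd'⟩ := exists_hasExpansion hΦ.diff
  rwa [hd.unique (hΦ.expansionLower hd')]

/-- A holomorphic function on the lower half-plane extends across the real projective line if and only if
its expansion in `w⁻¹` converges beyond the unit disk. -/
theorem mem_analyticLower_iff {f : LHP → ℂ} :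
    f ∈ analyticLower ↔ ∃ R : ℝ, 1 < R ∧ ∃ d, DecayAt R d ∧ ExpansionLower f d := by
  constructor
  · rintro ⟨R, Φ, hΦ⟩
    obtain ⟨d, hd⟩ := exists_hasExpansion hΦ.diff
    exact ⟨R, hΦ.one_lt, d, hd.decay, hΦ.expansionLower hd⟩
  · rintro ⟨R, hR, d, hd, hf⟩
    refine ⟨R, fun u => ∑' n, d n * u ^ n, hR, hd.hasExpansion.differentiableOn, fun t => ?_⟩
    exact (hf t).tsum_eq.symm

theorem ExpansionLower.decay {f : LHP → ℂ} (hf : f ∈ analyticLower) {d : ℕ → ℂ}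
    (hd : ExpansionLower f d) : ∃ R : ℝ, 1 < R ∧ DecayAt R d := by
  obtain ⟨R, hR, d', hd', H⟩ := mem_analyticLower_iff.1 hf
  exact ⟨R, hR, by rwa [hd.unique H]⟩

theorem ExpansionUpper.add {h k : ℍ → ℂ} {c e : ℕ → ℂ} (H : ExpansionUpper h c)
    (K : ExpansionUpper k e) : ExpansionUpper (h + k) (c + e) := fun z => by
  simpa [add_mul] using (H z).add (K z)

theorem ExpansionUpper.smul {h : ℍ → ℂ} {c : ℕ → ℂ} (H : ExpansionUpper h c) (x : ℂ) :
    ExpansionUpper (x • h) (x • c) := fun z => by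
  simpa [mul_assoc] using (H z).mul_left x

theorem ExpansionLower.add {f g : LHP → ℂ} {d e : ℕ → ℂ} (H : ExpansionLower f d)
    (K : ExpansionLower g e) : ExpansionLower (f + g) (d + e) := fun t => by
  simpa [add_mul] using (H t).add (K t)

theorem ExpansionLower.smul {f : LHP → ℂ} {d : ℕ → ℂ} (H : ExpansionLower f d) (x : ℂ) :
    ExpansionLower (x • f) (x • d) := fun t => by
  simpa [mul_assoc] using (H t).mul_left x

/-- The coefficients in the expansion of a holomorphic function on the upper half-plane (an
arbitrary sequence if there is no expansion). -/
def upperCoef (h : ℍ → ℂ) : ℕ → ℂ := Classical.epsilon (ExpansionUpper h)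

/-- The coefficients in the expansion of a holomorphic function on the lower half-plane (an
arbitrary sequence if there is no expansion). -/
def lowerCoef (f : LHP → ℂ) : ℕ → ℂ := Classical.epsilon (ExpansionLower f)

theorem expansionUpper_upperCoef {h : ℍ → ℂ} (hh : h ∈ holUpper) :
    ExpansionUpper h (upperCoef h) := Classical.epsilon_spec (mem_holUpper_iff.1 hh)

theorem ExpansionUpper.upperCoef_eq {h : ℍ → ℂ} {c : ℕ → ℂ} (H : ExpansionUpper h c) :
    upperCoef h = c := (Classical.epsilon_spec ⟨c, H⟩ : ExpansionUpper h (upperCoef h)).unique H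

theorem ExpansionLower.lowerCoef_eq {f : LHP → ℂ} {d : ℕ → ℂ} (H : ExpansionLower f d) :
    lowerCoef f = d := (Classical.epsilon_spec ⟨d, H⟩ : ExpansionLower f (lowerCoef f)).unique H

theorem expansionLower_lowerCoef {f : LHP → ℂ} (hf : f ∈ analyticLower) :
    ExpansionLower f (lowerCoef f) := by
  obtain ⟨R, hR, d, hd, H⟩ := mem_analyticLower_iff.1 hf
  rwa [H.lowerCoef_eq]

/-! ### The pairing -/

theorem summable_coeff_mul (r : ℝ) {R : ℝ} (hR : 1 < R) {c d : ℕ → ℂ} (hc : DecayAt 1 c)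
    (hd : DecayAt R d) : Summable fun n => coeff r n * c n * d n := by
  refine Summable.of_norm ?_
  simpa using (hc.coeff_mul r).summable_mul hR hd

/-- The bilinear form `∑ n! / (r)_n c_n d_n` in terms of the normalized functions `h⁺` and `f⁻`.
For `r = -a` with `a ∈ ℕ` the coefficients with `n > a` vanish, by the convention `x / 0 = 0`, so
that the same formula describes the form on polynomials. -/
def pairing (r : ℝ) : holUpper →ₗ[ℂ] analyticLower →ₗ[ℂ] ℂ :=
  have hs (h : holUpper) (f : analyticLower) :
      Summable fun n => coeff r n * upperCoef h n * lowerCoef f n := by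
    obtain ⟨R, hR, hd⟩ := (expansionLower_lowerCoef f.2).decay f.2
    exact summable_coeff_mul r hR (expansionUpper_iff.1 (expansionUpper_upperCoef h.2)).decay hd
  LinearMap.mk₂ ℂ (fun h f => ∑' n, coeff r n * upperCoef h n * lowerCoef f n)
    (fun h k f => by
      have e : upperCoef ((h + k : holUpper) : ℍ → ℂ) = upperCoef h + upperCoef k :=
        ((expansionUpper_upperCoef h.2).add (expansionUpper_upperCoef k.2)).upperCoef_eq
      rw [← (hs h f).tsum_add (hs k f), e]
      exact tsum_congr fun n => by simp only [Pi.add_apply]; ring)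
    (fun x h f => by
      have e : upperCoef ((x • h : holUpper) : ℍ → ℂ) = x • upperCoef h :=
        ((expansionUpper_upperCoef h.2).smul x).upperCoef_eq
      rw [smul_eq_mul, ← tsum_mul_left, e]
      exact tsum_congr fun n => by simp only [Pi.smul_apply, smul_eq_mul]; ring)
    (fun h f g => by
      have e : lowerCoef ((f + g : analyticLower) : LHP → ℂ) = lowerCoef f + lowerCoef g :=
        ((expansionLower_lowerCoef f.2).add (expansionLower_lowerCoef g.2)).lowerCoef_eq
      rw [← (hs h f).tsum_add (hs h g), e]
      exact tsum_congr fun n => by simp only [Pi.add_apply]; ring)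
    (fun x h f => by
      have e : lowerCoef ((x • f : analyticLower) : LHP → ℂ) = x • lowerCoef f :=
        ((expansionLower_lowerCoef f.2).smul x).lowerCoef_eq
      rw [smul_eq_mul, ← tsum_mul_left, e]
      exact tsum_congr fun n => by simp only [Pi.smul_apply, smul_eq_mul]; ring)

theorem hasSum_pairing (r : ℝ) (h : holUpper) (f : analyticLower) {c d : ℕ → ℂ}
    (hc : ExpansionUpper h c) (hd : ExpansionLower f d) :
    HasSum (fun n => coeff r n * c n * d n) (pairing r h f) := by
  obtain ⟨R, hR, hd'⟩ := hd.decay f.2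
  have hs := (summable_coeff_mul r hR (expansionUpper_iff.1 hc).decay hd').hasSum
  convert hs using 1
  simp only [pairing, LinearMap.mk₂_apply, hc.upperCoef_eq, hd.lowerCoef_eq]

theorem continuousOn_diskUpper {h : ℍ → ℂ} (hh : h ∈ holUpper) :
    ContinuousOn (diskUpper h) (Metric.ball 0 1) :=
  (mem_holUpper_iff_diskUpper.1 hh).continuousOn

/-- Cauchy's theorem for `h(z) dz / (z + i) ^ 2 = h dw / (2 i)`. -/
theorem WindsOnce.contourIntegral_diskUpper_eq_zero {δ : ℝ → ℂ} (hδ : WindsOnce δ) {m M : ℝ}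
    (hm : 0 < m) (hM : M < 1)
    (hmM : ∀ x ∈ Set.Icc (0 : ℝ) 1, m ≤ ‖δ x‖ ∧ ‖δ x‖ ≤ M) {h : ℍ → ℂ} (hh : h ∈ holUpper) :
    contourIntegral δ (diskUpper h) = 0 := by
  obtain ⟨c, hc⟩ := mem_holUpper_iff.1 hh
  rw [expansionUpper_iff] at hc
  have hM0 : 0 ≤ M := by
    obtain ⟨h1, h2⟩ := hmM 0 (by simp)
    linarith
  have hshift (w : ℂ) (hw : ‖w‖ < 1) :
      HasSum (fun n => (Nat.casesOn n 0 c : ℂ) * w ^ n) (w * diskUpper h w) := by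
    rw [← hasSum_nat_add_iff' 1]
    convert! (hc w hw).mul_left w using 1
    · funext n
      simp only [pow_succ]
      ring
    · simp
  have key := hδ.contourIntegral_mul hm hmM (a := fun n => (Nat.casesOn n 0 c : ℂ))
    (b := Pi.single 0 1) (F := fun w => w * diskUpper h w) (G := fun _ => 1) ?_ ?_ ?_ ?_
  · have h0 : (fun n => (Nat.casesOn n 0 c : ℂ) * (Pi.single 0 1 : ℕ → ℂ) n) = fun _ => 0 := by
      funext n
      cases n <;> simp
    rw [h0] at key
    have h1 := key.unique hasSum_zero
    have h2 : (2 * Real.pi * I : ℂ) ≠ 0 := Complex.two_pi_I_ne_zero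
    have h3 := (mul_eq_zero.1 h1).resolve_left (one_div_ne_zero h2)
    rw [← h3]
    refine contourIntegral_congr fun x hx => ?_
    have := hδ.ne_zero x hx
    field_simp
  · have := (hshift M (by rw [norm_real, Real.norm_of_nonneg hM0]; exact hM)).summable.norm
    simpa [abs_of_nonneg hM0] using this
  · refine summable_of_ne_finset_zero (s := {0}) fun n hn => ?_
    simp only [Finset.mem_singleton] at hn
    simp [Pi.single_eq_of_ne hn]
  · exact fun x hx => hshift _ ((hmM x hx).2.trans_lt hM)
  · intro x hx
    convert! hasSum_single (f := fun n => (Pi.single 0 1 : ℕ → ℂ) n * (δ x)⁻¹ ^ n) 0 ?_ using 1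
    · simp
    · intro n hn
      simp [Pi.single_eq_of_ne hn]

/-- The contour integral of the product of `h` with a Laurent tail `∑ e_n w⁻ⁿ⁻¹`. -/
theorem Encircles.hasSum_contourIntegral_mul {lo : ℝ} (hlo : 0 ≤ lo) {γ : ℝ → ℂ}
    (hγ : Encircles lo 1 γ) {h : ℍ → ℂ} {c : ℕ → ℂ} (hc : ExpansionUpper h c) {R : ℝ}
    (hlR : ∀ x : ℝ, lo < x → x⁻¹ < R) {e : ℕ → ℂ} (he : DecayAt R e) {S : ℂ → ℂ}
    (hS : ∀ x ∈ Set.Icc (0 : ℝ) 1, HasSum (fun n => e n * (cay (γ x))⁻¹ ^ n)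
      (cay (γ x) * S (γ x))) :
    HasSum (fun n => c n * e n)
      (1 / Real.pi * contourIntegral γ (fun z => h (ofComplex z) * S z / (z + I) ^ 2)) ∧
    ∀ k ∈ holUpper, 1 / Real.pi *
        contourIntegral γ (fun z => h (ofComplex z) * (S z + k (ofComplex z)) / (z + I) ^ 2) =
      1 / Real.pi * contourIntegral γ (fun z => h (ofComplex z) * S z / (z + I) ^ 2) := by
  obtain ⟨m, M, hm, hM, hmM⟩ := hγ.exists_bounds
  have hm0 : 0 < m := hlo.trans_lt hm
  have hM0 : 0 ≤ M := by
    obtain ⟨h1, h2⟩ := hmM 0 (by simp)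
    linarith
  have hδ := hγ.windsOnce hlo
  have hh : h ∈ holUpper := mem_holUpper_iff.2 ⟨c, hc⟩
  have hc' := expansionUpper_iff.1 hc
  have hpi : (Real.pi : ℂ) ≠ 0 := by exact_mod_cast Real.pi_ne_zero
  have hball : ∀ x ∈ Set.Icc (0 : ℝ) 1, ‖(cay ∘ γ) x‖ < 1 := fun x hx => (hmM x hx).2.trans_lt hM
  have hinv : ∀ x ∈ Set.Icc (0 : ℝ) 1, ‖((cay ∘ γ) x)⁻¹‖ < R := fun x hx => by
    rw [norm_inv]
    exact hlR _ (hm.trans_le (hmM x hx).1)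
  have hdisk : ∀ (k : ℍ → ℂ), ∀ x ∈ Set.Icc (0 : ℝ) 1,
      diskUpper k (cay (γ x)) = k (ofComplex (γ x)) := fun k x hx => by
    rw [diskUpper, icay_cay (hγ.mem x hx).1]
  have hG : ∀ x ∈ Set.Icc (0 : ℝ) 1,
      ∑' n, e n * (cay (γ x))⁻¹ ^ n = cay (γ x) * S (γ x) := fun x hx => (hS x hx).tsum_eq
  have key := hδ.contourIntegral_mul hm0 hmM (a := c) (b := e) (F := diskUpper h)
    (G := fun w => ∑' n, e n * w⁻¹ ^ n)
    (hc'.decay M hM0 hM) (he m⁻¹ (by positivity) (hlR m hm))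
    (fun x hx => hc' _ (hball x hx)) (fun x hx => he.hasExpansion _ (hinv x hx))
  have e0 : contourIntegral γ (fun z => h (ofComplex z) * S z / (z + I) ^ 2) =
      1 / (2 * I) * contourIntegral (cay ∘ γ)
        (fun w => diskUpper h w * (∑' n, e n * w⁻¹ ^ n) * w⁻¹) := by
    rw [contourIntegral_cay hγ.contour (fun x hx => (hγ.mem x hx).1), ← contourIntegral_const_mul]
    refine contourIntegral_congr fun x hx => ?_
    have h1 := add_I_ne_zero (hγ.mem x hx).1
    have h2 : cay (γ x) ≠ 0 := hδ.ne_zero x hx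
    simp only [hdisk h x hx, hG x hx]
    field_simp
  refine ⟨?_, fun k hk => ?_⟩
  · convert! key using 1
    rw [e0]
    field_simp
  · congr 1
    have hhk : h * k ∈ holUpper := by
      rw [mem_holUpper_iff_diskUpper] at hh hk ⊢
      exact hh.mul hk
    have hzero := hδ.contourIntegral_diskUpper_eq_zero hm0 hM hmM hhk
    have c1 : ContinuousOn (fun w : ℂ => diskUpper h w * (∑' n, e n * w⁻¹ ^ n) * w⁻¹)
        ((cay ∘ γ) '' Set.Icc 0 1) := by
      refine ((ContinuousOn.mono (continuousOn_diskUpper hh) ?_).mul ?_).mul hδ.continuousOn_inv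
      · rintro _ ⟨x, hx, rfl⟩
        simpa using hball x hx
      · refine (he.hasExpansion.differentiableOn.continuousOn).comp hδ.continuousOn_inv ?_
        rintro _ ⟨x, hx, rfl⟩
        simpa using hinv x hx
    have c2 : ContinuousOn (diskUpper (h * k)) ((cay ∘ γ) '' Set.Icc 0 1) := by
      refine (continuousOn_diskUpper hhk).mono ?_
      rintro _ ⟨x, hx, rfl⟩
      simpa using hball x hx
    rw [e0, ← add_zero (contourIntegral (cay ∘ γ) _), ← hzero,
      ← hδ.contour.contourIntegral_add c1 c2,
      contourIntegral_cay hγ.contour (fun x hx => (hγ.mem x hx).1), ← contourIntegral_const_mul]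
    refine contourIntegral_congr fun x hx => ?_
    have h1 := add_I_ne_zero (hγ.mem x hx).1
    have h2 : cay (γ x) ≠ 0 := hδ.ne_zero x hx
    have h3 : diskUpper (h * k) (cay (γ x)) = h (ofComplex (γ x)) * k (ofComplex (γ x)) :=
      hdisk (h * k) x hx
    simp only [hdisk h x hx, hG x hx, h3]
    field_simp

/-- The two contour integrals pick out the diagonal terms of products of expansions in `w` and `w⁻¹`; a
holomorphic summand of `σ_r f⁻` contributes nothing by Cauchy's theorem. -/
theorem contourFormula_pairing (r : ℝ) (h : holUpper) (f : analyticLower) :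
    ContourFormula r h f (pairing r h f) := by
  intro R Φ hΦ ρ γ₁ γ₂ h₁ h₂
  have hc := expansionUpper_upperCoef h.2
  have hd := expansionLower_lowerCoef f.2
  have hR0 : 0 < R := one_pos.trans hΦ.one_lt
  have hRρ : R⁻¹ < ρ := by
    have := (h₁.mem 0 (by simp)).2
    exact this.1.trans this.2
  have hρ : 0 < ρ := (by positivity : 0 < R⁻¹).trans hRρ
  have hexp := hΦ.hasExpansion hd
  obtain ⟨k1, k2⟩ := h₂.hasSum_contourIntegral_mul hρ.le hc
    (fun x hx => inv_lt_of_inv_lt₀ hR0 (hRρ.trans hx)) (hexp.decay.coeff_mul r)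
    (S := sigmaInt r Φ γ₁)
    (fun x hx => hasSum_sigmaInt r hΦ.one_lt hexp h₁ (h₂.mem x hx).2.1)
  have e : pairing r h f = _ := (hasSum_pairing r h f hc hd).unique
    (k1.congr_fun fun n => by ring)
  exact ⟨e, fun k hk => by rw [e, k2 k hk]⟩

theorem ExpansionPol.expansionLower {a : ℕ} {f : LHP → ℂ} {d : ℕ → ℂ} (H : ExpansionPol a f d) :
    ExpansionLower f (fun n => if n ∈ Finset.range (a + 1) then d n else 0) := fun t => by
  rw [H t]
  exact hasExpansion_sum_range (a + 1) d 1 _ (norm_cayInv_lt_one t)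

theorem polContourFormula_pairing (a : ℕ) (h : holUpper) (f : analyticLower)
    (hf : ∃ d, ExpansionPol a f d) : PolContourFormula a h f (pairing (-(a : ℝ)) h f) := by
  refine ⟨hf, fun d hd γ hγ => ?_⟩
  have hc := expansionUpper_upperCoef h.2
  obtain ⟨m, M, hm, hM, hmM⟩ := hγ.exists_bounds
  have hγ' : Encircles (m / 2) 1 γ :=
    ⟨hγ.contour, fun x hx => ⟨(hγ.mem x hx).1, by linarith [(hmM x hx).1], (hγ.mem x hx).2.2⟩,
      hγ.winding⟩
  have hm2 : 0 < m / 2 := by positivity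
  obtain ⟨k1, -⟩ := hγ'.hasSum_contourIntegral_mul hm2.le hc (R := (m / 2)⁻¹)
    (fun x hx => inv_strictAnti₀ hm2 hx)
    ((hasExpansion_sum_range (a + 1) (fun n => coeff (-(a : ℝ)) n * d n) _).decay)
    (S := sigmaPol a d) (fun x hx => by
      convert! hasExpansion_sum_range (a + 1) (fun n => coeff (-(a : ℝ)) n * d n)
        (‖(cay (γ x))⁻¹‖ + 1) _ (lt_add_one _) using 1
      have : cay (γ x) ≠ 0 := norm_pos_iff.1 (hγ.mem x hx).2.1
      rw [sigmaPol, Finset.mul_sum]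
      refine Finset.sum_congr rfl fun n _ => ?_
      rw [cayInv_eq_inv, pow_succ]
      field_simp)
  refine (hasSum_pairing _ h f hc hd.expansionLower).unique (k1.congr_fun fun n => ?_)
  split_ifs <;> ring

/-! ### Möbius transformations of the disk -/

/-- The Möbius transformation `w ↦ (B̄ + Ā w) / (A + B w)`, an automorphism of the unit disk if
`|A|² - |B|² = 1`. -/
def diskMoebius (A B w : ℂ) : ℂ := (conj B + conj A * w) / (A + B * w)

theorem normSq_sub_normSq (A B w : ℂ) :
    normSq (A + B * w) - normSq (conj B + conj A * w) =
      (normSq A - normSq B) * (1 - normSq w) := by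
  simp only [normSq_apply, add_re, add_im, mul_re, mul_im, conj_re, conj_im]
  ring

theorem add_mul_ne_zero {A B w : ℂ} (hAB : normSq A - normSq B = 1) (hw : ‖w‖ ≤ 1) :
    A + B * w ≠ 0 := by
  have hA : 0 < ‖A‖ := by
    rw [norm_pos_iff]
    rintro rfl
    rw [map_zero] at hAB
    linarith [normSq_nonneg B]
  have hBA : ‖B‖ < ‖A‖ := by
    rw [normSq_eq_norm_sq, normSq_eq_norm_sq] at hAB
    nlinarith [norm_nonneg B]
  intro h
  have h1 : ‖A‖ = ‖B‖ * ‖w‖ := by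
    rw [← norm_mul, ← norm_neg (B * w)]
    congr 1
    linear_combination h
  nlinarith [norm_nonneg B]

theorem ne_zero_of_normSq_sub {A B : ℂ} (hAB : normSq A - normSq B = 1) : A ≠ 0 := by
  simpa using add_mul_ne_zero (w := 0) hAB (by simp)

theorem norm_div_lt_one {A B : ℂ} (hAB : normSq A - normSq B = 1) : ‖B / A‖ < 1 := by
  rw [norm_div, div_lt_one (norm_pos_iff.2 (ne_zero_of_normSq_sub hAB)),
    ← sq_lt_sq₀ (norm_nonneg _) (norm_nonneg _), ← normSq_eq_norm_sq, ← normSq_eq_norm_sq]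
  linarith

theorem norm_diskMoebius_le_one {A B w : ℂ} (hAB : normSq A - normSq B = 1) (hw : ‖w‖ ≤ 1) :
    ‖diskMoebius A B w‖ ≤ 1 := by
  have h := normSq_sub_normSq A B w
  have h0 : normSq w ≤ 1 := by
    rw [normSq_eq_norm_sq]
    exact pow_le_one₀ (norm_nonneg _) hw
  rw [diskMoebius, norm_div, div_le_one (norm_pos_iff.2 (add_mul_ne_zero hAB hw)),
    ← sq_le_sq₀ (norm_nonneg _) (norm_nonneg _), ← normSq_eq_norm_sq, ← normSq_eq_norm_sq]
  rw [hAB] at h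
  linarith

theorem norm_diskMoebius_lt_one {A B w : ℂ} (hAB : normSq A - normSq B = 1) (hw : ‖w‖ < 1) :
    ‖diskMoebius A B w‖ < 1 := by
  have h := normSq_sub_normSq A B w
  have h0 : normSq w < 1 := by
    rw [normSq_eq_norm_sq]
    exact pow_lt_one₀ (norm_nonneg _) hw two_ne_zero
  rw [diskMoebius, norm_div, div_lt_one (norm_pos_iff.2 (add_mul_ne_zero hAB hw.le)),
    ← sq_lt_sq₀ (norm_nonneg _) (norm_nonneg _), ← normSq_eq_norm_sq, ← normSq_eq_norm_sq]
  rw [hAB] at h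
  linarith

theorem normSq_conj_sub {A B : ℂ} (hAB : normSq A - normSq B = 1) :
    normSq (conj A) - normSq (conj B) = 1 := by
  rwa [normSq_conj, normSq_conj]

theorem re_one_add_pos {x : ℂ} (hx : ‖x‖ < 1) : 0 < (1 + x).re := by
  have := neg_abs_le x.re
  have := abs_re_le_norm x
  simp only [add_re, one_re]
  linarith

theorem re_one_sub_pos {x : ℂ} (hx : ‖x‖ < 1) : 0 < (1 - x).re := by
  rw [sub_eq_add_neg]
  exact re_one_add_pos (by rwa [norm_neg])

theorem mul_cpow_of_re_pos {x y : ℂ} (hx : 0 < x.re) (hy : 0 < y.re) (s : ℂ) :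
    (x * y) ^ s = x ^ s * y ^ s := by
  have h1 := abs_lt.1 (abs_arg_lt_pi_div_two_iff.2 (.inl hx))
  have h2 := abs_lt.1 (abs_arg_lt_pi_div_two_iff.2 (.inl hy))
  have hx0 : x ≠ 0 := by rintro rfl; simp at hx
  have hy0 : y ≠ 0 := by rintro rfl; simp at hy
  have h3 : Complex.log (x * y) = Complex.log x + Complex.log y :=
    Complex.log_mul hx0 hy0 ⟨by linarith, by linarith⟩
  rw [cpow_def_of_ne_zero (mul_ne_zero hx0 hy0), cpow_def_of_ne_zero hx0, cpow_def_of_ne_zero hy0,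
    h3, add_mul, exp_add]

theorem norm_mul_lt_one {x y : ℂ} (hx : ‖x‖ < 1) (hy : ‖y‖ ≤ 1) : ‖x * y‖ < 1 := by
  rw [norm_mul]
  nlinarith [norm_nonneg x, norm_nonneg y]

theorem differentiableOn_one_add_cpow (b s : ℂ) :
    DifferentiableOn ℂ (fun w => (1 + b * w) ^ s) {w | ‖b * w‖ < 1} := by
  refine DifferentiableOn.cpow (by fun_prop) (by fun_prop) fun w hw => ?_
  exact .inl (re_one_add_pos hw)

theorem differentiableAt_diskMoebius {A B w : ℂ} (h : A + B * w ≠ 0) :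
    DifferentiableAt ℂ (diskMoebius A B) w := by
  unfold diskMoebius
  fun_prop (disch := exact h)

theorem differentiableOn_diskMoebius {A B : ℂ} (hAB : normSq A - normSq B = 1) :
    DifferentiableOn ℂ (diskMoebius A B) (Metric.ball 0 1) := fun _ hw =>
  (differentiableAt_diskMoebius (add_mul_ne_zero hAB
    (by simpa using (Metric.mem_ball.1 hw).le))).differentiableWithinAt

/-! ### Invariance of the form in the disk -/

theorem windsOnce_circle {ρ : ℝ} (hρ : 0 < ρ) :
    WindsOnce (fun x : ℝ => (ρ : ℂ) * exp (2 * Real.pi * I * x)) := by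
  have hd : ∀ x : ℝ, HasDerivAt (fun x : ℝ => (ρ : ℂ) * exp (2 * Real.pi * I * x))
      ((ρ : ℂ) * (exp (2 * Real.pi * I * x) * (2 * Real.pi * I))) x := fun x => by
    have h1 : HasDerivAt (fun x : ℝ => 2 * Real.pi * I * (x : ℂ)) (2 * Real.pi * I) x := by
      simpa using (ofRealCLM.hasDerivAt (x := x)).const_mul (2 * Real.pi * I : ℂ)
    exact (h1.cexp).const_mul _
  have hρ' : (ρ : ℂ) ≠ 0 := by exact_mod_cast hρ.ne'
  have hderiv : deriv (fun x : ℝ => (ρ : ℂ) * exp (2 * Real.pi * I * x)) =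
      fun x : ℝ => (ρ : ℂ) * (exp (2 * Real.pi * I * x) * (2 * Real.pi * I)) :=
    funext fun x => (hd x).deriv
  refine ⟨⟨?_, by simp [Complex.exp_two_pi_mul_I], ⟨∅, fun x _ _ => (hd x).differentiableAt⟩, ?_⟩,
    fun x _ => mul_ne_zero hρ' (exp_ne_zero _), ?_⟩
  · exact fun x _ => (hd x).continuousAt.continuousWithinAt
  · rw [hderiv]
    exact Continuous.intervalIntegrable (by fun_prop) _ _
  · rw [contourIntegral, hderiv]
    have : ∀ x : ℝ, ((ρ : ℂ) * exp (2 * Real.pi * I * x))⁻¹ *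
        ((ρ : ℂ) * (exp (2 * Real.pi * I * x) * (2 * Real.pi * I))) = 2 * Real.pi * I := fun x => by
      have := exp_ne_zero (2 * Real.pi * I * x)
      field_simp
    simp only [this]
    simp

/-- The factor of automorphy on the unit disk, up to a constant. -/
def diskFactor (r : ℝ) (A B w : ℂ) : ℂ := (1 + B / A * w) ^ (-(r : ℂ))

theorem differentiableOn_diskFactor (r : ℝ) {A B : ℂ} (hAB : normSq A - normSq B = 1) :
    DifferentiableOn ℂ (diskFactor r A B) (Metric.ball 0 1) :=
  (differentiableOn_one_add_cpow (B / A) _).mono fun _ hw =>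
    norm_mul_lt_one (norm_div_lt_one hAB) (by simpa using (Metric.mem_ball.1 hw).le)

/-- The linear forms `h ↦ ∑ c'_n e_n`, where `c'` are the coefficients of a transform of `h`, are
continuous, hence they are determined by their values on the powers of `w`. -/
theorem exists_hasSum_transform (r : ℝ) {A B : ℂ} (hAB : normSq A - normSq B = 1) (κ : ℂ) {R : ℝ}
    (hR : 1 < R) {e : ℕ → ℂ} (he : DecayAt R e) :
    ∃ Λ : ℕ → ℂ, ∀ (c c' : ℕ → ℂ) (H : ℂ → ℂ), HasExpansion 1 c H →
      HasExpansion 1 c' (fun w => κ * diskFactor r A B w * H (diskMoebius A B w)) →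
      HasSum (fun n => c n * Λ n) (∑' n, c' n * e n) := by
  obtain ⟨y, hy1, hyR⟩ := exists_between hR
  have hy0 : 0 < y := one_pos.trans hy1
  set ρ := y⁻¹ with hρdef
  have hρ0 : 0 < ρ := inv_pos.2 hy0
  have hρ1 : ρ < 1 := inv_lt_one_of_one_lt₀ hy1
  have hδ := windsOnce_circle hρ0
  set δ : ℝ → ℂ := fun x : ℝ => (ρ : ℂ) * exp (2 * Real.pi * I * x) with hδdef
  have hnorm : ∀ x, ‖δ x‖ = ρ := fun x => by
    have : ‖exp (2 * Real.pi * I * x)‖ = 1 := by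
      rw [show (2 * Real.pi * I * x : ℂ) = ((2 * Real.pi * x : ℝ) : ℂ) * I by push_cast; ring]
      exact norm_exp_ofReal_mul_I _
    rw [hδdef]
    simp only [norm_mul, this, mul_one, norm_real, Real.norm_of_nonneg hρ0.le]
  have hball : Metric.closedBall (0 : ℂ) ρ ⊆ Metric.ball 0 1 := Metric.closedBall_subset_ball hρ1
  have hδball : δ '' Set.Icc 0 1 ⊆ Metric.ball 0 1 := by
    rintro _ ⟨x, -, rfl⟩
    simpa [hnorm] using hρ1
  have hcM := (differentiableOn_diskMoebius hAB).continuousOn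
  have hcP : ContinuousOn (fun w => κ * diskFactor r A B w) (Metric.ball 0 1) :=
    continuousOn_const.mul (differentiableOn_diskFactor r hAB).continuousOn
  have hne : (Metric.closedBall (0 : ℂ) ρ).Nonempty := ⟨0, by simpa using hρ0.le⟩
  obtain ⟨x₀, hx₀, hmax⟩ := (isCompact_closedBall (0 : ℂ) ρ).exists_isMaxOn hne (hcM.mono hball).norm
  obtain ⟨C, hC⟩ := (isCompact_closedBall (0 : ℂ) ρ).exists_bound_of_continuousOn (hcP.mono hball)
  set μ := ‖diskMoebius A B x₀‖ with hμdef
  have hμ : μ < 1 := norm_diskMoebius_lt_one hAB (by simpa using hball hx₀)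
  have hmem : ∀ x, δ x ∈ Metric.closedBall (0 : ℂ) ρ := fun x => by simp [hnorm]
  have hMμ : ∀ x, ‖diskMoebius A B (δ x)‖ ≤ μ := fun x => hmax (hmem x)
  set G : ℂ → ℂ := fun w => ∑' n, e n * w⁻¹ ^ n with hGdef
  have hinv : ∀ x, ‖(δ x)⁻¹‖ < R := fun x => by
    rw [norm_inv, hnorm, hρdef, inv_inv]
    exact hyR
  have hcG : ContinuousOn G (δ '' Set.Icc 0 1) := by
    refine (he.hasExpansion.differentiableOn.continuousOn).comp hδ.continuousOn_inv ?_
    rintro _ ⟨x, -, rfl⟩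
    simpa using hinv x
  have hcGi : ContinuousOn (fun w => G w * w⁻¹) (δ '' Set.Icc 0 1) := hcG.mul hδ.continuousOn_inv
  obtain ⟨D, hD⟩ := (isCompact_Icc.image_of_continuousOn hδ.contour.cont).exists_bound_of_continuousOn
    hcGi
  refine ⟨fun n => 1 / (2 * Real.pi * I) * contourIntegral δ
    (fun w => κ * diskFactor r A B w * diskMoebius A B w ^ n * (G w * w⁻¹)),
    fun c c' H hH hH' => ?_⟩
  have hval := hδ.contourIntegral_mul (m := ρ) (M := ρ) hρ0 (fun x _ => by simp [hnorm])
    (a := c') (b := e) (F := fun w => κ * diskFactor r A B w * H (diskMoebius A B w)) (G := G)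
    (hH'.decay ρ hρ0.le hρ1) (by
      rw [hρdef, inv_inv]
      exact he y hy0.le hyR) (fun x _ => hH' _ (by rw [hnorm]; exact hρ1))
    (fun x _ => he.hasExpansion _ (hinv x))
  rw [hval.tsum_eq]
  have hsum := hδ.contour.hasSum_contourIntegral
    (F := fun n w => c n * (κ * diskFactor r A B w * diskMoebius A B w ^ n * (G w * w⁻¹)))
    (G := fun w => κ * diskFactor r A B w * H (diskMoebius A B w) * G w * w⁻¹)
    (u := fun n => C * D * (‖c n‖ * μ ^ n)) ?_ ?_ ?_ ?_
  · convert! hsum.mul_left (1 / (2 * Real.pi * I)) using 1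
    funext n
    rw [contourIntegral_const_mul]
    ring
  · intro n
    exact continuousOn_const.mul (((hcP.mono hδball).mul ((hcM.mono hδball).pow n)).mul hcGi)
  · exact (hH.decay μ (norm_nonneg _) hμ).mul_left _
  · intro n x hx
    have h1 := hC _ (hmem x)
    have h2 := hD _ (Set.mem_image_of_mem δ hx)
    have h3 := hMμ x
    have hC0 : 0 ≤ C := (norm_nonneg _).trans h1
    have hD0 : 0 ≤ D := (norm_nonneg _).trans h2
    calc _ = ‖κ * diskFactor r A B (δ x)‖ * ‖G (δ x) * (δ x)⁻¹‖ *
          (‖c n‖ * ‖diskMoebius A B (δ x)‖ ^ n) := by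
          simp only [norm_mul, norm_pow]
          ring
      _ ≤ C * D * (‖c n‖ * μ ^ n) := by gcongr
  · intro x hx
    have := ((hH _ ((hMμ x).trans_lt hμ)).mul_left (κ * diskFactor r A B (δ x))).mul_right
      (G (δ x) * (δ x)⁻¹)
    convert! this using 1
    · funext n
      ring
    · ring

/-- Invariance of the form on the unit disk. The functions `(1 - s w) ^ (-r)` reproduce the values
of the second argument; for them the invariance is an explicit computation. -/
theorem tsum_transform_eq (r : ℝ) {A B : ℂ} (hAB : normSq A - normSq B = 1) {κ κ' : ℂ}
    (hκ : κ * κ' * ((normSq A : ℂ))⁻¹ ^ (-(r : ℂ)) = 1) {R R' : ℝ} (hR : 1 < R) (hR' : 1 < R')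
    {c c' d d' : ℕ → ℂ} {H Φ : ℂ → ℂ} (hc : HasExpansion 1 c H)
    (hc' : HasExpansion 1 c' (fun w => κ * diskFactor r A B w * H (diskMoebius A B w)))
    (hd : HasExpansion R d Φ)
    (hd' : HasExpansion 1 d'
      (fun u => κ' * diskFactor r (conj A) (conj B) u * Φ (diskMoebius (conj A) (conj B) u)))
    (hdec : DecayAt R' d')
    (hsupp : ∀ n, (ascPochhammer ℂ n).eval (r : ℂ) = 0 → c n = 0 ∧ d' n = 0) :
    ∑' n, coeff r n * c' n * d' n = ∑' n, coeff r n * c n * d n := by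
  obtain ⟨Λ, hΛ⟩ := exists_hasSum_transform r hAB κ hR' (hdec.coeff_mul r)
  have hA := ne_zero_of_normSq_sub hAB
  have hA' : conj A ≠ 0 := by simpa using hA
  have hABc : A * conj A - B * conj B = 1 := by
    rw [mul_conj, mul_conj]
    exact_mod_cast hAB
  have hcoef : ∀ n, (ascPochhammer ℂ n).eval (r : ℂ) / n.factorial * Λ n = d n := by
    refine congrFun (HasExpansion.unique (R := 1) one_pos (F := Φ) (fun s hs => ?_)
      (hd.mono hR.le))
    -- `(1 - s w) ^ (-r)` is transformed into a multiple of `(1 - s' w) ^ (-r)`, and the transformation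
    -- of the second argument sends `s'` back to `s`.
    set s' := (s * conj A - B) / (A - s * conj B) with hs'
    have hAB2 : normSq A - normSq (-conj B) = 1 := by rwa [normSq_neg, normSq_conj]
    have hden : A - s * conj B ≠ 0 := by
      have := add_mul_ne_zero hAB2 hs.le
      intro h0
      exact this (by linear_combination h0)
    have hs'1 : ‖s'‖ < 1 := by
      convert! norm_diskMoebius_lt_one hAB2 hs using 2
      rw [hs', diskMoebius]
      simp only [map_neg, conj_conj]
      congr 1 <;> ring
    set X := 1 - s * (conj B / A) with hX
    have hnX : ‖s * (conj B / A)‖ < 1 := by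
      have h1 : ‖conj B / A‖ < 1 := by
        have := norm_div_lt_one hAB
        rwa [norm_div, norm_conj, ← norm_div]
      rw [mul_comm]
      exact norm_mul_lt_one h1 hs.le
    have hXre : 0 < X.re := re_one_sub_pos hnX
    have hXne : X ≠ 0 := fun h => by rw [h] at hXre; simp at hXre
    have hk := hΛ (fun n => (ascPochhammer ℂ n).eval (r : ℂ) / n.factorial * s ^ n)
      (fun n => κ * X ^ (-(r : ℂ)) * ((ascPochhammer ℂ n).eval (r : ℂ) / n.factorial * s' ^ n))
      (fun w => (1 - s * w) ^ (-(r : ℂ))) ?_ ?_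
    · have hsum : ∑' n, κ * X ^ (-(r : ℂ)) *
          ((ascPochhammer ℂ n).eval (r : ℂ) / n.factorial * s' ^ n) * (coeff r n * d' n) = Φ s := by
        have h1 := (hd' s' hs'1).mul_left (κ * X ^ (-(r : ℂ)))
        have h2 : ∀ n, κ * X ^ (-(r : ℂ)) *
            ((ascPochhammer ℂ n).eval (r : ℂ) / n.factorial * s' ^ n) * (coeff r n * d' n) =
            κ * X ^ (-(r : ℂ)) * (d' n * s' ^ n) := fun n => by
          by_cases h0 : (ascPochhammer ℂ n).eval (r : ℂ) = 0
          · simp [(hsupp n h0).2]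
          · have : (n.factorial : ℂ) ≠ 0 := by exact_mod_cast n.factorial_ne_zero
            rw [coeff]
            field_simp
        simp only [h2]
        rw [h1.tsum_eq]
        have hMs : diskMoebius (conj A) (conj B) s' = s := by
          have hden2 : conj A + conj B * s' = 1 / (A - s * conj B) := by
            rw [hs', eq_div_iff hden, add_mul, mul_assoc, div_mul_cancel₀ _ hden]
            linear_combination hABc
          rw [diskMoebius, hden2, conj_conj, conj_conj, hs', div_div_eq_mul_div, div_one, add_mul,
            mul_assoc, div_mul_cancel₀ _ hden]
          linear_combination s * hABc
        have hY : X * (1 + conj B / conj A * s') = ((normSq A : ℂ))⁻¹ := by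
          rw [← mul_conj, hX, hs']
          field_simp
          linear_combination hABc
        have hnY : ‖conj B / conj A * s'‖ < 1 :=
          norm_mul_lt_one (norm_div_lt_one (normSq_conj_sub hAB)) hs'1.le
        simp only [hMs, diskFactor]
        have h3 := mul_cpow_of_re_pos hXre (re_one_add_pos hnY) (-(r : ℂ))
        rw [hY] at h3
        rw [h3] at hκ
        linear_combination Φ s * hκ
      rw [← hsum]
      exact hk.congr_fun fun n => by ring
    · intro w hw
      have hsw : ‖s * w‖ < 1 := norm_mul_lt_one hs hw.le
      convert! hasExpansion_one_sub_cpow r (s * w) hsw using 1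
      funext n
      rw [mul_pow]
      ring
    · intro w hw
      have hs'w : ‖s' * w‖ < 1 := norm_mul_lt_one hs'1 hw.le
      convert! (hasExpansion_one_sub_cpow r (s' * w) hs'w).mul_left (κ * X ^ (-(r : ℂ))) using 1
      · funext n
        rw [mul_pow]
        ring
      · have hn1 : ‖B / A * w‖ < 1 := norm_mul_lt_one (norm_div_lt_one hAB) hw.le
        have hn2 : ‖s * diskMoebius A B w‖ < 1 :=
          norm_mul_lt_one hs (norm_diskMoebius_lt_one hAB hw).le
        have hAw := add_mul_ne_zero hAB hw.le
        have e : (1 + B / A * w) * (1 - s * diskMoebius A B w) = X * (1 - s' * w) := by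
          rw [hX, hs', diskMoebius]
          field_simp
          ring
        simp only [diskFactor]
        rw [mul_assoc, mul_assoc κ,
          ← mul_cpow_of_re_pos (re_one_add_pos hn1) (re_one_sub_pos hn2), e,
          mul_cpow_of_re_pos hXre (re_one_sub_pos hs'w)]
  have hfin := hΛ c c' H hc hc'
  have h1 : ∑' n, coeff r n * c' n * d' n = ∑' n, c' n * (coeff r n * d' n) :=
    tsum_congr fun n => by ring
  rw [h1, ← hfin.tsum_eq]
  refine tsum_congr fun n => ?_
  by_cases h0 : (ascPochhammer ℂ n).eval (r : ℂ) = 0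
  · simp [(hsupp n h0).1]
  · have : (n.factorial : ℂ) ≠ 0 := by exact_mod_cast n.factorial_ne_zero
    rw [← hcoef n, coeff]
    field_simp

/-! ### Factors of automorphy on the half-planes -/

/-- The diagonal entry of the matrix in `SU(1, 1)` that describes `g` in the disk coordinate. -/
def diskA (g : SL(2, ℝ)) : ℂ :=
  (((g 0 0 : ℝ) : ℂ) + (g 1 1 : ℝ) + I * ((g 1 0 : ℝ) - (g 0 1 : ℝ))) / 2

/-- The off-diagonal entry of the matrix in `SU(1, 1)` that describes `g` in the disk coordinate. -/
def diskB (g : SL(2, ℝ)) : ℂ :=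
  (((g 0 0 : ℝ) : ℂ) - (g 1 1 : ℝ) + I * ((g 1 0 : ℝ) + (g 0 1 : ℝ))) / 2

theorem SL2_det (g : SL(2, ℝ)) : g 0 0 * g 1 1 - g 0 1 * g 1 0 = 1 := by
  have := g.det_coe
  rwa [Matrix.det_fin_two] at this

theorem normSq_diskA_sub (g : SL(2, ℝ)) : normSq (diskA g) - normSq (diskB g) = 1 := by
  have h := SL2_det g
  simp only [diskA, diskB, normSq_div, normSq_ofNat]
  simp only [normSq_apply, add_re, add_im, sub_re, sub_im, mul_re, mul_im, Complex.I_re, Complex.I_im, ofReal_re,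
    ofReal_im]
  linear_combination h

theorem conj_diskA (g : SL(2, ℝ)) :
    conj (diskA g) = (((g 0 0 : ℝ) : ℂ) + (g 1 1 : ℝ) - I * ((g 1 0 : ℝ) - (g 0 1 : ℝ))) / 2 := by
  simp only [diskA, map_div₀, map_add, map_sub, map_mul, conj_ofReal, conj_I, map_ofNat]
  ring

theorem conj_diskB (g : SL(2, ℝ)) :
    conj (diskB g) = (((g 0 0 : ℝ) : ℂ) - (g 1 1 : ℝ) - I * ((g 1 0 : ℝ) + (g 0 1 : ℝ))) / 2 := by
  simp only [diskB, map_div₀, map_add, map_sub, map_mul, conj_ofReal, conj_I, map_ofNat]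
  ring

theorem add_I_mul_diskA {z : ℂ} (hz : 0 < z.im) (g : SL(2, ℝ)) :
    (z + I) * (diskA g + diskB g * cay z) =
      (((g 0 0 : ℝ) : ℂ) + I * (g 1 0 : ℝ)) * z + ((g 0 1 : ℝ) + I * (g 1 1 : ℝ)) := by
  have h0 := add_I_ne_zero hz
  have h1 : (z + I) * cay z = z - I := by rw [cay]; field_simp
  rw [mul_add, mul_left_comm, h1, diskA, diskB]
  linear_combination (-((g 0 1 : ℝ) : ℂ)) * I_sq

theorem add_I_mul_conj_diskA {z : ℂ} (hz : 0 < z.im) (g : SL(2, ℝ)) :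
    (z + I) * (conj (diskB g) + conj (diskA g) * cay z) =
      (((g 0 0 : ℝ) : ℂ) - I * (g 1 0 : ℝ)) * z + ((g 0 1 : ℝ) - I * (g 1 1 : ℝ)) := by
  have h0 := add_I_ne_zero hz
  have h1 : (z + I) * cay z = z - I := by rw [cay]; field_simp
  rw [mul_add, mul_left_comm, h1, conj_diskA, conj_diskB]
  linear_combination (-((g 0 1 : ℝ) : ℂ)) * I_sq

theorem autFactor_ne_zero {z : ℂ} (hz : z.im ≠ 0) (g : SL(2, ℝ)) : autFactor g z ≠ 0 := by
  have hdet := SL2_det g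
  intro h
  have h1 := congrArg Complex.im h
  have h2 := congrArg Complex.re h
  simp [autFactor] at h1 h2
  rcases h1 with h1 | h1
  · rw [h1] at h2 hdet
    simp at h2
    rw [h2] at hdet
    simp at hdet
  · exact hz h1

theorem coe_smul_eq_moebius (g : SL(2, ℝ)) (z : ℍ) : ((g • z : ℍ) : ℂ) = moebius g z := by
  rw [coe_specialLinearGroup_apply]
  rfl

theorem autFactor_mul_moebius_sub {z : ℂ} (hz : z.im ≠ 0) (g : SL(2, ℝ)) :
    autFactor g z * (moebius g z - I) =
      (((g 0 0 : ℝ) : ℂ) - I * (g 1 0 : ℝ)) * z + ((g 0 1 : ℝ) - I * (g 1 1 : ℝ)) := by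
  rw [moebius, mul_sub, mul_div_cancel₀ _ (autFactor_ne_zero hz g), autFactor]
  ring

theorem autFactor_mul_moebius_add {z : ℂ} (hz : z.im ≠ 0) (g : SL(2, ℝ)) :
    autFactor g z * (moebius g z + I) =
      (((g 0 0 : ℝ) : ℂ) + I * (g 1 0 : ℝ)) * z + ((g 0 1 : ℝ) + I * (g 1 1 : ℝ)) := by
  rw [moebius, mul_add, mul_div_cancel₀ _ (autFactor_ne_zero hz g), autFactor]
  ring

theorem cay_moebius {z : ℂ} (hz : 0 < z.im) (g : SL(2, ℝ)) :
    cay (moebius g z) = diskMoebius (diskA g) (diskB g) (cay z) := by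
  rw [cay, ← mul_div_mul_left _ _ (autFactor_ne_zero hz.ne' g), autFactor_mul_moebius_sub hz.ne',
    autFactor_mul_moebius_add hz.ne', ← add_I_mul_diskA hz, ← add_I_mul_conj_diskA hz,
    mul_div_mul_left _ _ (add_I_ne_zero hz), diskMoebius]

theorem cay_smul (g : SL(2, ℝ)) (z : ℍ) :
    cay ((g • z : ℍ) : ℂ) = diskMoebius (diskA g) (diskB g) (cay z) := by
  rw [coe_smul_eq_moebius, cay_moebius z.im_pos]

theorem conj_autFactor (g : SL(2, ℝ)) (z : ℂ) : conj (autFactor g z) = autFactor g (conj z) := by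
  simp [autFactor]

theorem conj_moebius (g : SL(2, ℝ)) (z : ℂ) : conj (moebius g z) = moebius g (conj z) := by
  rw [moebius, moebius, map_div₀, conj_autFactor]
  simp

theorem conj_diskMoebius (A B w : ℂ) :
    conj (diskMoebius A B w) = diskMoebius (conj A) (conj B) (conj w) := by
  simp [diskMoebius]

theorem cayInv_lowerMoebius (g : SL(2, ℝ)) (t : LHP) :
    cayInv (lowerMoebius g t) =
      diskMoebius (conj (diskA g)) (conj (diskB g)) (cayInv t) := by
  rw [lowerMoebius, cayInv_eq_conj, conj_moebius, cay_moebius t.conj_im_pos, conj_diskMoebius,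
    ← cayInv_eq_conj]

/-- The complex conjugate, in the upper half-plane, of a point of the lower half-plane. -/
def LHP.conj (t : LHP) : ℍ := ⟨starRingEnd ℂ (t : ℂ), t.conj_im_pos⟩

theorem cay_LHP_conj (t : LHP) : cay (t.conj : ℂ) = starRingEnd ℂ (cayInv t) := by
  rw [cayInv_eq_conj, conj_conj]
  rfl

/-- The functions `p` on the upper and `q` on the lower half-plane are the factors in a pair of
actions of weight `r` for which the pairing is invariant: they are constant multiples of
`(A + B w) ^ (-r)` and `(Ā + B̄ w⁻¹) ^ (-r)`, with constants of product
`|A| ^ (-2 r)`, so that the product of the two factors is `|A + B w| ^ (-2 r)` on the real projective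
line, as it is for complex conjugate factors. -/
def IsCocycle (r : ℝ) (g : SL(2, ℝ)) (p : ℍ → ℂ) (q : LHP → ℂ) : Prop :=
  ∃ κ κ' : ℂ, κ * κ' * ((normSq (diskA g) : ℂ))⁻¹ ^ (-(r : ℂ)) = 1 ∧
    (∀ z : ℍ, p z = κ * diskFactor r (diskA g) (diskB g) (cay z)) ∧
    ∀ t : LHP, q t = κ' * diskFactor r (conj (diskA g)) (conj (diskB g)) (cayInv t)

theorem conj_diskFactor (r : ℝ) {A B w : ℂ} (hAB : normSq A - normSq B = 1) (hw : ‖w‖ < 1) :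
    conj (diskFactor r A B w) = diskFactor r (conj A) (conj B) (conj w) := by
  have h1 : 0 < (1 + B / A * w).re :=
    re_one_add_pos (norm_mul_lt_one (norm_div_lt_one hAB) hw.le)
  have h2 : arg (1 + B / A * w) ≠ Real.pi := fun h => by
    have := (arg_eq_pi_iff.1 h).1
    linarith
  have h3 := conj_cpow (1 + B / A * w) (-(r : ℂ)) h2
  rw [map_neg, conj_ofReal] at h3
  rw [diskFactor, ← h3, diskFactor]
  simp

theorem norm_diskFactor (r : ℝ) (A B w : ℂ) :
    ‖diskFactor r A B w‖ = ‖1 + B / A * w‖ ^ (-r) := by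
  rw [diskFactor, ← ofReal_neg, norm_cpow_real]

/-- A holomorphic factor of the right absolute value is a constant multiple of the standard one,
by the maximum modulus principle. So the branches of the powers in the various actions never have to
be compared. -/
theorem isCocycle_of_norm {r : ℝ} {g : SL(2, ℝ)} {p₀ p : ℍ → ℂ} {q : LHP → ℂ}
    (h₀ : p₀ ∈ holUpper)
    (hn : ∀ z : ℍ, ‖p₀ z‖ = ‖diskA g + diskB g * cay z‖ ^ (-r)) {ψ : ℂ} (hψ : ψ ≠ 0)
    (hp : ∀ z, p z = ψ * p₀ z) (hq : ∀ t : LHP, q t = ψ⁻¹ * conj (p₀ t.conj)) :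
    IsCocycle r g p q := by
  have hAB := normSq_diskA_sub g
  set A := diskA g
  set B := diskB g
  have hA := ne_zero_of_normSq_sub hAB
  have hApos : 0 < ‖A‖ := norm_pos_iff.2 hA
  have hre : ∀ w : ℂ, ‖w‖ < 1 → 0 < (1 + B / A * w).re := fun w hw =>
    re_one_add_pos (norm_mul_lt_one (norm_div_lt_one hAB) hw.le)
  have hne : ∀ w : ℂ, ‖w‖ < 1 → 1 + B / A * w ≠ 0 := fun w hw h => by
    have := hre w hw
    rw [h] at this
    simp at this
  have hnorm : ∀ w : ℂ, ‖w‖ < 1 →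
      ‖diskUpper p₀ w / diskFactor r A B w‖ = ‖A‖ ^ (-r) := fun w hw => by
    have h1 : ‖diskUpper p₀ w‖ = ‖A‖ ^ (-r) * ‖1 + B / A * w‖ ^ (-r) := by
      rw [diskUpper_apply p₀ hw, hn, cay_upperPt,
        ← Real.mul_rpow (norm_nonneg _) (norm_nonneg _), ← norm_mul]
      congr 2
      field_simp
    have h2 : ‖1 + B / A * w‖ ^ (-r) ≠ 0 :=
      (Real.rpow_pos_of_pos (norm_pos_iff.2 (hne w hw)) _).ne'
    rw [norm_div, h1, norm_diskFactor, mul_div_assoc, div_self h2, mul_one]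
  have hfac : ∀ w : ℂ, ‖w‖ < 1 → diskFactor r A B w ≠ 0 := fun w hw => by
    rw [diskFactor, Ne, cpow_eq_zero_iff]
    exact fun h => hne w hw h.1
  have hd : DifferentiableOn ℂ (fun w => diskUpper p₀ w / diskFactor r A B w)
      (Metric.ball 0 1) :=
    (mem_holUpper_iff_diskUpper.1 h₀).div (differentiableOn_diskFactor r hAB)
      fun w hw => hfac w (by simpa using hw)
  have hconst := eqOn_of_isPreconnected_of_isMaxOn_norm (convex_ball (0 : ℂ) 1).isPreconnected
    Metric.isOpen_ball hd (Metric.mem_ball_self one_pos) (fun w hw => by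
      simp only [Function.comp, Set.mem_ofPred_eq]
      rw [hnorm w (by simpa using hw), hnorm 0 (by simp)])
  set κ₀ := diskUpper p₀ 0 / diskFactor r A B 0 with hκ₀
  have hκ₀n : ‖κ₀‖ = ‖A‖ ^ (-r) := hnorm 0 (by simp)
  have hp₀ : ∀ z : ℍ, p₀ z = κ₀ * diskFactor r A B (cay z) := fun z => by
    have hz := norm_cay_lt_one z.im_pos
    have := hconst (show cay z ∈ Metric.ball (0 : ℂ) 1 by simpa using hz)
    simp only [Function.const] at this
    rw [div_eq_iff (hfac _ hz), diskUpper_cay] at this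
    exact this
  refine ⟨ψ * κ₀, ψ⁻¹ * conj κ₀, ?_, fun z => by rw [hp, hp₀]; ring, fun t => ?_⟩
  · have e1 : ψ * κ₀ * (ψ⁻¹ * conj κ₀) = ((normSq κ₀ : ℝ) : ℂ) := by
      rw [← mul_conj]
      field_simp
    have e2 : ((normSq A : ℂ))⁻¹ ^ (-(r : ℂ)) = (((normSq A)⁻¹ ^ (-r) : ℝ) : ℂ) := by
      rw [ofReal_cpow (inv_nonneg.2 (normSq_nonneg A))]
      simp
    rw [e1, e2, ← ofReal_mul, normSq_eq_norm_sq, hκ₀n, normSq_eq_norm_sq, ← ofReal_one]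
    congr 1
    rw [Real.inv_rpow (by positivity), ← Real.rpow_natCast, ← Real.rpow_natCast,
      ← Real.rpow_mul hApos.le, ← Real.rpow_mul hApos.le]
    rw [mul_comm (-r), mul_inv_cancel₀]
    exact (Real.rpow_pos_of_pos hApos _).ne'
  · rw [hq, hp₀, map_mul, conj_diskFactor r hAB (norm_cay_lt_one t.conj.im_pos), cay_LHP_conj,
      conj_conj]
    ring

theorem IsCocycle.act_mem_holUpper {r : ℝ} {g : SL(2, ℝ)} {p : ℍ → ℂ} {q : LHP → ℂ}
    (hpq : IsCocycle r g p q) {h : ℍ → ℂ} (hh : h ∈ holUpper) :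
    (fun z => p z * h (g • z)) ∈ holUpper := by
  obtain ⟨κ, κ', -, hp, -⟩ := hpq
  have hAB := normSq_diskA_sub g
  rw [mem_holUpper_iff_diskUpper] at hh ⊢
  have hmaps : Set.MapsTo (diskMoebius (diskA g) (diskB g)) (Metric.ball 0 1) (Metric.ball 0 1) :=
    fun w hw => by simpa using norm_diskMoebius_lt_one hAB (by simpa using hw)
  refine (((differentiableOn_diskFactor r hAB).const_mul κ).mul
    (hh.comp (differentiableOn_diskMoebius hAB) hmaps)).congr fun w hw => ?_
  have hw' : ‖w‖ < 1 := by simpa using hw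
  rw [diskUpper_apply _ hw', hp, cay_upperPt, ← diskUpper_cay h, cay_smul, cay_upperPt]
  rfl

theorem IsCocycle.diskUpper_act {r : ℝ} {g : SL(2, ℝ)} {p : ℍ → ℂ} {κ : ℂ}
    (hp : ∀ z : ℍ, p z = κ * diskFactor r (diskA g) (diskB g) (cay z)) (h : ℍ → ℂ) {w : ℂ}
    (hw : ‖w‖ < 1) :
    diskUpper (fun z => p z * h (g • z)) w =
      κ * diskFactor r (diskA g) (diskB g) w *
        diskUpper h (diskMoebius (diskA g) (diskB g) w) := by
  rw [diskUpper_apply _ hw, hp, cay_upperPt, ← diskUpper_cay h, cay_smul, cay_upperPt]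

theorem IsCocycle.diskLower_act {r : ℝ} {g : SL(2, ℝ)} {q : LHP → ℂ} {κ' : ℂ}
    (hq : ∀ t : LHP, q t = κ' * diskFactor r (conj (diskA g)) (conj (diskB g)) (cayInv t))
    (f : LHP → ℂ) {u : ℂ} (hu : ‖u‖ < 1) :
    diskLower (fun t => q t * f (lowerMoebius g t)) u =
      κ' * diskFactor r (conj (diskA g)) (conj (diskB g)) u *
        diskLower f (diskMoebius (conj (diskA g)) (conj (diskB g)) u) := by
  rw [diskLower_apply _ hu, hq, cayInv_lowerPt, ← diskLower_cayInv f, cayInv_lowerMoebius,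
    cayInv_lowerPt]

/-- A neighbourhood of the closed disk is mapped into a given neighbourhood of the closed disk. -/
theorem exists_ball_mapsTo_diskMoebius {A B : ℂ} (hAB : normSq A - normSq B = 1) {R : ℝ}
    (hR : 1 < R) : ∃ R' : ℝ, 1 < R' ∧ ∀ u : ℂ, ‖u‖ < R' →
      ‖B / A * u‖ < 1 ∧ ‖diskMoebius A B u‖ < R := by
  have hA := ne_zero_of_normSq_sub hAB
  have hV : IsOpen {u : ℂ | ‖B / A * u‖ < 1} := isOpen_lt (by fun_prop) continuous_const
  have hne : ∀ u ∈ {u : ℂ | ‖B / A * u‖ < 1}, A + B * u ≠ 0 := fun u hu h => by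
    have h1 : B / A * u = -1 := by
      field_simp
      linear_combination h
    have hu' : ‖B / A * u‖ < 1 := hu
    rw [h1] at hu'
    simp at hu'
  have hcont : ContinuousOn (diskMoebius A B) {u : ℂ | ‖B / A * u‖ < 1} := fun u hu =>
    (differentiableAt_diskMoebius (hne u hu)).continuousAt.continuousWithinAt
  have hU := hcont.isOpen_inter_preimage hV (Metric.isOpen_ball (x := (0 : ℂ)) (ε := R))
  have hsub : Metric.closedBall (0 : ℂ) 1 ⊆
      {u : ℂ | ‖B / A * u‖ < 1} ∩ diskMoebius A B ⁻¹' Metric.ball 0 R := fun u hu => by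
    have hu' : ‖u‖ ≤ 1 := by simpa using hu
    refine ⟨norm_mul_lt_one (norm_div_lt_one hAB) hu', ?_⟩
    simpa using (norm_diskMoebius_le_one hAB hu').trans_lt hR
  obtain ⟨δ, hδ, h⟩ := (isCompact_closedBall (0 : ℂ) 1).exists_thickening_subset_open hU hsub
  rw [thickening_closedBall hδ zero_le_one] at h
  refine ⟨δ + 1, by linarith, fun u hu => ?_⟩
  have := h (show u ∈ Metric.ball (0 : ℂ) (δ + 1) by simpa using hu)
  exact ⟨this.1, by simpa using this.2⟩

theorem IsCocycle.act_mem_analyticLower {r : ℝ} {g : SL(2, ℝ)} {p : ℍ → ℂ} {q : LHP → ℂ}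
    (hpq : IsCocycle r g p q) {f : LHP → ℂ} (hf : f ∈ analyticLower) :
    (fun t => q t * f (lowerMoebius g t)) ∈ analyticLower := by
  obtain ⟨κ, κ', -, -, hq⟩ := hpq
  have hAB := normSq_conj_sub (normSq_diskA_sub g)
  obtain ⟨R, Φ, hΦ⟩ := hf
  obtain ⟨R', hR', hmap⟩ := exists_ball_mapsTo_diskMoebius hAB hΦ.one_lt
  refine ⟨R', fun u => κ' * diskFactor r (conj (diskA g)) (conj (diskB g)) u *
    Φ (diskMoebius (conj (diskA g)) (conj (diskB g)) u), hR', ?_, fun t => ?_⟩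
  · have hA := ne_zero_of_normSq_sub hAB
    refine DifferentiableOn.mul (DifferentiableOn.const_mul ?_ _) (hΦ.diff.comp ?_ ?_)
    · exact (differentiableOn_one_add_cpow _ _).mono fun u hu => (hmap u (by simpa using hu)).1
    · intro u hu
      refine (differentiableAt_diskMoebius fun h => ?_).differentiableWithinAt
      have h1 : conj (diskB g) / conj (diskA g) * u = -1 := by
        field_simp
        linear_combination h
      have h2 := (hmap u (by simpa using hu)).1
      rw [h1] at h2
      simp at h2
    · exact fun u hu => by simpa using (hmap u (by simpa using hu)).2
  · simp only [hq, hΦ.eq, cayInv_lowerMoebius]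

/-- Invariance of the pairing, for functions with coefficients supported on the `n` with
`(r)_n ≠ 0`. -/
theorem IsCocycle.pairing_act {r : ℝ} {g : SL(2, ℝ)} {p : ℍ → ℂ} {q : LHP → ℂ}
    (hpq : IsCocycle r g p q) {h h' : holUpper} {f f' : analyticLower}
    (hh' : ∀ z, (h' : ℍ → ℂ) z = p z * (h : ℍ → ℂ) (g • z))
    (hf' : ∀ t, (f' : LHP → ℂ) t = q t * (f : LHP → ℂ) (lowerMoebius g t))
    (hsupp : ∀ n, (ascPochhammer ℂ n).eval (r : ℂ) = 0 →
      upperCoef h n = 0 ∧ lowerCoef f' n = 0) :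
    pairing r h' f' = pairing r h f := by
  obtain ⟨κ, κ', hκ, hp, hq⟩ := hpq
  have hAB := normSq_diskA_sub g
  obtain ⟨R, Φ, hΦ⟩ := f.2
  obtain ⟨R', hR', hdec⟩ := (expansionLower_lowerCoef f'.2).decay f'.2
  have hΦd := hΦ.hasExpansion (expansionLower_lowerCoef f.2)
  rw [← (hasSum_pairing r h' f' (expansionUpper_upperCoef h'.2)
      (expansionLower_lowerCoef f'.2)).tsum_eq,
    ← (hasSum_pairing r h f (expansionUpper_upperCoef h.2)
      (expansionLower_lowerCoef f.2)).tsum_eq]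
  refine tsum_transform_eq r hAB hκ hΦ.one_lt hR'
    (expansionUpper_iff.1 (expansionUpper_upperCoef h.2)) ?_ hΦd ?_ hdec hsupp
  · refine (expansionUpper_iff.1 (expansionUpper_upperCoef h'.2)).congr fun w hw => ?_
    rw [← IsCocycle.diskUpper_act hp _ hw, funext hh']
  · refine (expansionLower_iff.1 (expansionLower_lowerCoef f'.2)).congr fun u hu => ?_
    have hu' := norm_diskMoebius_lt_one (normSq_conj_sub hAB) hu
    rw [funext hf', IsCocycle.diskLower_act hq _ hu, diskLower_apply _ hu', hΦ.eq, cayInv_lowerPt]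

/-! ### The factors of the weight `r` actions and of the principal series -/

theorem conj_cpow_ofReal {x : ℂ} (hx : x.im ≠ 0) (s : ℝ) :
    conj (x ^ (s : ℂ)) = conj x ^ (s : ℂ) := by
  have h : arg x ≠ Real.pi := fun h => hx (arg_eq_pi_iff.1 h).2
  have := conj_cpow x (s : ℂ) h
  rw [conj_ofReal] at this
  exact this.symm

theorem cpow_neg_mul_cpow {x : ℂ} (hx : x ≠ 0) (s : ℂ) : x ^ (-s) * x ^ s = 1 := by
  rw [← cpow_add _ _ hx, neg_add_cancel, cpow_zero]

theorem mem_holUpper_of_differentiableOn {h : ℍ → ℂ} {H : ℂ → ℂ}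
    (hH : DifferentiableOn ℂ H {z | 0 < z.im}) (e : ∀ z : ℍ, h z = H z) : h ∈ holUpper := by
  refine DifferentiableOn.congr hH fun z hz => ?_
  have hz' : 0 < z.im := hz
  simp only [Function.comp, ofComplex_apply_of_im_pos hz', e]

/-- The function `p` with `(h | γ)⁺(z) = v(γ)⁻¹ p(z) h⁺(γ z)`. -/
def slashFactor (r : ℝ) (g : SL(2, ℝ)) (z : ℍ) : ℂ :=
  (-I - (z : ℂ)) ^ (r : ℂ) * autFactor g z ^ (-(r : ℂ)) * (-I - ((g • z : ℍ) : ℂ)) ^ (-(r : ℂ))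

theorem neg_I_sub_im_neg {z : ℂ} (hz : 0 < z.im) : (-I - z).im < 0 := by
  simp
  linarith

theorem neg_I_sub_ne_zero {z : ℂ} (hz : 0 < z.im) : -I - z ≠ 0 := fun h => by
  have := neg_I_sub_im_neg hz
  rw [h] at this
  simp at this

theorem slashFactor_mem_holUpper (r : ℝ) (g : SL(2, ℝ)) : slashFactor r g ∈ holUpper := by
  refine mem_holUpper_of_differentiableOn (H := fun z => (-I - z) ^ (r : ℂ) *
    autFactor g z ^ (-(r : ℂ)) * (-I - moebius g z) ^ (-(r : ℂ))) ?_
    fun z => by rw [slashFactor, coe_smul_eq_moebius]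
  have haut : DifferentiableOn ℂ (autFactor g) {z | 0 < z.im} := by
    unfold autFactor
    fun_prop
  have hmob : DifferentiableOn ℂ (moebius g) {z | 0 < z.im} := by
    unfold moebius
    exact DifferentiableOn.div (by fun_prop) haut
      fun z hz => autFactor_ne_zero (ne_of_gt (show 0 < z.im from hz)) g
  refine (DifferentiableOn.mul ?_ ?_).mul ?_
  · exact DifferentiableOn.cpow (by fun_prop) (by fun_prop)
      fun z hz => .inr (neg_I_sub_im_neg hz).ne
  · by_cases hc : g 1 0 = 0
    · have : autFactor g = fun _ => ((g 1 1 : ℝ) : ℂ) := by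
        funext z
        simp [autFactor, hc]
      rw [this]
      exact differentiableOn_const _
    · refine DifferentiableOn.cpow haut (by fun_prop) fun z hz => .inr ?_
      have hz' : z.im ≠ 0 := ne_of_gt (show 0 < z.im from hz)
      simpa [autFactor] using ⟨hc, hz'⟩
  · refine DifferentiableOn.cpow (by fun_prop) (by fun_prop) fun z hz => .inr ?_
    have := (g • (⟨z, hz⟩ : ℍ)).im_pos
    rw [UpperHalfPlane.im, coe_smul_eq_moebius] at this
    exact (neg_I_sub_im_neg this).ne

theorem norm_slashFactor (r : ℝ) (g : SL(2, ℝ)) (z : ℍ) :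
    ‖slashFactor r g z‖ = ‖diskA g + diskB g * cay z‖ ^ (-r) := by
  have h1 : ‖-I - ((g • z : ℍ) : ℂ)‖ * ‖autFactor g z‖ =
      ‖-I - (z : ℂ)‖ * ‖diskA g + diskB g * cay z‖ := by
    rw [← norm_mul, ← norm_mul, ← norm_neg, ← norm_neg (_ * (_ + _))]
    congr 1
    have e1 := add_I_mul_diskA z.im_pos g
    have e2 := autFactor_mul_moebius_add z.im_pos.ne' g
    rw [coe_smul_eq_moebius]
    linear_combination e2 - e1
  have hz : ‖-I - (z : ℂ)‖ ≠ 0 := norm_ne_zero_iff.2 (neg_I_sub_ne_zero z.im_pos)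
  rw [slashFactor, norm_mul, norm_mul, ← ofReal_neg, norm_cpow_real, norm_cpow_real,
    norm_cpow_real, mul_assoc, mul_comm (‖autFactor g z‖ ^ (-r)),
    ← Real.mul_rpow (norm_nonneg _) (norm_nonneg _), h1,
    Real.mul_rpow (norm_nonneg _) (norm_nonneg _), ← mul_assoc, ← Real.rpow_add
      (lt_of_le_of_ne (norm_nonneg _) hz.symm), add_neg_cancel, Real.rpow_zero, one_mul]

theorem plusMap_slashUpper (v : SL(2, ℤ) → ℂˣ) (r : ℝ) (γ : SL(2, ℤ)) (h : ℍ → ℂ) (z : ℍ) :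
    plusMap r (slashUpper v r γ h) z =
      ((v γ : ℂ))⁻¹ * slashFactor r γ z * plusMap r h ((γ : SL(2, ℝ)) • z) := by
  have := cpow_neg_mul_cpow (neg_I_sub_ne_zero ((γ : SL(2, ℝ)) • z).im_pos) (r : ℂ)
  simp only [plusMap, LinearMap.coe_mk, AddHom.coe_mk, slashUpper, slashFactor]
  linear_combination (-(-I - (z : ℂ)) ^ (r : ℂ) * ((v γ : ℂ))⁻¹ * autFactor γ z ^ (-(r : ℂ)) *
    h ((γ : SL(2, ℝ)) • z)) * this

theorem coe_LHP_conj (t : LHP) : (t.conj : ℂ) = starRingEnd ℂ (t : ℂ) := rfl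

theorem conj_slashFactor (r : ℝ) (g : SL(2, ℝ)) (t : LHP) :
    conj (slashFactor r g t.conj) = (I - (t : ℂ)) ^ (r : ℂ) *
      conj (autFactor g (conj (t : ℂ)) ^ (-(r : ℂ))) *
      (I - (lowerMoebius g t : ℂ)) ^ (-(r : ℂ)) := by
  rw [slashFactor, map_mul, map_mul, ← ofReal_neg,
    conj_cpow_ofReal (neg_I_sub_im_neg t.conj.im_pos).ne,
    conj_cpow_ofReal (neg_I_sub_im_neg (g • t.conj).im_pos).ne, coe_smul_eq_moebius, coe_LHP_conj]
  simp only [map_sub, map_neg, conj_I, conj_conj, conj_moebius, neg_neg, lowerMoebius]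

theorem minusMap_slashLower (v : SL(2, ℤ) → ℂˣ) (r : ℝ) (γ : SL(2, ℤ)) (f : LHP → ℂ) (t : LHP) :
    minusMap r (slashLower v r γ f) t =
      (v γ : ℂ) * conj (slashFactor r γ t.conj) * minusMap r f (lowerMoebius γ t) := by
  have hne : I - (lowerMoebius γ t : ℂ) ≠ 0 := fun h => by
    have h1 := (lowerMoebius γ t).2
    have h2 := congrArg Complex.im h
    simp at h2
    linarith
  have := cpow_neg_mul_cpow hne (r : ℂ)
  rw [conj_slashFactor]
  simp only [minusMap, LinearMap.coe_mk, AddHom.coe_mk, slashLower]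
  linear_combination (-(I - (t : ℂ)) ^ (r : ℂ) * (v γ : ℂ) *
    conj (autFactor γ (conj (t : ℂ)) ^ (-(r : ℂ))) * f (lowerMoebius γ t)) * this

theorem isCocycle_slash (v : SL(2, ℤ) → ℂˣ) (r : ℝ) (γ : SL(2, ℤ)) :
    IsCocycle r γ (fun z => ((v γ : ℂ))⁻¹ * slashFactor r γ z)
      (fun t => (v γ : ℂ) * conj (slashFactor r γ t.conj)) :=
  isCocycle_of_norm (slashFactor_mem_holUpper r γ) (norm_slashFactor r γ)
    (inv_ne_zero (v γ).ne_zero) (fun _ => rfl) fun _ => by rw [inv_inv]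

theorem moebius_inv_neg_I (g : SL(2, ℝ)) :
    moebius g⁻¹ (-I) = -((g 0 1 : ℝ) + I * (g 1 1 : ℝ)) / ((g 0 0 : ℝ) + I * (g 1 0 : ℝ)) := by
  rw [moebius, autFactor, Matrix.SpecialLinearGroup.SL2_inv_expl]
  simp
  ring

theorem psFactor_plus (r : ℝ) (g : SL(2, ℝ)) (z : ℂ) :
    psFactor (r / 2) r g z = (((g 0 0 : ℝ) : ℂ) + I * ((g 1 0 : ℝ) : ℂ)) ^ (-(r : ℂ)) *
      ((z + I) / (z - moebius g⁻¹ (-I))) ^ (r : ℂ) := by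
  have e1 : (r : ℂ) / 2 - ((r / 2 : ℝ) : ℂ) = 0 := by push_cast; ring
  have e2 : ((r / 2 : ℝ) : ℂ) - (r : ℂ) / 2 = 0 := by push_cast; ring
  have e3 : -((r / 2 : ℝ) : ℂ) - (r : ℂ) / 2 = -r := by push_cast; ring
  have e4 : ((r / 2 : ℝ) : ℂ) + (r : ℂ) / 2 = r := by push_cast; ring
  rw [psFactor, e1, e2, e3, e4, cpow_zero, cpow_zero, one_mul, one_mul]

theorem psFactor_minus (r : ℝ) (g : SL(2, ℝ)) (t : ℂ) :
    psFactor (r / 2) (-r) g t = (((g 0 0 : ℝ) : ℂ) - I * ((g 1 0 : ℝ) : ℂ)) ^ (-(r : ℂ)) *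
      ((t - I) / (t - moebius g⁻¹ I)) ^ (r : ℂ) := by
  have e1 : ((-r : ℝ) : ℂ) / 2 - ((r / 2 : ℝ) : ℂ) = -r := by push_cast; ring
  have e2 : ((r / 2 : ℝ) : ℂ) - ((-r : ℝ) : ℂ) / 2 = r := by push_cast; ring
  have e3 : -((r / 2 : ℝ) : ℂ) - ((-r : ℝ) : ℂ) / 2 = 0 := by push_cast; ring
  have e4 : ((r / 2 : ℝ) : ℂ) + ((-r : ℝ) : ℂ) / 2 = 0 := by push_cast; ring
  rw [psFactor, e1, e2, e3, e4, cpow_zero, cpow_zero, mul_one, mul_one]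

theorem add_I_mul_ne_zero (g : SL(2, ℝ)) : ((g 0 0 : ℝ) : ℂ) + I * ((g 1 0 : ℝ) : ℂ) ≠ 0 := by
  intro h
  have h1 := congrArg Complex.re h
  have h2 := congrArg Complex.im h
  simp at h1 h2
  have := SL2_det g
  rw [h1, h2] at this
  simp at this

theorem moebius_inv_neg_I_im_neg (g : SL(2, ℝ)) : (moebius g⁻¹ (-I)).im < 0 :=
  moebius_im_neg g⁻¹ (by simp)

theorem div_mem_slitPlane {x y : ℂ} (hx : 0 < x.im) (hy : 0 < y.im) : x / y ∈ slitPlane := by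
  rw [mem_slitPlane_iff_not_le_zero]
  intro h
  obtain ⟨h1, h2⟩ := Complex.le_def.1 h
  have hy0 : y ≠ 0 := fun h => by rw [h] at hy; simp at hy
  have e : x = x / y * y := by field_simp
  have e' := congrArg Complex.im e
  rw [mul_im, h2] at e'
  simp only [zero_re, zero_im, zero_mul, add_zero] at h1 e'
  nlinarith

theorem psFactor_plus_mem_slitPlane (g : SL(2, ℝ)) {z : ℂ} (hz : 0 < z.im) :
    (z + I) / (z - moebius g⁻¹ (-I)) ∈ slitPlane := by
  have := moebius_inv_neg_I_im_neg g
  refine div_mem_slitPlane ?_ ?_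
  · simp only [add_im, Complex.I_im]
    linarith
  · simp only [sub_im]
    linarith

theorem psFactor_mem_holUpper (r : ℝ) (g : SL(2, ℝ)) :
    (fun z : ℍ => psFactor (r / 2) r g z) ∈ holUpper := by
  refine mem_holUpper_of_differentiableOn (H := fun z : ℂ =>
    (((g 0 0 : ℝ) : ℂ) + I * ((g 1 0 : ℝ) : ℂ)) ^ (-(r : ℂ)) *
      ((z + I) / (z - moebius g⁻¹ (-I))) ^ (r : ℂ)) ?_ fun z => psFactor_plus r g z
  refine DifferentiableOn.const_mul (DifferentiableOn.cpow ?_ (by fun_prop)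
    fun z hz => psFactor_plus_mem_slitPlane g hz) _
  refine DifferentiableOn.div (by fun_prop) (by fun_prop) fun z hz h => ?_
  have h1 := moebius_inv_neg_I_im_neg g
  have h2 := congrArg Complex.im h
  have hz' : 0 < z.im := hz
  simp only [sub_im, zero_im] at h2
  linarith

theorem norm_psFactor (r : ℝ) (g : SL(2, ℝ)) (z : ℍ) :
    ‖psFactor (r / 2) r g z‖ = ‖diskA g + diskB g * cay z‖ ^ (-r) := by
  have h0 := add_I_mul_ne_zero g
  have hz := add_I_ne_zero z.im_pos
  have hAB := add_mul_ne_zero (normSq_diskA_sub g) (norm_cay_lt_one z.im_pos).le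
  have e1 : ((z : ℂ) - moebius g⁻¹ (-I)) =
      (z + I) * (diskA g + diskB g * cay z) / ((g 0 0 : ℝ) + I * (g 1 0 : ℝ)) := by
    rw [add_I_mul_diskA z.im_pos, moebius_inv_neg_I, eq_div_iff h0, sub_mul,
      div_mul_cancel₀ _ h0]
    ring
  have e2 : ((z : ℂ) + I) / (z - moebius g⁻¹ (-I)) =
      ((g 0 0 : ℝ) + I * (g 1 0 : ℝ)) / (diskA g + diskB g * cay z) := by
    rw [e1, div_div_eq_mul_div, mul_div_mul_left _ _ hz]
  have hpos := norm_pos_iff.2 h0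
  rw [psFactor_plus, e2, norm_mul, ← ofReal_neg, norm_cpow_real, norm_cpow_real, norm_div,
    Real.div_rpow (norm_nonneg _) (norm_nonneg _), Real.rpow_neg (norm_nonneg _),
    Real.rpow_neg (norm_nonneg _)]
  have := (Real.rpow_pos_of_pos hpos r).ne'
  field_simp

theorem arg_ne_pi_of_mem_G0 {g : SL(2, ℝ)} (hg : g ∈ G0) :
    arg (((g 0 0 : ℝ) : ℂ) + I * ((g 1 0 : ℝ) : ℂ)) ≠ Real.pi := by
  intro h
  obtain ⟨h1, h2⟩ := arg_eq_pi_iff.1 h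
  simp at h1 h2
  refine hg (arg_eq_pi_iff.2 ?_)
  have hdet := SL2_det g
  rw [h2, mul_zero, sub_zero] at hdet
  simp only [autFactor, h2]
  simp
  nlinarith

theorem conj_psFactor (r : ℝ) {g : SL(2, ℝ)} (hg : g ∈ G0) (t : LHP) :
    conj (psFactor (r / 2) r g t.conj) = psFactor (r / 2) (-r) g t := by
  have h1 := conj_cpow _ (((-r : ℝ)) : ℂ) (arg_ne_pi_of_mem_G0 hg)
  have h2 := conj_cpow _ (r : ℂ)
    (slitPlane_arg_ne_pi (psFactor_plus_mem_slitPlane g t.conj.im_pos))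
  rw [conj_ofReal] at h1 h2
  rw [psFactor_plus, psFactor_minus, map_mul, ← ofReal_neg, ← h1, ← h2]
  simp only [map_add, map_mul, map_div₀, map_sub, conj_ofReal, conj_I, conj_moebius, map_neg,
    neg_neg, coe_LHP_conj, conj_conj]
  ring_nf

theorem isCocycle_ps (r : ℝ) (k : ℤ) {g : SL(2, ℝ)} (hg : g ∈ G0) :
    IsCocycle r g (fun z => exp (-(Real.pi * I * r * k)) * psFactor (r / 2) r g z)
      (fun t => exp (Real.pi * I * r * k) * psFactor (r / 2) (-r) g t) :=
  isCocycle_of_norm (psFactor_mem_holUpper r g) (norm_psFactor r g) (exp_ne_zero _)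
    (fun _ => rfl) fun t => by rw [conj_psFactor r hg, ← exp_neg, neg_neg]

/-! ### Polynomials -/

theorem exists_homogenization {a : ℕ} {P : Polynomial ℂ} (hP : P.natDegree ≤ a)
    (α β γ δ : ℂ) : ∃ Q : Polynomial ℂ, Q.natDegree ≤ a ∧ ∀ x, γ * x + δ ≠ 0 →
      Q.eval x = (γ * x + δ) ^ a * P.eval ((α * x + β) / (γ * x + δ)) := by
  refine ⟨∑ k ∈ Finset.range (a + 1), Polynomial.C (P.coeff k) *
    (Polynomial.C α * Polynomial.X + Polynomial.C β) ^ k *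
    (Polynomial.C γ * Polynomial.X + Polynomial.C δ) ^ (a - k), ?_, fun x hx => ?_⟩
  · refine Polynomial.natDegree_sum_le_of_forall_le _ _ fun k hk => ?_
    have hk' : k ≤ a := Nat.lt_succ_iff.1 (Finset.mem_range.1 hk)
    have h1 : ((Polynomial.C α * Polynomial.X + Polynomial.C β) ^ k).natDegree ≤ k * 1 :=
      Polynomial.natDegree_pow_le_of_le k Polynomial.natDegree_linear_le
    have h2 : ((Polynomial.C γ * Polynomial.X + Polynomial.C δ) ^ (a - k)).natDegree ≤
        (a - k) * 1 := Polynomial.natDegree_pow_le_of_le _ Polynomial.natDegree_linear_le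
    have h3 := (Polynomial.natDegree_C_mul_le (P.coeff k)
      ((Polynomial.C α * Polynomial.X + Polynomial.C β) ^ k)).trans h1
    have := Polynomial.natDegree_mul_le_of_le h3 h2
    omega
  · rw [Polynomial.eval_finsetSum, Polynomial.eval_eq_sum_range' (Nat.lt_succ_of_le hP),
      Finset.mul_sum]
    have hx' : x * γ + δ ≠ 0 := by rwa [mul_comm]
    refine Finset.sum_congr rfl fun k hk => ?_
    have hk' : k ≤ a := Nat.lt_succ_iff.1 (Finset.mem_range.1 hk)
    have e : (γ * x + δ) ^ a = (γ * x + δ) ^ (a - k) * (γ * x + δ) ^ k := by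
      rw [← pow_add, Nat.sub_add_cancel hk']
    simp only [Polynomial.eval_mul, Polynomial.eval_pow, Polynomial.eval_add, Polynomial.eval_C,
      Polynomial.eval_X, e, div_pow]
    field_simp

theorem cpow_neg_natCast (x : ℂ) (a : ℕ) : x ^ (((-(a : ℝ) : ℝ)) : ℂ) = (x ^ a)⁻¹ := by
  rw [ofReal_neg, cpow_neg, ofReal_natCast, cpow_natCast]

theorem plusMap_mem_diskPolUpper_iff {a : ℕ} {h : ℍ → ℂ} :
    plusMap (-(a : ℝ)) h ∈ diskPolUpper a ↔ h ∈ polUpper a := by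
  have hval : ∀ z : ℍ, plusMap (-(a : ℝ)) h z = ((-I - (z : ℂ)) ^ a)⁻¹ * h z := fun z => by
    simp only [plusMap, LinearMap.coe_mk, AddHom.coe_mk, cpow_neg_natCast]
  constructor
  · rintro ⟨P, hP, hPe⟩
    obtain ⟨Q, hQ, hQe⟩ := exists_homogenization hP 1 (-I) 1 I
    refine ⟨Polynomial.C ((-1) ^ a) * Q, (Polynomial.natDegree_C_mul_le _ _).trans hQ,
      fun z => ?_⟩
    have hz := add_I_ne_zero z.im_pos
    have hz' := pow_ne_zero a (neg_I_sub_ne_zero z.im_pos)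
    have h1 := hPe z
    rw [hval, inv_mul_eq_iff_eq_mul₀ hz'] at h1
    rw [h1, Polynomial.eval_mul, Polynomial.eval_C, hQe z (by simpa using hz), cay, ← mul_assoc,
      ← mul_pow]
    simp only [one_mul, ← sub_eq_add_neg]
    congr 2
    ring
  · rintro ⟨P, hP, hPe⟩
    obtain ⟨Q, hQ, hQe⟩ := exists_homogenization hP I I (-1) 1
    refine ⟨Polynomial.C ((I / 2) ^ a) * Q, (Polynomial.natDegree_C_mul_le _ _).trans hQ,
      fun z => ?_⟩
    have hz := add_I_ne_zero z.im_pos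
    have hz' := neg_I_sub_ne_zero z.im_pos
    have h1 : 1 - cay z ≠ 0 := one_sub_ne_zero_of_norm_lt (norm_cay_lt_one z.im_pos)
    have h2 : (I * cay z + I) / (-1 * cay z + 1) = z := by
      have := icay_cay z.im_pos
      rw [icay] at this
      rw [show I * cay z + I = I * (1 + cay z) by ring, show -1 * cay z + 1 = 1 - cay z by ring]
      exact this
    rw [hval, hPe, Polynomial.eval_mul, Polynomial.eval_C,
      hQe _ (by rwa [show -1 * cay z + 1 = 1 - cay z by ring]), h2, ← mul_assoc, ← mul_pow,
      ← inv_pow]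
    congr 2
    have h3 : -1 * cay z + 1 = 2 * I / (z + I) := by
      rw [cay]
      field_simp
      ring
    rw [h3, show -I - (z : ℂ) = -(z + I) by ring, inv_neg]
    field_simp
    rw [I_sq]

theorem LHP.sub_I_ne_zero (t : LHP) : (t : ℂ) - I ≠ 0 := fun h => by
  have h1 := t.2
  have h2 := congrArg Complex.im h
  simp at h2
  linarith

theorem minusMap_mem_diskPolLower_iff {a : ℕ} {f : LHP → ℂ} :
    minusMap (-(a : ℝ)) f ∈ diskPolLower a ↔ f ∈ polLower a := by
  have hval : ∀ t : LHP, minusMap (-(a : ℝ)) f t = ((I - (t : ℂ)) ^ a)⁻¹ * f t := fun t => by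
    simp only [minusMap, LinearMap.coe_mk, AddHom.coe_mk, cpow_neg_natCast]
  have hne : ∀ t : LHP, I - (t : ℂ) ≠ 0 := fun t h =>
    t.sub_I_ne_zero (by rw [← neg_sub, h, neg_zero])
  constructor
  · rintro ⟨P, hP, hPe⟩
    obtain ⟨Q, hQ, hQe⟩ := exists_homogenization hP 1 I 1 (-I)
    refine ⟨Polynomial.C ((-1) ^ a) * Q, (Polynomial.natDegree_C_mul_le _ _).trans hQ,
      fun t => ?_⟩
    have ht := t.sub_I_ne_zero
    have h1 := hPe t
    rw [hval, inv_mul_eq_iff_eq_mul₀ (pow_ne_zero a (hne t))] at h1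
    rw [h1, Polynomial.eval_mul, Polynomial.eval_C,
      hQe t (by simpa [← sub_eq_add_neg] using ht), cayInv, ← mul_assoc, ← mul_pow]
    simp only [one_mul, ← sub_eq_add_neg]
    congr 2
    ring
  · rintro ⟨P, hP, hPe⟩
    obtain ⟨Q, hQ, hQe⟩ := exists_homogenization hP (-I) (-I) (-1) 1
    refine ⟨Polynomial.C ((-I / 2) ^ a) * Q, (Polynomial.natDegree_C_mul_le _ _).trans hQ,
      fun t => ?_⟩
    have ht := t.sub_I_ne_zero
    have ht' := hne t
    have h3 : -1 * cayInv t + 1 = 2 * I / (I - t) := by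
      rw [cayInv, ← neg_sub I (t : ℂ)]
      field_simp
      ring
    have h4 : -I * cayInv t + -I = 2 * I * t / (I - t) := by
      rw [cayInv, ← neg_sub I (t : ℂ)]
      field_simp
      ring
    have h2 : (-I * cayInv t + -I) / (-1 * cayInv t + 1) = t := by
      rw [h3, h4]
      field_simp
    have h1 : -1 * cayInv t + 1 ≠ 0 := by
      rw [h3]
      exact div_ne_zero (mul_ne_zero two_ne_zero I_ne_zero) ht'
    rw [hval, hPe, Polynomial.eval_mul, Polynomial.eval_C, hQe _ h1, h2, ← mul_assoc, ← mul_pow,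
      ← inv_pow]
    congr 2
    rw [h3]
    field_simp
    rw [I_sq]
    ring

theorem diskPolLower_le_analyticLower (a : ℕ) : diskPolLower a ≤ analyticLower := by
  rintro f ⟨P, -, hP⟩
  exact ⟨2, fun u => P.eval u, one_lt_two, P.differentiable.differentiableOn, hP⟩

/-- `(1 + B / A w) ^ a P(M w)`, with the Möbius transformation `M` of the disk, is a polynomial in `w`
of degree at most `a`. -/
theorem exists_polynomial_act {a : ℕ} {A B : ℂ} (hAB : normSq A - normSq B = 1) (κ : ℂ)
    {P : Polynomial ℂ} (hP : P.natDegree ≤ a) : ∃ Q : Polynomial ℂ, Q.natDegree ≤ a ∧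
      ∀ w, ‖w‖ < 1 → κ * diskFactor (-(a : ℝ)) A B w * P.eval (diskMoebius A B w) = Q.eval w := by
  obtain ⟨Q, hQ, hQe⟩ := exists_homogenization hP (conj A) (conj B) B A
  refine ⟨Polynomial.C (κ * (A ^ a)⁻¹) * Q, (Polynomial.natDegree_C_mul_le _ _).trans hQ,
    fun w hw => ?_⟩
  have h0 := add_mul_ne_zero hAB hw.le
  have hA := ne_zero_of_normSq_sub hAB
  have e1 : diskFactor (-(a : ℝ)) A B w = (A ^ a)⁻¹ * (A + B * w) ^ a := by
    have : (-((-(a : ℝ) : ℝ) : ℂ)) = (a : ℂ) := by push_cast; ring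
    rw [diskFactor, this, cpow_natCast, ← inv_pow, ← mul_pow]
    congr 1
    field_simp
  rw [Polynomial.eval_mul, Polynomial.eval_C, hQe w (by rwa [add_comm]), e1, diskMoebius,
    add_comm (conj A * w), add_comm (B * w)]
  ring

theorem IsCocycle.act_mem_diskPolUpper {a : ℕ} {g : SL(2, ℝ)} {p : ℍ → ℂ} {q : LHP → ℂ}
    (hpq : IsCocycle (-(a : ℝ)) g p q) {h : ℍ → ℂ} (hh : h ∈ diskPolUpper a) :
    (fun z => p z * h (g • z)) ∈ diskPolUpper a := by
  obtain ⟨κ, κ', -, hp, -⟩ := hpq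
  obtain ⟨P, hP, hPe⟩ := hh
  obtain ⟨Q, hQ, hQe⟩ := exists_polynomial_act (normSq_diskA_sub g) κ hP
  refine ⟨Q, hQ, fun z => ?_⟩
  rw [← hQe _ (norm_cay_lt_one z.im_pos)]
  simp only [hp, hPe, cay_smul]

theorem IsCocycle.act_mem_diskPolLower {a : ℕ} {g : SL(2, ℝ)} {p : ℍ → ℂ} {q : LHP → ℂ}
    (hpq : IsCocycle (-(a : ℝ)) g p q) {f : LHP → ℂ} (hf : f ∈ diskPolLower a) :
    (fun t => q t * f (lowerMoebius g t)) ∈ diskPolLower a := by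
  obtain ⟨κ, κ', -, -, hq⟩ := hpq
  obtain ⟨P, hP, hPe⟩ := hf
  obtain ⟨Q, hQ, hQe⟩ := exists_polynomial_act (normSq_conj_sub (normSq_diskA_sub g)) κ' hP
  refine ⟨Q, hQ, fun t => ?_⟩
  rw [← hQe _ (norm_cayInv_lt_one t)]
  simp only [hq, hPe, cayInv_lowerMoebius]

theorem upperCoef_eq_zero_of_mem_diskPolUpper {a : ℕ} {h : ℍ → ℂ} (hh : h ∈ diskPolUpper a)
    {n : ℕ} (hn : a < n) : upperCoef h n = 0 := by
  obtain ⟨P, hP, hPe⟩ := hh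
  have : ExpansionUpper h P.coeff := fun z => by
    rw [hPe z]
    exact hasExpansion_polynomial P 1 _ (norm_cay_lt_one z.im_pos)
  rw [this.upperCoef_eq]
  exact Polynomial.coeff_eq_zero_of_natDegree_lt (hP.trans_lt hn)

theorem lowerCoef_eq_zero_of_mem_diskPolLower {a : ℕ} {f : LHP → ℂ} (hf : f ∈ diskPolLower a)
    {n : ℕ} (hn : a < n) : lowerCoef f n = 0 := by
  obtain ⟨P, hP, hPe⟩ := hf
  have : ExpansionLower f P.coeff := fun t => by
    rw [hPe t]
    exact hasExpansion_polynomial P 1 _ (norm_cayInv_lt_one t)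
  rw [this.lowerCoef_eq]
  exact Polynomial.coeff_eq_zero_of_natDegree_lt (hP.trans_lt hn)

theorem exists_expansionPol {a : ℕ} {f : LHP → ℂ} (hf : f ∈ diskPolLower a) :
    ∃ d, ExpansionPol a f d := by
  obtain ⟨P, hP, hPe⟩ := hf
  exact ⟨P.coeff, fun t => by
    rw [hPe t, Polynomial.eval_eq_sum_range' (Nat.lt_succ_of_le hP)]⟩

/-- Invariance of the pairing for weights outside `ℤ_{≤ 0}`. -/
theorem IsCocycle.pairing_act_of_ne {r : ℝ} (hr : ∀ a : ℕ, r ≠ -(a : ℝ)) {g : SL(2, ℝ)}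
    {p : ℍ → ℂ} {q : LHP → ℂ} (hpq : IsCocycle r g p q) {h h' : holUpper} {f f' : analyticLower}
    (hh' : ∀ z, (h' : ℍ → ℂ) z = p z * (h : ℍ → ℂ) (g • z))
    (hf' : ∀ t, (f' : LHP → ℂ) t = q t * (f : LHP → ℂ) (lowerMoebius g t)) :
    pairing r h' f' = pairing r h f :=
  hpq.pairing_act hh' hf' fun n hn => by
    obtain ⟨j, -, hj⟩ := (ascPochhammer_eval_eq_zero_iff r n).1 hn
    exact (hr j hj).elim

/-- Invariance of the pairing on polynomials. -/
theorem IsCocycle.pairing_act_pol {a : ℕ} {g : SL(2, ℝ)} {p : ℍ → ℂ} {q : LHP → ℂ}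
    (hpq : IsCocycle (-(a : ℝ)) g p q) {h h' : holUpper} {f f' : analyticLower}
    (hh : (h : ℍ → ℂ) ∈ diskPolUpper a) (hf : (f : LHP → ℂ) ∈ diskPolLower a)
    (hh' : ∀ z, (h' : ℍ → ℂ) z = p z * (h : ℍ → ℂ) (g • z))
    (hf' : ∀ t, (f' : LHP → ℂ) t = q t * (f : LHP → ℂ) (lowerMoebius g t)) :
    pairing (-(a : ℝ)) h' f' = pairing (-(a : ℝ)) h f := by
  have hf'' : (f' : LHP → ℂ) ∈ diskPolLower a := by
    rw [funext hf']
    exact hpq.act_mem_diskPolLower hf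
  refine hpq.pairing_act hh' hf' fun n hn => ?_
  obtain ⟨j, hj, hj'⟩ := (ascPochhammer_eval_eq_zero_iff _ n).1 hn
  have haj : a = j := by
    have : (a : ℝ) = j := by linarith
    exact_mod_cast this
  rw [← haj] at hj
  exact ⟨upperCoef_eq_zero_of_mem_diskPolUpper hh hj, lowerCoef_eq_zero_of_mem_diskPolLower hf'' hj⟩

/-! ### Non-degeneracy -/

/-- The monomial `w ^ m` on the upper half-plane. -/
def upperMonomial (m : ℕ) (z : ℍ) : ℂ := cay z ^ m

/-- The monomial `w ^ (-m)` on the lower half-plane. -/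
def lowerMonomial (m : ℕ) (t : LHP) : ℂ := cayInv t ^ m

theorem upperMonomial_mem {m a : ℕ} (hm : m ≤ a) : upperMonomial m ∈ diskPolUpper a :=
  ⟨Polynomial.X ^ m, by simpa using hm, fun z => by simp [upperMonomial]⟩

theorem lowerMonomial_mem {m a : ℕ} (hm : m ≤ a) : lowerMonomial m ∈ diskPolLower a :=
  ⟨Polynomial.X ^ m, by simpa using hm, fun z => by simp [lowerMonomial]⟩

theorem upperMonomial_mem_holUpper (m : ℕ) : upperMonomial m ∈ holUpper :=
  diskPolUpper_le_holUpper m (upperMonomial_mem le_rfl)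

theorem lowerMonomial_mem_analyticLower (m : ℕ) : lowerMonomial m ∈ analyticLower :=
  diskPolLower_le_analyticLower m (lowerMonomial_mem le_rfl)

theorem pairing_lowerMonomial (r : ℝ) (h : holUpper) (m : ℕ) :
    pairing r h ⟨lowerMonomial m, lowerMonomial_mem_analyticLower m⟩ =
      coeff r m * upperCoef h m := by
  have hd : ExpansionLower (lowerMonomial m) (Pi.single m 1) := fun t =>
    hasExpansion_monomial m 1 _ (norm_cayInv_lt_one t)
  have := hasSum_pairing r h ⟨lowerMonomial m, lowerMonomial_mem_analyticLower m⟩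
    (expansionUpper_upperCoef h.2) hd
  refine this.unique ?_
  convert! hasSum_single (f := fun n => coeff r n * upperCoef h n * (Pi.single m 1 : ℕ → ℂ) n) m ?_
    using 1
  · simp
  · intro n hn
    simp [Pi.single_eq_of_ne hn]

theorem pairing_upperMonomial (r : ℝ) (f : analyticLower) (m : ℕ) :
    pairing r ⟨upperMonomial m, upperMonomial_mem_holUpper m⟩ f = coeff r m * lowerCoef f m := by
  have hc : ExpansionUpper (upperMonomial m) (Pi.single m 1) := fun z =>
    hasExpansion_monomial m 1 _ (norm_cay_lt_one z.im_pos)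
  have := hasSum_pairing r ⟨upperMonomial m, upperMonomial_mem_holUpper m⟩ f hc
    (expansionLower_lowerCoef f.2)
  refine this.unique ?_
  convert! hasSum_single (f := fun n => coeff r n * (Pi.single m 1 : ℕ → ℂ) n * lowerCoef f n) m ?_
    using 1
  · simp
  · intro n hn
    simp [Pi.single_eq_of_ne hn]

theorem eq_zero_of_upperCoef {h : ℍ → ℂ} (hh : h ∈ holUpper) (h0 : ∀ n, upperCoef h n = 0) :
    h = 0 := by
  funext z
  have := expansionUpper_upperCoef hh z
  simp only [h0, zero_mul] at this
  exact this.unique hasSum_zero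

theorem eq_zero_of_lowerCoef {f : LHP → ℂ} (hf : f ∈ analyticLower) (h0 : ∀ n, lowerCoef f n = 0) :
    f = 0 := by
  funext t
  have := expansionLower_lowerCoef hf t
  simp only [h0, zero_mul] at this
  exact this.unique hasSum_zero

theorem pairing_nondegenerate {r : ℝ} (hr : ∀ a : ℕ, r ≠ -(a : ℝ)) : (pairing r).Nondegenerate := by
  constructor
  · refine fun h H => Subtype.ext (eq_zero_of_upperCoef h.2 fun n => ?_)
    have := H ⟨lowerMonomial n, lowerMonomial_mem_analyticLower n⟩
    rw [pairing_lowerMonomial] at this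
    exact (mul_eq_zero.1 this).resolve_left (coeff_ne_zero fun j _ => hr j)
  · refine fun f H => Subtype.ext (eq_zero_of_lowerCoef f.2 fun n => ?_)
    have := H ⟨upperMonomial n, upperMonomial_mem_holUpper n⟩
    rw [pairing_upperMonomial] at this
    exact (mul_eq_zero.1 this).resolve_left (coeff_ne_zero fun j _ => hr j)

theorem coeff_neg_nat_ne_zero {a n : ℕ} (hn : n ≤ a) : coeff (-(a : ℝ)) n ≠ 0 :=
  coeff_ne_zero fun j hj h => by
    have : (a : ℝ) = j := by linarith
    have : a = j := by exact_mod_cast this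
    omega

/-- The pairing restricted to polynomials. -/
def polPairing (a : ℕ) : diskPolUpper a →ₗ[ℂ] diskPolLower a →ₗ[ℂ] ℂ :=
  (pairing (-(a : ℝ))).compl₁₂ (Submodule.inclusion (diskPolUpper_le_holUpper a))
    (Submodule.inclusion (diskPolLower_le_analyticLower a))

theorem polPairing_nondegenerate (a : ℕ) : (polPairing a).Nondegenerate := by
  constructor
  · refine fun h H => Subtype.ext
      (eq_zero_of_upperCoef (diskPolUpper_le_holUpper a h.2) fun n => ?_)
    rcases le_or_gt n a with hn | hn
    · have := H ⟨lowerMonomial n, lowerMonomial_mem hn⟩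
      have e : polPairing a h ⟨lowerMonomial n, lowerMonomial_mem hn⟩ = _ :=
        pairing_lowerMonomial (-(a : ℝ)) (Submodule.inclusion (diskPolUpper_le_holUpper a) h) n
      rw [e] at this
      exact (mul_eq_zero.1 this).resolve_left (coeff_neg_nat_ne_zero hn)
    · exact upperCoef_eq_zero_of_mem_diskPolUpper h.2 hn
  · refine fun f H => Subtype.ext
      (eq_zero_of_lowerCoef (diskPolLower_le_analyticLower a f.2) fun n => ?_)
    rcases le_or_gt n a with hn | hn
    · have := H ⟨upperMonomial n, upperMonomial_mem hn⟩
      have e : polPairing a ⟨upperMonomial n, upperMonomial_mem hn⟩ f = _ :=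
        pairing_upperMonomial (-(a : ℝ)) (Submodule.inclusion (diskPolLower_le_analyticLower a) f) n
      rw [e] at this
      exact (mul_eq_zero.1 this).resolve_left (coeff_neg_nat_ne_zero hn)
    · exact lowerCoef_eq_zero_of_mem_diskPolLower f.2 hn

/-! ### Representatives of hyperfunctions -/

theorem isPreconnected_annulus (a b : ℝ) (ha : 0 ≤ a) :
    IsPreconnected {w : ℂ | a < ‖w‖ ∧ ‖w‖ < b} := by
  have h : {w : ℂ | a < ‖w‖ ∧ ‖w‖ < b} =
      (fun p : ℝ × ℝ => (p.1 : ℂ) * exp (p.2 * I)) '' (Set.Ioo a b ×ˢ Set.univ) := by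
    ext w
    constructor
    · intro hw
      exact ⟨(‖w‖, arg w), ⟨hw, trivial⟩, norm_mul_exp_arg_mul_I w⟩
    · rintro ⟨⟨x, y⟩, ⟨hx, -⟩, rfl⟩
      have hx0 : 0 ≤ x := ha.trans hx.1.le
      have : ‖(x : ℂ) * exp (y * I)‖ = x := by
        rw [norm_mul, norm_exp_ofReal_mul_I, mul_one, norm_real, Real.norm_of_nonneg hx0]
      simp only [Set.mem_ofPred_eq, this]
      exact hx
  rw [h]
  exact (isPreconnected_Ioo.prod isPreconnected_univ).image _ (by fun_prop)

theorem isOpen_annulus (a b : ℝ) : IsOpen {w : ℂ | a < ‖w‖ ∧ ‖w‖ < b} :=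
  (isOpen_lt continuous_const continuous_norm).inter (isOpen_lt continuous_norm continuous_const)

/-- Identity theorem, for functions that vanish on an annulus. -/
theorem eq_zero_of_eq_zero_on_annulus {U : Set ℂ} (hU : IsOpen U) (hc : IsPreconnected U)
    {G : ℂ → ℂ} (hG : DifferentiableOn ℂ G U) {a b : ℝ} (ha : 0 ≤ a) (hab : a < b)
    (hsub : {w : ℂ | a < ‖w‖ ∧ ‖w‖ < b} ⊆ U) (h0 : ∀ w : ℂ, a < ‖w‖ → ‖w‖ < b → G w = 0) :
    ∀ w ∈ U, G w = 0 := by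
  obtain ⟨x, hax, hxb⟩ := exists_between hab
  have hx : ‖(x : ℂ)‖ = x := by rw [norm_real, Real.norm_of_nonneg (ha.trans hax.le)]
  have hmem : (x : ℂ) ∈ {w : ℂ | a < ‖w‖ ∧ ‖w‖ < b} := by
    simp only [Set.mem_ofPred_eq, hx]
    exact ⟨hax, hxb⟩
  refine (hG.analyticOnNhd hU).eqOn_zero_of_preconnected_of_eventuallyEq_zero hc (hsub hmem) ?_
  filter_upwards [(isOpen_annulus a b).mem_nhds hmem] with w hw
  exact h0 w hw.1 hw.2

theorem differentiableOn_diskLower {f : LHP → ℂ} (hf : f ∈ analyticLower) :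
    DifferentiableOn ℂ (diskLower f) (Metric.ball 0 1) :=
  (expansionLower_iff.1 (expansionLower_lowerCoef hf)).differentiableOn

theorem eq_of_diskUpper_eq {h k : ℍ → ℂ} (hh : h ∈ holUpper) (hk : k ∈ holUpper) {c : ℝ}
    (hc0 : 0 < c) (hc1 : c < 1)
    (H : ∀ (w : ℂ) (hw : ‖w‖ < 1), c < ‖w‖ → h (upperPt w hw) = k (upperPt w hw)) : h = k := by
  have hd := mem_holUpper_iff_diskUpper.1 (holUpper.sub_mem hh hk)
  have := eq_zero_of_eq_zero_on_annulus Metric.isOpen_ball (convex_ball (0 : ℂ) 1).isPreconnected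
    hd hc0.le hc1 (fun w hw => by simpa using hw.2) (fun w h1 h2 => by
      rw [diskUpper_apply _ h2, Pi.sub_apply, H w h2 h1, sub_self])
  funext z
  have hz := this (cay z) (by simpa using norm_cay_lt_one z.im_pos)
  rw [diskUpper_cay] at hz
  exact sub_eq_zero.1 hz

theorem eq_of_diskLower_eq {f k : LHP → ℂ} (hf : f ∈ analyticLower) (hk : k ∈ analyticLower)
    {c : ℝ} (hc0 : 0 < c) (hc1 : c < 1)
    (H : ∀ (u : ℂ) (hu : ‖u‖ < 1), c < ‖u‖ → f (lowerPt u hu) = k (lowerPt u hu)) : f = k := by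
  have hd := differentiableOn_diskLower (analyticLower.sub_mem hf hk)
  have := eq_zero_of_eq_zero_on_annulus Metric.isOpen_ball (convex_ball (0 : ℂ) 1).isPreconnected
    hd hc0.le hc1 (fun w hw => by simpa using hw.2) (fun w h1 h2 => by
      rw [diskLower_apply _ h2, Pi.sub_apply, H w h2 h1, sub_self])
  funext t
  have hz := this (cayInv t) (by simpa using norm_cayInv_lt_one t)
  rw [diskLower_cayInv] at hz
  exact sub_eq_zero.1 hz

theorem cay_lowerPt {u : ℂ} (hu : ‖u‖ < 1) : cay (lowerPt u hu) = u⁻¹ := by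
  have := cayInv_eq_inv (lowerPt u hu : ℂ)
  rw [cayInv_lowerPt] at this
  exact inv_eq_iff_eq_inv.1 this.symm

/-- Two representatives of the same hyperfunction differ by a function that is holomorphic near the
real projective line. -/
theorem exists_of_mk_eq {H K : hyperReps}
    (h : (Submodule.Quotient.mk H : Hyperfunction) = Submodule.Quotient.mk K) :
    ∃ c : ℝ, 0 < c ∧ c < 1 ∧ ∃ G : ℂ → ℂ, DifferentiableOn ℂ G {w | c < ‖w‖ ∧ ‖w‖ < c⁻¹} ∧
      (∀ (w : ℂ) (hw : ‖w‖ < 1), c < ‖w‖ →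
        (H : ℂ → ℂ) (upperPt w hw) - (K : ℂ → ℂ) (upperPt w hw) = G w) ∧
      ∀ (u : ℂ) (hu : ‖u‖ < 1), c < ‖u‖ →
        (H : ℂ → ℂ) (lowerPt u hu) - (K : ℂ → ℂ) (lowerPt u hu) = G u⁻¹ := by
  rw [Submodule.Quotient.eq] at h
  have h' : ((H - K : hyperReps) : ℂ → ℂ) ∈ hyperNull := h
  obtain ⟨c, hc0, hc1, G, hG, hGe⟩ := h'
  have hcc : 1 < c⁻¹ := one_lt_inv₀ hc0 |>.2 hc1
  refine ⟨c, hc0, hc1, G, hG, fun w hw hcw => ?_, fun u hu hcu => ?_⟩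
  · have := hGe (upperPt w hw) ⟨(upperPt w hw).im_pos.ne', by
      rw [cay_upperPt]
      exact ⟨hcw, hw.trans hcc⟩⟩
    rw [cay_upperPt] at this
    exact this
  · have := hGe (lowerPt u hu) ⟨(lowerPt u hu).2.ne, by
      rw [cay_lowerPt, norm_inv]
      exact ⟨hc1.trans (one_lt_inv₀ (hc0.trans hcu) |>.2 hu), inv_strictAnti₀ hc0 hcu⟩⟩
    rw [cay_lowerPt] at this
    exact this

/-- The difference of two representatives is given near the real projective line by a holomorphic
function on an annulus that vanishes on the outer half of it, hence everywhere. -/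
theorem RepPlus.unique {W W' : Submodule ℂ (ℍ → ℂ)} (hW : W ≤ holUpper) (hW' : W' ≤ holUpper)
    {α : Hyperfunction} {h h' : ℍ → ℂ} (H : RepPlus W α h) (H' : RepPlus W' α h') : h = h' := by
  obtain ⟨hh, K, hK, hK1, hK2⟩ := H
  obtain ⟨hh', K', hK', hK1', hK2'⟩ := H'
  obtain ⟨c, hc0, hc1, G, hG, hG1, hG2⟩ := exists_of_mk_eq (hK.trans hK'.symm)
  have hcc : 1 < c⁻¹ := one_lt_inv₀ hc0 |>.2 hc1
  have hG0 := eq_zero_of_eq_zero_on_annulus (isOpen_annulus c c⁻¹)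
    (isPreconnected_annulus c c⁻¹ hc0.le) hG zero_le_one hcc
    (fun w hw => ⟨hc1.trans hw.1, hw.2⟩) (fun w h1 h2 => by
      have hu : ‖w⁻¹‖ < 1 := by
        rw [norm_inv]
        exact inv_lt_one_of_one_lt₀ h1
      have := hG2 w⁻¹ hu (by
        rw [norm_inv]
        exact (lt_inv_comm₀ (one_pos.trans h1) hc0).1 h2)
      rw [hK2, hK2', sub_zero, inv_inv] at this
      exact this.symm)
  refine eq_of_diskUpper_eq (hW hh) (hW' hh') hc0 hc1 fun w hw hcw => ?_
  have := hG1 w hw hcw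
  rw [hG0 w ⟨hcw, hw.trans hcc⟩, hK1, hK1'] at this
  exact sub_eq_zero.1 this

theorem RepMinus.unique {W W' : Submodule ℂ (LHP → ℂ)} (hW : W ≤ analyticLower)
    (hW' : W' ≤ analyticLower) {β : Hyperfunction} {f f' : LHP → ℂ} (H : RepMinus W β f)
    (H' : RepMinus W' β f') : f = f' := by
  obtain ⟨hf, K, hK, hK1, hK2⟩ := H
  obtain ⟨hf', K', hK', hK1', hK2'⟩ := H'
  obtain ⟨c, hc0, hc1, G, hG, hG1, hG2⟩ := exists_of_mk_eq (hK.trans hK'.symm)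
  have hcc : 1 < c⁻¹ := one_lt_inv₀ hc0 |>.2 hc1
  have hG0 := eq_zero_of_eq_zero_on_annulus (isOpen_annulus c c⁻¹)
    (isPreconnected_annulus c c⁻¹ hc0.le) hG hc0.le hc1
    (fun w hw => ⟨hw.1, hw.2.trans hcc⟩) (fun w h1 h2 => by
      have := hG1 w h2 h1
      rw [hK1, hK1', sub_zero] at this
      exact this.symm)
  refine eq_of_diskLower_eq (hW hf) (hW' hf') hc0 hc1 fun u hu hcu => ?_
  have := hG2 u hu hcu
  rw [hG0 u⁻¹ (by
    simp only [Set.mem_ofPred_eq, norm_inv]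
    exact ⟨hc1.trans (one_lt_inv₀ (hc0.trans hcu) |>.2 hu), inv_strictAnti₀ hc0 hcu⟩),
    hK2, hK2'] at this
  exact sub_eq_zero.1 this

/-- A hyperfunction is determined by the values of a representative off the real line. -/
theorem mk_eq_mk_of_eq {H K : hyperReps} (h1 : ∀ z : ℍ, (H : ℂ → ℂ) z = (K : ℂ → ℂ) z)
    (h2 : ∀ t : LHP, (H : ℂ → ℂ) t = (K : ℂ → ℂ) t) :
    (Submodule.Quotient.mk H : Hyperfunction) = Submodule.Quotient.mk K := by
  rw [Submodule.Quotient.eq]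
  refine ⟨1 / 2, by norm_num, by norm_num, 0, differentiableOn_const _, fun z hz => ?_⟩
  rcases lt_or_gt_of_ne hz.1 with h | h
  · have := h2 ⟨z, h⟩
    simpa [sub_eq_zero] using this
  · have := h1 ⟨z, h⟩
    simpa [sub_eq_zero] using this

theorem exists_repPlus {W : Submodule ℂ (ℍ → ℂ)} (hW : W ≤ holUpper) {h : ℍ → ℂ} (hh : h ∈ W) :
    ∃ α : plusHyper W, RepPlus W α h := by
  classical
  have hd : DifferentiableOn ℂ (h ∘ ofComplex) {z | 0 < z.im} := hW hh
  have hH : (fun z : ℂ => if 0 < z.im then h (ofComplex z) else 0) ∈ hyperReps := by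
    refine ⟨1 / 2, by norm_num, by norm_num, fun z hz => DifferentiableAt.differentiableWithinAt ?_⟩
    rcases lt_or_gt_of_ne hz.1 with h0 | h0
    · refine (differentiableAt_const (0 : ℂ)).congr_of_eventuallyEq ?_
      filter_upwards [(isOpen_lt Complex.continuous_im continuous_const).mem_nhds h0] with y hy
      exact if_neg (not_lt.2 (le_of_lt hy))
    · have ho : {z : ℂ | 0 < z.im} ∈ 𝓝 z := (isOpen_lt continuous_const Complex.continuous_im).mem_nhds h0
      refine (hd.differentiableAt ho).congr_of_eventuallyEq ?_
      filter_upwards [ho] with y hy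
      exact if_pos hy
  have hrep : RepPlus W (Submodule.Quotient.mk (⟨_, hH⟩ : hyperReps)) h := by
    refine ⟨hh, ⟨_, hH⟩, rfl, fun z => ?_, fun t => ?_⟩
    · simp only [z.im_pos, UpperHalfPlane.coe_im, if_true, ofComplex_apply]
    · exact if_neg (not_lt.2 t.2.le)
  exact ⟨⟨_, h, hrep⟩, hrep⟩

theorem exists_repMinus {W : Submodule ℂ (LHP → ℂ)} (hW : W ≤ analyticLower) {f : LHP → ℂ}
    (hf : f ∈ W) : ∃ β : minusHyper W, RepMinus W β f := by
  classical
  obtain ⟨R, Φ, hΦ⟩ := hW hf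
  have hH : (fun z : ℂ => if z.im < 0 then Φ (cayInv z) else 0) ∈ hyperReps := by
    refine ⟨1 / 2, by norm_num, by norm_num, fun z hz => DifferentiableAt.differentiableWithinAt ?_⟩
    rcases lt_or_gt_of_ne hz.1 with h0 | h0
    · have ho : {z : ℂ | z.im < 0} ∈ 𝓝 z := (isOpen_lt Complex.continuous_im continuous_const).mem_nhds h0
      have hne := LHP.sub_I_ne_zero ⟨z, h0⟩
      have hc : DifferentiableAt ℂ cayInv z := by
        unfold cayInv
        fun_prop (disch := exact hne)
      have hball : cayInv z ∈ Metric.ball (0 : ℂ) R := by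
        simpa using (norm_cayInv_lt_one ⟨z, h0⟩).trans hΦ.one_lt
      refine ((hΦ.diff.differentiableAt (Metric.isOpen_ball.mem_nhds hball)).comp z
        hc).congr_of_eventuallyEq ?_
      filter_upwards [ho] with y hy
      exact if_pos hy
    · refine (differentiableAt_const (0 : ℂ)).congr_of_eventuallyEq ?_
      filter_upwards [(isOpen_lt continuous_const Complex.continuous_im).mem_nhds h0] with y hy
      exact if_neg (not_lt.2 (le_of_lt hy))
  have hrep : RepMinus W (Submodule.Quotient.mk (⟨_, hH⟩ : hyperReps)) f := by
    refine ⟨hf, ⟨_, hH⟩, rfl, fun z => ?_, fun t => ?_⟩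
    · exact if_neg (not_lt.2 z.im_pos.le)
    · exact (if_pos t.2).trans (hΦ.eq t).symm
  exact ⟨⟨_, f, hrep⟩, hrep⟩

theorem RepPlus.add {W : Submodule ℂ (ℍ → ℂ)} {α β : Hyperfunction} {h k : ℍ → ℂ}
    (H : RepPlus W α h) (K : RepPlus W β k) : RepPlus W (α + β) (h + k) := by
  obtain ⟨hh, H, rfl, h1, h2⟩ := H
  obtain ⟨hk, K, rfl, k1, k2⟩ := K
  exact ⟨W.add_mem hh hk, H + K, rfl, fun z => by simp [h1, k1], fun t => by simp [h2, k2]⟩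

theorem RepPlus.smul {W : Submodule ℂ (ℍ → ℂ)} {α : Hyperfunction} {h : ℍ → ℂ}
    (H : RepPlus W α h) (x : ℂ) : RepPlus W (x • α) (x • h) := by
  obtain ⟨hh, H, rfl, h1, h2⟩ := H
  exact ⟨W.smul_mem x hh, x • H, rfl, fun z => by simp [h1], fun t => by simp [h2]⟩

theorem RepMinus.add {W : Submodule ℂ (LHP → ℂ)} {α β : Hyperfunction} {f k : LHP → ℂ}
    (H : RepMinus W α f) (K : RepMinus W β k) : RepMinus W (α + β) (f + k) := by
  obtain ⟨hh, H, rfl, h1, h2⟩ := H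
  obtain ⟨hk, K, rfl, k1, k2⟩ := K
  exact ⟨W.add_mem hh hk, H + K, rfl, fun z => by simp [h1, k1], fun t => by simp [h2, k2]⟩

theorem RepMinus.smul {W : Submodule ℂ (LHP → ℂ)} {α : Hyperfunction} {f : LHP → ℂ}
    (H : RepMinus W α f) (x : ℂ) : RepMinus W (x • α) (x • f) := by
  obtain ⟨hh, H, rfl, h1, h2⟩ := H
  exact ⟨W.smul_mem x hh, x • H, rfl, fun z => by simp [h1], fun t => by simp [h2]⟩

/-- The unique representative, on the upper half-plane, of a hyperfunction in `plusHyper W`. -/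
def plusRepr {W : Submodule ℂ (ℍ → ℂ)} (hW : W ≤ holUpper) : plusHyper W →ₗ[ℂ] W where
  toFun α := ⟨Classical.choose α.2, (Classical.choose_spec α.2).1⟩
  map_add' α β := Subtype.ext <| RepPlus.unique hW hW (Classical.choose_spec (α + β).2)
    ((Classical.choose_spec α.2).add (Classical.choose_spec β.2))
  map_smul' x α := Subtype.ext <| RepPlus.unique hW hW (Classical.choose_spec (x • α).2)
    ((Classical.choose_spec α.2).smul x)

/-- The unique representative, on the lower half-plane, of a hyperfunction in `minusHyper W`. -/
def minusRepr {W : Submodule ℂ (LHP → ℂ)} (hW : W ≤ analyticLower) : minusHyper W →ₗ[ℂ] W where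
  toFun α := ⟨Classical.choose α.2, (Classical.choose_spec α.2).1⟩
  map_add' α β := Subtype.ext <| RepMinus.unique hW hW (Classical.choose_spec (α + β).2)
    ((Classical.choose_spec α.2).add (Classical.choose_spec β.2))
  map_smul' x α := Subtype.ext <| RepMinus.unique hW hW (Classical.choose_spec (x • α).2)
    ((Classical.choose_spec α.2).smul x)

theorem repPlus_plusRepr {W : Submodule ℂ (ℍ → ℂ)} (hW : W ≤ holUpper) (α : plusHyper W) :
    RepPlus W α (plusRepr hW α) := Classical.choose_spec α.2

theorem repMinus_minusRepr {W : Submodule ℂ (LHP → ℂ)} (hW : W ≤ analyticLower)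
    (β : minusHyper W) : RepMinus W β (minusRepr hW β) := Classical.choose_spec β.2

theorem RepPlus.plusRepr_eq {W W' : Submodule ℂ (ℍ → ℂ)} (hW : W ≤ holUpper) (hW' : W' ≤ holUpper)
    {α : plusHyper W} {h : ℍ → ℂ} (H : RepPlus W' α h) : (plusRepr hW α : ℍ → ℂ) = h :=
  (repPlus_plusRepr hW α).unique hW hW' H

theorem RepMinus.minusRepr_eq {W W' : Submodule ℂ (LHP → ℂ)} (hW : W ≤ analyticLower)
    (hW' : W' ≤ analyticLower) {β : minusHyper W} {f : LHP → ℂ} (H : RepMinus W' β f) :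
    (minusRepr hW β : LHP → ℂ) = f :=
  (repMinus_minusRepr hW β).unique hW hW' H

theorem plusRepr_bijective {W : Submodule ℂ (ℍ → ℂ)} (hW : W ≤ holUpper) :
    Function.Bijective (plusRepr hW) := by
  constructor
  · intro α β h
    obtain ⟨-, H, hH, h1, h2⟩ := repPlus_plusRepr hW α
    obtain ⟨-, K, hK, k1, k2⟩ := repPlus_plusRepr hW β
    refine Subtype.ext ?_
    rw [← hH, ← hK]
    exact mk_eq_mk_of_eq (fun z => by rw [h1, k1, h]) fun t => by rw [h2, k2]
  · intro h
    obtain ⟨α, hα⟩ := exists_repPlus hW h.2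
    exact ⟨α, Subtype.ext (hα.plusRepr_eq hW hW)⟩

theorem minusRepr_bijective {W : Submodule ℂ (LHP → ℂ)} (hW : W ≤ analyticLower) :
    Function.Bijective (minusRepr hW) := by
  constructor
  · intro α β h
    obtain ⟨-, H, hH, h1, h2⟩ := repMinus_minusRepr hW α
    obtain ⟨-, K, hK, k1, k2⟩ := repMinus_minusRepr hW β
    refine Subtype.ext ?_
    rw [← hH, ← hK]
    exact mk_eq_mk_of_eq (fun z => by rw [h1, k1]) fun t => by rw [h2, k2, h]
  · intro f
    obtain ⟨β, hβ⟩ := exists_repMinus hW f.2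
    exact ⟨β, Subtype.ext (hβ.minusRepr_eq hW hW)⟩

theorem nondegenerate_compl₁₂ {M N M' N' : Type*} [AddCommGroup M] [Module ℂ M] [AddCommGroup N]
    [Module ℂ N] [AddCommGroup M'] [Module ℂ M'] [AddCommGroup N'] [Module ℂ N']
    {B : M →ₗ[ℂ] N →ₗ[ℂ] ℂ} (hB : B.Nondegenerate) {φ : M' →ₗ[ℂ] M} {ψ : N' →ₗ[ℂ] N}
    (hφ : Function.Bijective φ) (hψ : Function.Bijective ψ) : (B.compl₁₂ φ ψ).Nondegenerate := by
  constructor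
  · intro x hx
    refine hφ.1 ((hB.1 _ fun y => ?_).trans (map_zero φ).symm)
    obtain ⟨y, rfl⟩ := hψ.2 y
    exact hx y
  · intro y hy
    refine hψ.1 ((hB.2 _ fun x => ?_).trans (map_zero ψ).symm)
    obtain ⟨x, rfl⟩ := hφ.2 x
    exact hy x

/-! ### The normalization maps -/

theorem plusMap_mem_holUpper_iff {r : ℝ} {h : ℍ → ℂ} : plusMap r h ∈ holUpper ↔ h ∈ holUpper := by
  have key : ∀ (s : ℝ) (k : ℍ → ℂ), k ∈ holUpper → plusMap s k ∈ holUpper := fun s k hk => by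
    have hk' : DifferentiableOn ℂ (k ∘ ofComplex) {z | 0 < z.im} := hk
    refine mem_holUpper_of_differentiableOn
      (H := fun z => (-I - z) ^ (s : ℂ) * (k ∘ ofComplex) z) ?_ fun z => by
        simp [plusMap, ofComplex_apply]
    refine DifferentiableOn.mul ?_ hk'
    exact DifferentiableOn.cpow (by fun_prop) (by fun_prop)
      fun z hz => .inr (neg_I_sub_im_neg hz).ne
  refine ⟨fun H => ?_, key r h⟩
  convert key (-r) _ H using 1
  funext z
  have := cpow_neg_mul_cpow (neg_I_sub_ne_zero z.im_pos) (r : ℂ)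
  simp only [plusMap, LinearMap.coe_mk, AddHom.coe_mk, ofReal_neg]
  rw [← mul_assoc, this, one_mul]

theorem plusMap_injective (r : ℝ) : Function.Injective (plusMap r) := by
  intro h k e
  funext z
  have h0 : (-I - (z : ℂ)) ^ (r : ℂ) ≠ 0 := fun h0 =>
    neg_I_sub_ne_zero z.im_pos ((cpow_eq_zero_iff _ _).1 h0).1
  exact mul_left_cancel₀ h0 (congrFun e z)

theorem plusMap_surjective (r : ℝ) : Function.Surjective (plusMap r) := by
  intro h
  refine ⟨plusMap (-r) h, ?_⟩
  funext z
  have := cpow_neg_mul_cpow (neg_I_sub_ne_zero z.im_pos) (r : ℂ)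
  simp only [plusMap, LinearMap.coe_mk, AddHom.coe_mk, ofReal_neg]
  rw [← mul_assoc, mul_comm (_ ^ (r : ℂ)), this, one_mul]

theorem I_sub_ne_zero (t : LHP) : I - (t : ℂ) ≠ 0 := fun h =>
  t.sub_I_ne_zero (by rw [← neg_sub, h, neg_zero])

theorem minusMap_injective (r : ℝ) : Function.Injective (minusMap r) := by
  intro h k e
  funext t
  have h0 : (I - (t : ℂ)) ^ (r : ℂ) ≠ 0 := fun h0 =>
    I_sub_ne_zero t ((cpow_eq_zero_iff _ _).1 h0).1
  exact mul_left_cancel₀ h0 (congrFun e t)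

theorem minusMap_surjective (r : ℝ) : Function.Surjective (minusMap r) := by
  intro h
  refine ⟨minusMap (-r) h, ?_⟩
  funext t
  have := cpow_neg_mul_cpow (I_sub_ne_zero t) (r : ℂ)
  simp only [minusMap, LinearMap.coe_mk, AddHom.coe_mk, ofReal_neg]
  rw [← mul_assoc, mul_comm (_ ^ (r : ℂ)), this, one_mul]

theorem restrict_bijective {V : Type*} {V' : Type*} [AddCommGroup V] [Module ℂ V]
    [AddCommGroup V'] [Module ℂ V'] {φ : V →ₗ[ℂ] V'} (hφ : Function.Bijective φ)
    {W : Submodule ℂ V} {W' : Submodule ℂ V'} (h : ∀ x, φ x ∈ W' ↔ x ∈ W) :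
    Function.Bijective (φ.restrict fun x hx => (h x).2 hx : W →ₗ[ℂ] W') := by
  constructor
  · intro x y e
    exact Subtype.ext (hφ.1 (congrArg Subtype.val e))
  · rintro ⟨y, hy⟩
    obtain ⟨x, rfl⟩ := hφ.2 y
    exact ⟨⟨x, (h x).1 hy⟩, rfl⟩

/-! ### Fourier coefficients of smooth boundary values -/

/-- The Fourier coefficient `(1/π) ∫ F(θ) exp (2 i n θ) dθ` over a period of the `π`-periodic
function `F`; with `w = exp (2 i θ)` it is the coefficient of `w ^ (-n)`. -/
def fourierInt (F : ℝ → ℂ) (n : ℕ) : ℂ :=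
  (Real.pi : ℂ)⁻¹ * ∫ θ in (-Real.pi)..0, F θ * exp (2 * I * n * θ)

theorem continuous_mul_exp {F : ℝ → ℂ} (hF : Continuous F) (n : ℕ) :
    Continuous fun θ : ℝ => F θ * exp (2 * I * n * θ) := by
  fun_prop

theorem norm_exp_two_mul_I (n : ℕ) (θ : ℝ) : ‖exp (2 * I * n * θ)‖ = 1 := by
  rw [Complex.norm_exp]
  simp

theorem norm_fourierInt_sub_le {F G : ℝ → ℂ} (hF : Continuous F) (hG : Continuous G) {M : ℝ}
    (hM : ∀ θ, ‖F θ - G θ‖ ≤ M) (n : ℕ) : ‖fourierInt F n - fourierInt G n‖ ≤ M := by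
  rw [fourierInt, fourierInt, ← mul_sub, ← intervalIntegral.integral_sub
    ((continuous_mul_exp hF n).intervalIntegrable _ _)
    ((continuous_mul_exp hG n).intervalIntegrable _ _)]
  have h := intervalIntegral.norm_integral_le_of_norm_le_const (a := -Real.pi) (b := 0) (C := M)
    (f := fun θ : ℝ => F θ * exp (2 * I * n * θ) - G θ * exp (2 * I * n * θ)) (fun θ _ => by
      rw [← sub_mul, norm_mul, norm_exp_two_mul_I, mul_one]
      exact hM θ)
  rw [norm_mul, norm_inv, Complex.norm_real, Real.norm_of_nonneg Real.pi_pos.le]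
  rw [sub_neg_eq_add, zero_add, abs_of_pos Real.pi_pos] at h
  rw [inv_mul_le_iff₀ Real.pi_pos]
  exact h.trans_eq (mul_comm _ _)

/-- Integration by parts. -/
theorem fourierInt_deriv {F : ℝ → ℂ} (hF : ContDiff ℝ ∞ F) (hp : Function.Periodic F Real.pi) (n : ℕ) :
    fourierInt (deriv F) n = -(2 * I * n) * fourierInt F n := by
  have hd (x : ℝ) : HasDerivAt F (deriv F x) x :=
    ((hF.differentiable (by simp)) x).hasDerivAt
  have he (x : ℝ) : HasDerivAt (fun θ : ℝ => exp (2 * I * n * θ))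
      (2 * I * n * exp (2 * I * n * x)) x := by
    have h1 : HasDerivAt (fun z : ℂ => exp (2 * I * n * z)) (exp (2 * I * n * x) * (2 * I * n * 1)) x :=
      ((hasDerivAt_id (x : ℂ)).const_mul (2 * I * n)).cexp
    convert! h1.comp_ofReal using 1
    ring
  have hc : Continuous (deriv F) := hF.continuous_deriv (by simp)
  have h := intervalIntegral.integral_mul_deriv_eq_deriv_mul (a := -Real.pi) (b := 0)
    (fun x _ => he x) (fun x _ => hd x)
    (Continuous.intervalIntegrable (by fun_prop) _ _) (hc.intervalIntegrable _ _)
  have e0 : exp (2 * I * n * ((-Real.pi : ℝ) : ℂ)) = 1 := by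
    rw [Complex.exp_eq_one_iff]
    exact ⟨-n, by push_cast; ring⟩
  have hF0 : F (-Real.pi) = F 0 := by
    rw [← hp (-Real.pi), neg_add_cancel]
  rw [e0, hF0] at h
  simp only [ofReal_zero, mul_zero, Complex.exp_zero, one_mul, sub_self, zero_sub] at h
  have e1 : ∫ θ in (-Real.pi)..0, deriv F θ * exp (2 * I * n * θ) =
      -(2 * I * n * ∫ θ in (-Real.pi)..0, F θ * exp (2 * I * n * θ)) := by
    rw [← intervalIntegral.integral_const_mul]
    convert! h using 1
    · exact intervalIntegral.integral_congr fun θ _ => mul_comm _ _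
    · congr 1
      exact intervalIntegral.integral_congr fun θ _ => by ring
  rw [fourierInt, fourierInt, e1]
  ring

theorem contDiff_iteratedDeriv {F : ℝ → ℂ} (hF : ContDiff ℝ ∞ F) (k : ℕ) :
    ContDiff ℝ ∞ (iteratedDeriv k F) := by
  rw [iteratedDeriv_eq_iterate]
  exact hF.iterate_deriv k

theorem periodic_iteratedDeriv {F : ℝ → ℂ} {c : ℝ} (hp : Function.Periodic F c) (k : ℕ) :
    Function.Periodic (iteratedDeriv k F) c := by
  intro x
  have h := iteratedDeriv_comp_add_const k F c
  rw [show (fun z => F (z + c)) = F from funext hp] at h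
  exact (congrFun h x).symm

theorem fourierInt_iteratedDeriv {F : ℝ → ℂ} (hF : ContDiff ℝ ∞ F)
    (hp : Function.Periodic F Real.pi) (n k : ℕ) :
    fourierInt (iteratedDeriv k F) n = (-(2 * I * n)) ^ k * fourierInt F n := by
  induction k with
  | zero => simp
  | succ k ih =>
    rw [iteratedDeriv_succ, fourierInt_deriv (contDiff_iteratedDeriv hF k)
      (periodic_iteratedDeriv hp k), ih, pow_succ]
    ring

/-- The Fourier coefficients of smooth functions decay rapidly, uniformly in terms of the supremum
norms of the derivatives. -/
theorem norm_fourierInt_sub_mul_le {F G : ℝ → ℂ} (hF : ContDiff ℝ ∞ F)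
    (hp : Function.Periodic F Real.pi) (hG : ContDiff ℝ ∞ G) (hq : Function.Periodic G Real.pi)
    {k : ℕ} {M : ℝ} (h0 : ∀ θ, ‖F θ - G θ‖ ≤ M)
    (hk : ∀ θ, ‖iteratedDeriv k F θ - iteratedDeriv k G θ‖ ≤ M) (n : ℕ) :
    ‖fourierInt F n - fourierInt G n‖ * ((n : ℝ) + 1) ^ k ≤ M := by
  rcases Nat.eq_zero_or_pos n with rfl | hn
  · simpa using norm_fourierInt_sub_le hF.continuous hG.continuous h0 0
  · have h1 := norm_fourierInt_sub_le (contDiff_iteratedDeriv hF k).continuous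
      (contDiff_iteratedDeriv hG k).continuous hk n
    rw [fourierInt_iteratedDeriv hF hp, fourierInt_iteratedDeriv hG hq, ← mul_sub, norm_mul,
      norm_pow, norm_neg] at h1
    have h2 : ‖2 * I * (n : ℂ)‖ = 2 * n := by simp
    rw [h2] at h1
    have hn' : (1 : ℝ) ≤ n := by exact_mod_cast hn
    refine le_trans ?_ h1
    rw [mul_comm]
    gcongr
    linarith

theorem exp_neg_two_mul_I_mem (θ : ℝ) : exp (-2 * I * (θ : ℂ)) ∈ Metric.sphere (0 : ℂ) 1 := by
  rw [mem_sphere_zero_iff_norm, Complex.norm_exp]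
  simp

/-- Cauchy's formula on the unit circle. -/
theorem HasExpansion.eq_fourierInt {Φ : ℂ → ℂ} (hd : DifferentiableOn ℂ Φ (Metric.ball 0 1))
    (hc : ContinuousOn Φ (Metric.closedBall 0 1)) {d : ℕ → ℂ} (h : HasExpansion 1 d Φ) (n : ℕ) :
    d n = fourierInt (fun θ => Φ (exp (-2 * I * (θ : ℂ)))) n := by
  have hdc : DiffContOnCl ℂ Φ (Metric.ball 0 ((1 : NNReal) : ℝ)) :=
    ⟨hd, by rwa [NNReal.coe_one, closure_ball _ one_ne_zero]⟩
  have hp := hdc.hasFPowerSeriesOnBall one_pos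
  set b : ℕ → ℂ := fun m => (2 * (Real.pi : ℂ) * I)⁻¹ * ∮ z in C(0, 1), (z ^ (m + 1))⁻¹ * Φ z
  have hb : HasExpansion 1 b Φ := by
    intro w hw
    have h1 := hp.hasSum (y := w) (by simpa [enorm_eq_nnnorm, ← NNReal.coe_lt_one] using hw)
    rw [zero_add] at h1
    convert! h1 using 2 with m
    rw [cauchyPowerSeries_apply]
    simp only [b, smul_eq_mul, sub_zero, NNReal.coe_one]
    rw [mul_assoc]
    congr 1
    rw [mul_comm, ← circleIntegral.integral_const_mul]
    refine congrArg (fun f : ℂ → ℂ => circleIntegral f 0 1) (funext fun z => ?_)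
    rw [div_pow, pow_succ, mul_inv]
    ring
  have hdb : d n = b n := congrFun (h.unique one_pos hb) n
  rw [hdb]
  simp only [b]
  rw [circleIntegral, fourierInt]
  have h2 := intervalIntegral.integral_comp_mul_left (a := -Real.pi) (b := 0) (c := -2)
    (fun φ : ℝ => deriv (circleMap 0 1) φ • ((circleMap 0 1 φ ^ (n + 1))⁻¹ * Φ (circleMap 0 1 φ)))
    (by norm_num)
  rw [show (-2 : ℝ) * -Real.pi = 2 * Real.pi by ring, mul_zero,
    intervalIntegral.integral_symm 0 (2 * Real.pi)] at h2
  have h3 : ∀ θ : ℝ, circleMap 0 1 (-2 * θ) = exp (-2 * I * (θ : ℂ)) := fun θ => by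
    rw [circleMap_zero, ofReal_one, one_mul]
    congr 1
    push_cast
    ring
  have h4 : ∀ θ : ℝ, deriv (circleMap 0 1) (-2 * θ) • ((circleMap 0 1 (-2 * θ) ^ (n + 1))⁻¹ *
      Φ (circleMap 0 1 (-2 * θ))) = I * (Φ (exp (-2 * I * (θ : ℂ))) * exp (2 * I * n * θ)) := fun θ => by
    rw [deriv_circleMap, h3, smul_eq_mul, pow_succ, mul_inv, ← Complex.exp_nat_mul, ← Complex.exp_neg,
      show -((n : ℂ) * (-2 * I * θ)) = 2 * I * n * θ by ring]
    have := Complex.exp_ne_zero (-2 * I * (θ : ℂ))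
    field_simp
  simp only [h4] at h2
  rw [intervalIntegral.integral_const_mul, real_smul] at h2
  push_cast at h2
  have hpi : (Real.pi : ℂ) ≠ 0 := ofReal_ne_zero.2 Real.pi_ne_zero
  set J := ∫ θ in (-Real.pi)..0, Φ (exp (-2 * I * (θ : ℂ))) * exp (2 * I * n * θ)
  have h5 : (∫ φ in (0 : ℝ)..2 * Real.pi, deriv (circleMap 0 1) φ •
      ((circleMap 0 1 φ ^ (n + 1))⁻¹ * Φ (circleMap 0 1 φ))) = 2 * (I * J) := by
    linear_combination (-2 : ℂ) * h2
  rw [h5]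
  field_simp

/-! ### Functions of polynomial growth -/

theorem im_icay (w : ℂ) : (icay w).im = (1 - ‖w‖ ^ 2) / ‖1 - w‖ ^ 2 := by
  rw [icay, Complex.div_im, ← normSq_eq_norm_sq, ← normSq_eq_norm_sq, normSq_apply w]
  simp
  ring

theorem le_im_icay {w : ℂ} (hw : ‖w‖ < 1) : (1 - ‖w‖) / 4 ≤ (icay w).im := by
  rw [im_icay]
  have h0 : 0 < ‖1 - w‖ := norm_pos_iff.2 (one_sub_ne_zero_of_norm_lt hw)
  have h1 : ‖1 - w‖ ≤ 2 := (norm_sub_le _ _).trans (by rw [norm_one]; linarith)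
  have h2 := norm_nonneg w
  rw [div_le_div_iff₀ (by norm_num) (by positivity)]
  have h3 : ‖1 - w‖ ^ 2 ≤ 4 * (1 + ‖w‖) := by nlinarith
  calc (1 - ‖w‖) * ‖1 - w‖ ^ 2 ≤ (1 - ‖w‖) * (4 * (1 + ‖w‖)) :=
        mul_le_mul_of_nonneg_left h3 (by linarith)
    _ = (1 - ‖w‖ ^ 2) * 4 := by ring

theorem norm_icay_le {w : ℂ} (hw : ‖w‖ < 1) : ‖icay w‖ ≤ 2 / (1 - ‖w‖) := by
  rw [icay, norm_div, norm_mul, Complex.norm_I, one_mul]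
  have h1 : 1 - ‖w‖ ≤ ‖1 - w‖ := by simpa using norm_sub_norm_le (1 : ℂ) w
  have h2 : ‖1 + w‖ ≤ 2 := (norm_add_le _ _).trans (by rw [norm_one]; linarith)
  have h3 : 0 < 1 - ‖w‖ := by linarith
  gcongr

/-- Functions of polynomial growth are bounded by a power of the distance to the boundary of the unit
disk. -/
theorem HasPolyGrowth.disk_bound {h : ℍ → ℂ} (hg : HasPolyGrowth h) :
    ∃ C : ℝ, 0 ≤ C ∧ ∃ K : ℕ, ∀ w : ℂ, ‖w‖ < 1 → ‖diskUpper h w‖ ≤ C * (4 / (1 - ‖w‖)) ^ K := by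
  obtain ⟨B, hB, C, hC⟩ := hg
  obtain ⟨K, hK⟩ := exists_nat_ge B
  refine ⟨2 * |C|, by positivity, K, fun w hw => ?_⟩
  rw [diskUpper_apply h hw]
  have h0 : 0 < 1 - ‖w‖ := by linarith
  have h1 : 1 ≤ 4 / (1 - ‖w‖) := by
    rw [one_le_div h0]
    linarith [norm_nonneg w]
  have h2 : (4 / (1 - ‖w‖)) ^ B ≤ (4 / (1 - ‖w‖)) ^ K := by
    rw [← Real.rpow_natCast]
    exact Real.rpow_le_rpow_of_exponent_le h1 hK
  have h3 : (upperPt w hw).im ^ (-B) ≤ (4 / (1 - ‖w‖)) ^ B := by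
    rw [← inv_div, Real.inv_rpow (by positivity), ← Real.rpow_neg (by positivity)]
    exact Real.rpow_le_rpow_of_nonpos (by positivity) (le_im_icay hw) (by linarith)
  have h4 : ‖(upperPt w hw : ℂ)‖ ^ B ≤ (4 / (1 - ‖w‖)) ^ B := by
    refine Real.rpow_le_rpow (norm_nonneg _) ((norm_icay_le hw).trans ?_) hB.le
    gcongr
    norm_num
  have h5 : 0 ≤ (upperPt w hw).im ^ (-B) + ‖(upperPt w hw : ℂ)‖ ^ B :=
    add_nonneg (Real.rpow_nonneg (upperPt w hw).im_pos.le _) (Real.rpow_nonneg (norm_nonneg _) _)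
  calc ‖h (upperPt w hw)‖ ≤ C * _ := hC _
    _ ≤ |C| * _ := mul_le_mul_of_nonneg_right (le_abs_self C) h5
    _ ≤ |C| * ((4 / (1 - ‖w‖)) ^ K + (4 / (1 - ‖w‖)) ^ K) := by
      gcongr
      · exact h3.trans h2
      · exact h4.trans h2
    _ = _ := by ring

/-- Functions of polynomial growth have coefficients of polynomial growth. -/
theorem HasPolyGrowth.coeff_bound {h : ℍ → ℂ} (hh : h ∈ holUpper) (hg : HasPolyGrowth h) {c : ℕ → ℂ}
    (hc : ExpansionUpper h c) : ∃ C : ℝ, 0 ≤ C ∧ ∃ K : ℕ, ∀ n : ℕ, ‖c n‖ ≤ C * ((n : ℝ) + 1) ^ K := by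
  obtain ⟨C, hC, K, hK⟩ := hg.disk_bound
  refine ⟨C * 8 ^ K * Real.exp 1, by positivity, K, fun n => ?_⟩
  have hn : (0 : ℝ) ≤ n := n.cast_nonneg
  -- The radius `(n + 1) / (n + 2)` has distance `1 / (n + 2)` to the boundary, and its power `-n`
  -- is bounded.
  set R : ℝ := ((n : ℝ) + 1) / (n + 2)
  have hR0 : 0 < R := by positivity
  have hR1 : R < 1 := by
    rw [div_lt_one (by positivity)]
    linarith
  have hR : 1 - R = 1 / (n + 2) := by
    simp only [R]
    field_simp
    ring
  have hdiff := mem_holUpper_iff_diskUpper.1 hh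
  have h1 := Complex.norm_iteratedDeriv_le_of_forall_mem_sphere_norm_le (c := 0) (R := R)
    (C := C * (4 * (n + 2)) ^ K) (f := diskUpper h) n hR0
    ((hdiff.mono (Metric.closedBall_subset_ball hR1)).diffContOnCl_ball subset_rfl) (fun z hz => by
      rw [mem_sphere_zero_iff_norm] at hz
      have := hK z (by rw [hz]; exact hR1)
      rw [hz, hR] at this
      simpa using this)
  have hcn : c n = ((n.factorial : ℂ))⁻¹ * iteratedDeriv n (diskUpper h) 0 := by
    have hb : HasExpansion 1 (fun n => ((n.factorial : ℂ))⁻¹ * iteratedDeriv n (diskUpper h) 0)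
        (diskUpper h) := fun w hw => by
      convert! hasSum_taylorSeries_on_ball hdiff (z := w) (by simpa using hw) using 2 with m
      simp only [sub_zero, smul_eq_mul]
      ring
    exact congrFun ((expansionUpper_iff.1 hc).unique one_pos hb) n
  have hf : (0 : ℝ) < n.factorial := by exact_mod_cast n.factorial_pos
  have h2 : ‖c n‖ ≤ C * (4 * (n + 2)) ^ K / R ^ n := by
    rw [hcn, norm_mul, norm_inv, Complex.norm_natCast, inv_mul_le_iff₀ hf]
    rwa [mul_div_assoc] at h1
  have h3 : (R ^ n)⁻¹ ≤ Real.exp 1 := by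
    have e : R⁻¹ = 1 / (n + 1) + 1 := by
      simp only [R]
      field_simp
      ring
    rw [← inv_pow, e]
    calc (1 / ((n : ℝ) + 1) + 1) ^ n ≤ (Real.exp (1 / ((n : ℝ) + 1))) ^ n := by
          gcongr
          exact Real.add_one_le_exp _
      _ = Real.exp (n * (1 / ((n : ℝ) + 1))) := (Real.exp_nat_mul _ _).symm
      _ ≤ Real.exp 1 := by
          rw [Real.exp_le_exp, mul_one_div, div_le_one (by positivity)]
          linarith
  have h4 : (4 * ((n : ℝ) + 2)) ^ K ≤ 8 ^ K * ((n : ℝ) + 1) ^ K := by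
    rw [← mul_pow]
    exact pow_le_pow_left₀ (by positivity) (by linarith) K
  calc ‖c n‖ ≤ C * (4 * (n + 2)) ^ K * (R ^ n)⁻¹ := h2
    _ ≤ C * (8 ^ K * ((n : ℝ) + 1) ^ K) * Real.exp 1 := by gcongr
    _ = _ := by ring

/-! ### The extension of the pairing to smooth vectors -/

/-- The extension to the closed unit disk that is used in `boundaryFun`. -/
theorem exists_boundary_extension (r : ℝ) (f : DSmooth r) :
    ∃ Φ : ℂ → ℂ, DifferentiableOn ℂ Φ (Metric.ball 0 1) ∧ ContDiffOn ℝ ∞ Φ (Metric.closedBall 0 1) ∧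
      (∀ t : LHP, minusMap r f t = Φ (cayInv t)) ∧
      boundaryFun r f = fun θ : ℝ => Φ (exp (-2 * I * (θ : ℂ))) :=
  have h := Classical.choose_spec (show minusMap r f ∈ smoothLower from f.2)
  ⟨_, h.1, h.2.1, h.2.2, rfl⟩

theorem contDiff_boundaryFun (r : ℝ) (f : DSmooth r) : ContDiff ℝ ∞ (boundaryFun r f) := by
  obtain ⟨Φ, -, h, -, e⟩ := exists_boundary_extension r f
  rw [e]
  refine h.comp_contDiff (ContDiff.cexp (contDiff_const.mul ofRealCLM.contDiff)) fun θ => ?_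
  exact Metric.sphere_subset_closedBall (exp_neg_two_mul_I_mem θ)

theorem periodic_boundaryFun (r : ℝ) (f : DSmooth r) :
    Function.Periodic (boundaryFun r f) Real.pi := by
  intro θ
  obtain ⟨Φ, -, -, -, e⟩ := exists_boundary_extension r f
  rw [e]
  refine congrArg Φ ?_
  rw [Complex.exp_eq_exp_iff_exists_int]
  exact ⟨-1, by push_cast; ring⟩

theorem exists_expansionLower (r : ℝ) (f : DSmooth r) : ∃ d, ExpansionLower (minusMap r f) d := by
  obtain ⟨Φ, h, -, he, -⟩ := exists_boundary_extension r f
  obtain ⟨d, hd⟩ := exists_hasExpansion h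
  exact ⟨d, fun t => by rw [he t]; exact hd _ (norm_cayInv_lt_one t)⟩

theorem eq_fourierInt_boundaryFun (r : ℝ) (f : DSmooth r) {d : ℕ → ℂ}
    (hd : ExpansionLower (minusMap r f) d) (n : ℕ) : d n = fourierInt (boundaryFun r f) n := by
  obtain ⟨Φ, h, hc, he, e⟩ := exists_boundary_extension r f
  rw [e]
  refine HasExpansion.eq_fourierInt h hc.continuousOn (fun u hu => ?_) n
  have := hd (lowerPt u hu)
  rwa [he, cayInv_lowerPt] at this

theorem lowerCoef_eq_fourierInt (r : ℝ) (f : DSmooth r) (n : ℕ) :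
    lowerCoef (minusMap r f) n = fourierInt (boundaryFun r f) n := by
  obtain ⟨d, hd⟩ := exists_expansionLower r f
  rw [hd.lowerCoef_eq]
  exact eq_fourierInt_boundaryFun r f hd n

theorem exists_norm_iteratedDeriv_boundaryFun_le (r : ℝ) (f : DSmooth r) (k : ℕ) :
    ∃ M : ℝ, ∀ θ, ‖iteratedDeriv k (boundaryFun r f) θ‖ ≤ M := by
  have h := (periodic_iteratedDeriv (periodic_boundaryFun r f) k)
  obtain ⟨M, hM⟩ := (h.isBounded_of_continuous Real.pi_ne_zero
    (contDiff_iteratedDeriv (contDiff_boundaryFun r f) k).continuous).exists_norm_le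
  exact ⟨M, fun θ => hM _ ⟨θ, rfl⟩⟩

theorem norm_mul_le_of_growth {b : ℕ → ℂ} {C : ℝ} {K : ℕ} (hC : 0 ≤ C)
    (hb : ∀ n : ℕ, ‖b n‖ ≤ C * ((n : ℝ) + 1) ^ K) {x : ℂ} {M : ℝ} {n : ℕ}
    (hx : ‖x‖ * ((n : ℝ) + 1) ^ (K + 2) ≤ M) : ‖b n * x‖ ≤ C * M * (((n : ℝ) + 1) ^ 2)⁻¹ := by
  have hn : (0 : ℝ) < (n : ℝ) + 1 := by positivity
  rw [norm_mul, ← div_eq_mul_inv, le_div_iff₀ (by positivity)]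
  calc ‖b n‖ * ‖x‖ * ((n : ℝ) + 1) ^ 2 ≤ C * ((n : ℝ) + 1) ^ K * ‖x‖ * ((n : ℝ) + 1) ^ 2 := by
        gcongr
        exact hb n
    _ = C * (‖x‖ * ((n : ℝ) + 1) ^ (K + 2)) := by ring
    _ ≤ C * M := by gcongr

theorem summable_inv_succ_sq : Summable fun n : ℕ => (((n : ℝ) + 1) ^ 2)⁻¹ := by
  have := (summable_nat_add_iff 1).2 (Real.summable_nat_pow_inv.2 (one_lt_two : 1 < 2))
  simpa using this

theorem summable_mul_lowerCoef (r : ℝ) {b : ℕ → ℂ} {C : ℝ} {K : ℕ} (hC : 0 ≤ C)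
    (hb : ∀ n : ℕ, ‖b n‖ ≤ C * ((n : ℝ) + 1) ^ K) (f : DSmooth r) :
    Summable fun n => b n * lowerCoef (minusMap r f) n := by
  obtain ⟨M₀, hM₀⟩ := exists_norm_iteratedDeriv_boundaryFun_le r f 0
  obtain ⟨M, hM⟩ := exists_norm_iteratedDeriv_boundaryFun_le r f (K + 2)
  have h0 : ∀ j : ℕ, iteratedDeriv j (fun _ : ℝ => (0 : ℂ)) = fun _ => 0 := fun j => by
    induction j with
    | zero => simp
    | succ j ih => rw [iteratedDeriv_succ, ih, deriv_const']
  refine Summable.of_norm_bounded (summable_inv_succ_sq.mul_left (C * max M₀ M)) fun n => ?_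
  refine norm_mul_le_of_growth hC hb ?_
  have := norm_fourierInt_sub_mul_le (contDiff_boundaryFun r f) (periodic_boundaryFun r f)
    (G := fun _ => 0) contDiff_const (fun _ => rfl) (k := K + 2) (M := max M₀ M)
    (fun θ => by simpa using (hM₀ θ).trans (le_max_left _ _))
    (fun θ => by simpa [h0] using (hM θ).trans (le_max_right _ _)) n
  rw [lowerCoef_eq_fourierInt]
  simpa [fourierInt] using this

/-- The linear form `∑ b_n d_n` on smooth vectors, for a sequence `b` of polynomial growth. -/
def smoothForm (r : ℝ) (b : ℕ → ℂ)
    (hb : ∃ C : ℝ, 0 ≤ C ∧ ∃ K : ℕ, ∀ n : ℕ, ‖b n‖ ≤ C * ((n : ℝ) + 1) ^ K) : DSmooth r →ₗ[ℂ] ℂ where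
  toFun f := ∑' n, b n * lowerCoef (minusMap r f) n
  map_add' f g := by
    obtain ⟨C, hC, K, hK⟩ := hb
    rw [← (summable_mul_lowerCoef r hC hK f).tsum_add (summable_mul_lowerCoef r hC hK g)]
    refine tsum_congr fun n => ?_
    obtain ⟨d, hd⟩ := exists_expansionLower r f
    obtain ⟨e, he⟩ := exists_expansionLower r g
    rw [Submodule.coe_add, map_add, (hd.add he).lowerCoef_eq, hd.lowerCoef_eq, he.lowerCoef_eq]
    simp [mul_add]
  map_smul' x f := by
    rw [RingHom.id_apply, smul_eq_mul, ← tsum_mul_left]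
    refine tsum_congr fun n => ?_
    obtain ⟨d, hd⟩ := exists_expansionLower r f
    rw [Submodule.coe_smul, map_smul, (hd.smul x).lowerCoef_eq, hd.lowerCoef_eq]
    simp only [Pi.smul_apply, smul_eq_mul]
    ring

theorem hasSum_smoothForm {r : ℝ} {b : ℕ → ℂ}
    (hb : ∃ C : ℝ, 0 ≤ C ∧ ∃ K : ℕ, ∀ n : ℕ, ‖b n‖ ≤ C * ((n : ℝ) + 1) ^ K) (f : DSmooth r)
    {d : ℕ → ℂ} (hd : ExpansionLower (minusMap r f) d) :
    HasSum (fun n => b n * d n) (smoothForm r b hb f) := by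
  have hb' := hb
  obtain ⟨C, hC, K, hK⟩ := hb'
  have := (summable_mul_lowerCoef r hC hK f).hasSum
  rwa [hd.lowerCoef_eq, show ∑' n, b n * d n = smoothForm r b hb f by
    rw [← hd.lowerCoef_eq]; rfl] at this

theorem norm_smoothForm_sub_le {r : ℝ} {b : ℕ → ℂ} {C : ℝ} {K : ℕ} (hC : 0 ≤ C)
    (hK : ∀ n : ℕ, ‖b n‖ ≤ C * ((n : ℝ) + 1) ^ K) (f g : DSmooth r) {M : ℝ}
    (h0 : ∀ θ, ‖boundaryFun r f θ - boundaryFun r g θ‖ ≤ M)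
    (h1 : ∀ θ, ‖iteratedDeriv (K + 2) (boundaryFun r f) θ -
      iteratedDeriv (K + 2) (boundaryFun r g) θ‖ ≤ M) :
    ‖smoothForm r b ⟨C, hC, K, hK⟩ f - smoothForm r b ⟨C, hC, K, hK⟩ g‖ ≤
      C * M * ∑' n : ℕ, (((n : ℝ) + 1) ^ 2)⁻¹ := by
  have e : smoothForm r b ⟨C, hC, K, hK⟩ f - smoothForm r b ⟨C, hC, K, hK⟩ g =
      ∑' n, b n * (lowerCoef (minusMap r f) n - lowerCoef (minusMap r g) n) := by
    refine ((summable_mul_lowerCoef r hC hK f).tsum_sub (summable_mul_lowerCoef r hC hK g)).symm.trans ?_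
    simp only [mul_sub]
  rw [e, ← tsum_mul_left]
  refine tsum_of_norm_bounded (summable_inv_succ_sq.mul_left _).hasSum fun n => ?_
  refine norm_mul_le_of_growth hC hK ?_
  rw [lowerCoef_eq_fourierInt, lowerCoef_eq_fourierInt]
  exact norm_fourierInt_sub_mul_le (contDiff_boundaryFun r f) (periodic_boundaryFun r f)
    (contDiff_boundaryFun r g) (periodic_boundaryFun r g) h0 h1 n

theorem eventually_iteratedDeriv_boundaryFun_lt (r : ℝ) (f₀ : DSmooth r) (k : ℕ) {δ : ℝ}
    (hδ : 0 < δ) : ∀ᶠ f in @nhds _ (smoothTopology r) f₀, ∀ θ,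
      ‖iteratedDeriv k (boundaryFun r f) θ - iteratedDeriv k (boundaryFun r f₀) θ‖ < δ := by
  let _ : TopologicalSpace (DSmooth r) := smoothTopology r
  have h1 : Continuous fun f : DSmooth r =>
      (UniformFun.ofFun (iteratedDeriv k (boundaryFun r f)) : UniformFun ℝ ℂ) :=
    (continuous_apply k).comp (continuous_induced_dom (t := inferInstance)
      (f := fun (f : DSmooth r) (k : ℕ) =>
        (UniformFun.ofFun (iteratedDeriv k (boundaryFun r f)) : UniformFun ℝ ℂ)))
  have h2 := UniformFun.tendsto_iff_tendstoUniformly.1 (h1.tendsto f₀)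
  filter_upwards [Metric.tendstoUniformly_iff.1 h2 δ hδ] with f hf θ
  have := hf θ
  rwa [dist_comm, dist_eq_norm] at this

theorem continuous_smoothForm (r : ℝ) (b : ℕ → ℂ)
    (hb : ∃ C : ℝ, 0 ≤ C ∧ ∃ K : ℕ, ∀ n : ℕ, ‖b n‖ ≤ C * ((n : ℝ) + 1) ^ K) :
    @Continuous _ _ (smoothTopology r) inferInstance (smoothForm r b hb) := by
  let _ : TopologicalSpace (DSmooth r) := smoothTopology r
  obtain ⟨C, hC, K, hK⟩ := hb
  refine continuous_iff_continuousAt.2 fun f₀ => Metric.tendsto_nhds.2 fun ε hε => ?_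
  set S := ∑' n : ℕ, (((n : ℝ) + 1) ^ 2)⁻¹
  have hS : 0 ≤ S := tsum_nonneg fun n => by positivity
  set δ := ε / (C * S + 1)
  have hδ : 0 < δ := by positivity
  filter_upwards [eventually_iteratedDeriv_boundaryFun_lt r f₀ 0 hδ,
    eventually_iteratedDeriv_boundaryFun_lt r f₀ (K + 2) hδ] with f h0 h1
  rw [dist_eq_norm]
  refine (norm_smoothForm_sub_le hC hK f f₀ (M := δ) (fun θ => by simpa using (h0 θ).le)
    fun θ => (h1 θ).le).trans_lt ?_
  calc C * δ * S = C * S * δ := by ring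
    _ < (C * S + 1) * δ := by gcongr; linarith
    _ = ε := by simp only [δ]; field_simp

/-! ### The forms on the weight `r` modules -/

/-- The isomorphism `h ↦ h⁺` of the space of holomorphic functions on the upper half-plane. -/
def plusEquiv (r : ℝ) : holUpper →ₗ[ℂ] holUpper :=
  (plusMap r).restrict fun _ hh => plusMap_mem_holUpper_iff.2 hh

/-- The isomorphism `f ↦ f⁻` from analytic vectors to functions on the lower half-plane. -/
def minusEquiv (r : ℝ) : DOmega r →ₗ[ℂ] analyticLower :=
  (minusMap r).restrict fun _ hf => hf

/-- The isomorphism `h ↦ h⁺` from polynomials in `z` to polynomials in `w`. -/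
def plusPolEquiv (a : ℕ) : polUpper a →ₗ[ℂ] diskPolUpper a :=
  (plusMap (-(a : ℝ))).restrict fun _ hh => plusMap_mem_diskPolUpper_iff.2 hh

/-- The isomorphism `f ↦ f⁻` from polynomials in `t` to polynomials in `w⁻¹`. -/
def minusPolEquiv (a : ℕ) : polLower a →ₗ[ℂ] diskPolLower a :=
  (minusMap (-(a : ℝ))).restrict fun _ hf => minusMap_mem_diskPolLower_iff.2 hf

theorem plusEquiv_bijective (r : ℝ) : Function.Bijective (plusEquiv r) :=
  restrict_bijective ⟨plusMap_injective r, plusMap_surjective r⟩ fun _ => plusMap_mem_holUpper_iff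

theorem minusEquiv_bijective (r : ℝ) : Function.Bijective (minusEquiv r) :=
  restrict_bijective ⟨minusMap_injective r, minusMap_surjective r⟩ fun _ => Iff.rfl

theorem plusPolEquiv_bijective (a : ℕ) : Function.Bijective (plusPolEquiv a) :=
  restrict_bijective ⟨plusMap_injective _, plusMap_surjective _⟩ fun _ => plusMap_mem_diskPolUpper_iff

theorem minusPolEquiv_bijective (a : ℕ) : Function.Bijective (minusPolEquiv a) :=
  restrict_bijective ⟨minusMap_injective _, minusMap_surjective _⟩
    fun _ => minusMap_mem_diskPolLower_iff

/-- The form `[h, f]_r` for `r ∉ ℤ_{≤ 0}`. -/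
def weightPairing (r : ℝ) : holUpper →ₗ[ℂ] DOmega r →ₗ[ℂ] ℂ :=
  (pairing r).compl₁₂ (plusEquiv r) (minusEquiv r)

/-- The form `[h, f]_r` for `r = -a ∈ ℤ_{≤ 0}`. -/
def weightPolPairing (a : ℕ) : holUpper →ₗ[ℂ] polLower a →ₗ[ℂ] ℂ :=
  (pairing (-(a : ℝ))).compl₁₂ (plusEquiv (-(a : ℝ)))
    (Submodule.inclusion (diskPolLower_le_analyticLower a) ∘ₗ minusPolEquiv a)

/-- The form on hyperfunctions for `r ∉ ℤ_{≤ 0}`. -/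
def hyperPairing (r : ℝ) : plusHyper holUpper →ₗ[ℂ] minusHyper analyticLower →ₗ[ℂ] ℂ :=
  (pairing r).compl₁₂ (plusRepr le_rfl) (minusRepr le_rfl)

/-- The form on hyperfunctions for `r = -a ∈ ℤ_{≤ 0}`. -/
def hyperPolPairing (a : ℕ) : plusHyper holUpper →ₗ[ℂ] minusHyper (diskPolLower a) →ₗ[ℂ] ℂ :=
  (pairing (-(a : ℝ))).compl₁₂ (plusRepr le_rfl)
    (Submodule.inclusion (diskPolLower_le_analyticLower a) ∘ₗ
      minusRepr (diskPolLower_le_analyticLower a))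

theorem weightPairing_nondegenerate {r : ℝ} (hr : ∀ a : ℕ, r ≠ -(a : ℝ)) :
    (weightPairing r).Nondegenerate :=
  nondegenerate_compl₁₂ (pairing_nondegenerate hr) (plusEquiv_bijective r) (minusEquiv_bijective r)

theorem weightPolPairing_nondegenerate (a : ℕ) :
    (weightPolPairing a ∘ₗ Submodule.inclusion (polUpper_le_holUpper a)).Nondegenerate := by
  have e : weightPolPairing a ∘ₗ Submodule.inclusion (polUpper_le_holUpper a) =
      (polPairing a).compl₁₂ (plusPolEquiv a) (minusPolEquiv a) := by
    refine LinearMap.ext fun h => LinearMap.ext fun f => ?_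
    have h1 : plusEquiv (-(a : ℝ)) (Submodule.inclusion (polUpper_le_holUpper a) h) =
        Submodule.inclusion (diskPolUpper_le_holUpper a) (plusPolEquiv a h) := Subtype.ext rfl
    exact congrArg (fun k => pairing (-(a : ℝ)) k _) h1
  rw [e]
  exact nondegenerate_compl₁₂ (polPairing_nondegenerate a) (plusPolEquiv_bijective a)
    (minusPolEquiv_bijective a)

theorem hyperPairing_nondegenerate {r : ℝ} (hr : ∀ a : ℕ, r ≠ -(a : ℝ)) :
    (hyperPairing r).Nondegenerate :=
  nondegenerate_compl₁₂ (pairing_nondegenerate hr) (plusRepr_bijective _) (minusRepr_bijective _)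

theorem hyperPolPairing_nondegenerate (a : ℕ) :
    (hyperPolPairing a ∘ₗ Submodule.inclusion
      (plusHyper_mono (diskPolUpper_le_holUpper a))).Nondegenerate := by
  have e : hyperPolPairing a ∘ₗ Submodule.inclusion (plusHyper_mono (diskPolUpper_le_holUpper a)) =
      (polPairing a).compl₁₂ (plusRepr (diskPolUpper_le_holUpper a))
        (minusRepr (diskPolLower_le_analyticLower a)) := by
    refine LinearMap.ext fun α => LinearMap.ext fun β => ?_
    have h : plusRepr le_rfl (Submodule.inclusion (plusHyper_mono (diskPolUpper_le_holUpper a)) α) =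
        Submodule.inclusion (diskPolUpper_le_holUpper a)
          (plusRepr (diskPolUpper_le_holUpper a) α) :=
      Subtype.ext (RepPlus.plusRepr_eq le_rfl (diskPolUpper_le_holUpper a)
        (repPlus_plusRepr (diskPolUpper_le_holUpper a) α))
    exact congrArg (fun k => pairing (-(a : ℝ)) k _) h
  rw [e]
  exact nondegenerate_compl₁₂ (polPairing_nondegenerate a) (plusRepr_bijective _)
    (minusRepr_bijective _)

theorem hyperPairing_apply {r : ℝ} {α : plusHyper holUpper} {β : minusHyper analyticLower}
    {h : holUpper} {f : analyticLower} (hα : RepPlus holUpper α h) (hβ : RepMinus analyticLower β f) :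
    hyperPairing r α β = pairing r h f := by
  have h1 : plusRepr le_rfl α = h := Subtype.ext (hα.plusRepr_eq le_rfl le_rfl)
  have h2 : minusRepr le_rfl β = f := Subtype.ext (hβ.minusRepr_eq le_rfl le_rfl)
  rw [hyperPairing, LinearMap.compl₁₂_apply, h1, h2]

theorem hyperPolPairing_apply {a : ℕ} {α : plusHyper holUpper} {β : minusHyper (diskPolLower a)}
    {W : Submodule ℂ (ℍ → ℂ)} (hW : W ≤ holUpper) {h : holUpper} {f : diskPolLower a}
    (hα : RepPlus W α h) (hβ : RepMinus (diskPolLower a) β f) :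
    hyperPolPairing a α β =
      pairing (-(a : ℝ)) h (Submodule.inclusion (diskPolLower_le_analyticLower a) f) := by
  have h1 : plusRepr le_rfl α = h := Subtype.ext (hα.plusRepr_eq le_rfl hW)
  have h2 : minusRepr (diskPolLower_le_analyticLower a) β = f :=
    Subtype.ext (hβ.minusRepr_eq _ (diskPolLower_le_analyticLower a))
  rw [hyperPolPairing, LinearMap.compl₁₂_apply, LinearMap.comp_apply, h1, h2]

/-! ### Invariance -/

theorem weightPairing_slash {r : ℝ} (hr : ∀ a : ℕ, r ≠ -(a : ℝ)) (v : SL(2, ℤ) → ℂˣ)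
    (γ : SL(2, ℤ)) (h : holUpper) (f : DOmega r) :
    ∃ (hh : slashUpper v r γ h ∈ holUpper) (hf : slashLower v r γ f ∈ DOmega r),
      weightPairing r ⟨_, hh⟩ ⟨_, hf⟩ = weightPairing r h f := by
  have hc := isCocycle_slash v r γ
  have e1 := funext (plusMap_slashUpper v r γ h)
  have e2 := funext (minusMap_slashLower v r γ f)
  have hh : slashUpper v r γ h ∈ holUpper := plusMap_mem_holUpper_iff.1 <| by
    rw [e1]
    exact hc.act_mem_holUpper (plusEquiv r h).2
  have hf : minusMap r (slashLower v r γ f) ∈ analyticLower := by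
    rw [e2]
    exact hc.act_mem_analyticLower (minusEquiv r f).2
  exact ⟨hh, hf, hc.pairing_act_of_ne hr (h := plusEquiv r h) (h' := plusEquiv r ⟨_, hh⟩)
    (f := minusEquiv r f) (f' := minusEquiv r ⟨_, hf⟩) (congrFun e1) (congrFun e2)⟩

theorem weightPolPairing_slash (a : ℕ) (v : SL(2, ℤ) → ℂˣ) (γ : SL(2, ℤ)) (h : polUpper a)
    (f : polLower a) :
    ∃ (hh : slashUpper v (-(a : ℝ)) γ h ∈ polUpper a) (hf : slashLower v (-(a : ℝ)) γ f ∈ polLower a),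
      weightPolPairing a (Submodule.inclusion (polUpper_le_holUpper a) ⟨_, hh⟩) ⟨_, hf⟩ =
        weightPolPairing a (Submodule.inclusion (polUpper_le_holUpper a) h) f := by
  have hc := isCocycle_slash v (-(a : ℝ)) γ
  have e1 := funext (plusMap_slashUpper v (-(a : ℝ)) γ h)
  have e2 := funext (minusMap_slashLower v (-(a : ℝ)) γ f)
  have hh : slashUpper v (-(a : ℝ)) γ h ∈ polUpper a := plusMap_mem_diskPolUpper_iff.1 <| by
    rw [e1]
    exact hc.act_mem_diskPolUpper (plusPolEquiv a h).2
  have hf : slashLower v (-(a : ℝ)) γ f ∈ polLower a := minusMap_mem_diskPolLower_iff.1 <| by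
    rw [e2]
    exact hc.act_mem_diskPolLower (minusPolEquiv a f).2
  exact ⟨hh, hf, hc.pairing_act_pol
    (h := plusEquiv _ (Submodule.inclusion (polUpper_le_holUpper a) h))
    (h' := plusEquiv _ (Submodule.inclusion (polUpper_le_holUpper a) ⟨_, hh⟩))
    (f := Submodule.inclusion (diskPolLower_le_analyticLower a) (minusPolEquiv a f))
    (f' := Submodule.inclusion (diskPolLower_le_analyticLower a) (minusPolEquiv a ⟨_, hf⟩))
    (plusPolEquiv a h).2 (minusPolEquiv a f).2 (congrFun e1) (congrFun e2)⟩

theorem hyperPairing_ps {r : ℝ} (hr : ∀ a : ℕ, r ≠ -(a : ℝ)) (k : ℤ) {g : SL(2, ℝ)} (hg : g ∈ G0)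
    {α : plusHyper holUpper} {β : minusHyper analyticLower} {h : ℍ → ℂ} {f : LHP → ℂ}
    (hα : RepPlus holUpper α h) (hβ : RepMinus analyticLower β f) :
    ∃ (α' : plusHyper holUpper) (β' : minusHyper analyticLower),
      RepPlus holUpper α' (psUpper r k g h) ∧ RepMinus analyticLower β' (psLower r k g f) ∧
        hyperPairing r α' β' = hyperPairing r α β := by
  have hc := isCocycle_ps r k hg
  have hh : psUpper r k g h ∈ holUpper := hc.act_mem_holUpper hα.1
  have hf : psLower r k g f ∈ analyticLower := hc.act_mem_analyticLower hβ.1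
  obtain ⟨α', hα'⟩ := exists_repPlus le_rfl hh
  obtain ⟨β', hβ'⟩ := exists_repMinus le_rfl hf
  refine ⟨α', β', hα', hβ', ?_⟩
  rw [hyperPairing_apply (h := ⟨_, hh⟩) (f := ⟨_, hf⟩) hα' hβ',
    hyperPairing_apply (h := ⟨h, hα.1⟩) (f := ⟨f, hβ.1⟩) hα hβ]
  exact hc.pairing_act_of_ne hr (fun _ => rfl) fun _ => rfl

theorem hyperPolPairing_ps {a : ℕ} (k : ℤ) {g : SL(2, ℝ)} (hg : g ∈ G0)
    {α : plusHyper (diskPolUpper a)} {β : minusHyper (diskPolLower a)} {h : ℍ → ℂ} {f : LHP → ℂ}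
    (hα : RepPlus (diskPolUpper a) α h) (hβ : RepMinus (diskPolLower a) β f) :
    ∃ (α' : plusHyper (diskPolUpper a)) (β' : minusHyper (diskPolLower a)),
      RepPlus (diskPolUpper a) α' (psUpper (-(a : ℝ)) k g h) ∧
        RepMinus (diskPolLower a) β' (psLower (-(a : ℝ)) k g f) ∧
        hyperPolPairing a (Submodule.inclusion (plusHyper_mono (diskPolUpper_le_holUpper a)) α') β' =
          hyperPolPairing a (Submodule.inclusion (plusHyper_mono (diskPolUpper_le_holUpper a)) α) β := by
  have hc := isCocycle_ps (-(a : ℝ)) k hg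
  have hW := diskPolUpper_le_holUpper a
  have hW' := diskPolLower_le_analyticLower a
  have hh : psUpper (-(a : ℝ)) k g h ∈ diskPolUpper a := hc.act_mem_diskPolUpper hα.1
  have hf : psLower (-(a : ℝ)) k g f ∈ diskPolLower a := hc.act_mem_diskPolLower hβ.1
  obtain ⟨α', hα'⟩ := exists_repPlus hW hh
  obtain ⟨β', hβ'⟩ := exists_repMinus hW' hf
  refine ⟨α', β', hα', hβ', ?_⟩
  rw [hyperPolPairing_apply (α := Submodule.inclusion (plusHyper_mono hW) α') hW
      (h := ⟨_, hW hh⟩) (f := ⟨_, hf⟩) hα' hβ',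
    hyperPolPairing_apply (α := Submodule.inclusion (plusHyper_mono hW) α) hW
      (h := ⟨h, hW hα.1⟩) (f := ⟨f, hβ.1⟩) hα hβ]
  exact hc.pairing_act_pol hα.1 hβ.1 (fun _ => rfl) fun _ => rfl

/-! ### Extension to smooth vectors and finite sums -/

/-- For `h⁺` of polynomial growth the coefficients `n! / (r)_n c_n` grow polynomially, and are compensated
by the decay of the Fourier coefficients of smooth vectors. -/
theorem exists_continuous_extension (r : ℝ) {h : holUpper} (hg : HasPolyGrowth (plusMap r h)) :
    ∃ L : DSmooth r →ₗ[ℂ] ℂ,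
      @Continuous _ _ (smoothTopology r) inferInstance L ∧
      (∀ f : DOmega r, L (Submodule.inclusion (DOmega_le_DSmooth r) f) = weightPairing r h f) ∧
      ∀ (f : DSmooth r) (c d : ℕ → ℂ),
        ExpansionUpper (plusMap r h) c → ExpansionLower (minusMap r f) d →
          HasSum (fun n => coeff r n * c n * d n) (L f) := by
  have hc := expansionUpper_upperCoef (plusEquiv r h).2
  have hb : ∃ C : ℝ, 0 ≤ C ∧ ∃ K : ℕ, ∀ n : ℕ,
      ‖coeff r n * upperCoef (plusMap r h) n‖ ≤ C * ((n : ℝ) + 1) ^ K := by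
    obtain ⟨C, hC, K, hK⟩ := coeff_growth r
    obtain ⟨C', hC', K', hK'⟩ := hg.coeff_bound (plusEquiv r h).2 hc
    refine ⟨C * C', by positivity, K + K', fun n => ?_⟩
    calc _ ≤ C * ((n : ℝ) + 1) ^ K * (C' * ((n : ℝ) + 1) ^ K') := by
          rw [norm_mul]
          exact mul_le_mul (hK n) (hK' n) (norm_nonneg _) (by positivity)
      _ = _ := by ring
  refine ⟨smoothForm r _ hb, continuous_smoothForm r _ hb, fun f => ?_, fun f c d hc' hd => ?_⟩
  · have hd := expansionLower_lowerCoef (minusEquiv r f).2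
    exact (hasSum_smoothForm hb (Submodule.inclusion (DOmega_le_DSmooth r) f) hd).unique
      (hasSum_pairing r (plusEquiv r h) (minusEquiv r f) hc hd)
  · obtain rfl : upperCoef (plusMap r h) = c := hc'.upperCoef_eq
    exact hasSum_smoothForm hb f hd

theorem weightPolPairing_eq_sum (a : ℕ) (h : holUpper) (f : polLower a) {c d : ℕ → ℂ}
    (hc : ExpansionUpper (plusMap (-(a : ℝ)) h) c) (hd : ExpansionPol a (minusMap (-(a : ℝ)) f) d) :
    weightPolPairing a h f = ∑ n ∈ Finset.range (a + 1), coeff (-(a : ℝ)) n * c n * d n := by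
  have hs := hasSum_pairing (-(a : ℝ)) (plusEquiv _ h)
    (Submodule.inclusion (diskPolLower_le_analyticLower a) (minusPolEquiv a f)) hc hd.expansionLower
  refine (hs.unique (hasSum_sum_of_ne_finset_zero (s := Finset.range (a + 1)) fun n hn => by
    rw [if_neg hn, mul_zero])).trans (Finset.sum_congr rfl fun n hn => by rw [if_pos hn])

end WeightDuality

end


theorem theorem4p1 (r : ℝ) (v : SL(2, ℤ) → ℂˣ) (hv : IsMultiplierSystem r v) :
    -- weights outside `ℤ_{≤ 0}`
    ((∀ a : ℕ, r ≠ -(a : ℝ)) →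
      ∃ B : holUpper →ₗ[ℂ] DOmega r →ₗ[ℂ] ℂ,
        (∀ (h : holUpper) (f : DOmega r),
          ContourFormula r (plusMap r h) (minusMap r f) (B h f)) ∧
        B.Nondegenerate ∧
        (∀ (γ : SL(2, ℤ)) (h : holUpper) (f : DOmega r),
          ∃ (hh : slashUpper v r γ h ∈ holUpper) (hf : slashLower v r γ f ∈ DOmega r),
            B ⟨_, hh⟩ ⟨_, hf⟩ = B h f) ∧
        (∀ (h : holUpper) (f : DOmega r) (c d : ℕ → ℂ),
          ExpansionUpper (plusMap r h) c → ExpansionLower (minusMap r f) d →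
            HasSum (fun n => coeff r n * c n * d n) (B h f)) ∧
        (∀ h : holUpper, HasPolyGrowth (plusMap r h) →
          ∃ L : DSmooth r →ₗ[ℂ] ℂ,
            @Continuous _ _ (smoothTopology r) inferInstance L ∧
            (∀ f : DOmega r, L (Submodule.inclusion (DOmega_le_DSmooth r) f) = B h f) ∧
            (∀ (f : DSmooth r) (c d : ℕ → ℂ),
              ExpansionUpper (plusMap r h) c → ExpansionLower (minusMap r f) d →
                HasSum (fun n => coeff r n * c n * d n) (L f))) ∧
        -- the version for principal series of the universal covering group
        (∃ B' : plusHyper holUpper →ₗ[ℂ] minusHyper analyticLower →ₗ[ℂ] ℂ,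
          (∀ (α : plusHyper holUpper) (β : minusHyper analyticLower) (hp : ℍ → ℂ) (fm : LHP → ℂ),
            RepPlus holUpper α hp → RepMinus analyticLower β fm → ContourFormula r hp fm (B' α β)) ∧
          B'.Nondegenerate ∧
          (∀ (k : ℤ) (g : SL(2, ℝ)), g ∈ G0 →
            ∀ (α : plusHyper holUpper) (β : minusHyper analyticLower)
              (hp : ℍ → ℂ) (fm : LHP → ℂ), RepPlus holUpper α hp → RepMinus analyticLower β fm →
              ∃ (α' : plusHyper holUpper) (β' : minusHyper analyticLower),
                RepPlus holUpper α' (psUpper r k g hp) ∧ RepMinus analyticLower β' (psLower r k g fm) ∧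
                B' α' β' = B' α β) ∧
          (∀ (h : holUpper) (f : DOmega r) (α : plusHyper holUpper)
            (β : minusHyper analyticLower),
            RepPlus holUpper α (plusMap r h) → RepMinus analyticLower β (minusMap r f) → B' α β = B h f))) ∧
    -- weights in `ℤ_{≤ 0}`
    (∀ a : ℕ, r = -(a : ℝ) →
      ∃ B : holUpper →ₗ[ℂ] polLower a →ₗ[ℂ] ℂ,
        (∀ (h : holUpper) (f : polLower a),
          PolContourFormula a (plusMap r h) (minusMap r f) (B h f)) ∧
        (B ∘ₗ Submodule.inclusion (polUpper_le_holUpper a)).Nondegenerate ∧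
        (∀ (γ : SL(2, ℤ)) (h : polUpper a) (f : polLower a),
          ∃ (hh : slashUpper v r γ h ∈ polUpper a) (hf : slashLower v r γ f ∈ polLower a),
            B (Submodule.inclusion (polUpper_le_holUpper a) ⟨_, hh⟩) ⟨_, hf⟩ =
              B (Submodule.inclusion (polUpper_le_holUpper a) h) f) ∧
        (∀ (h : holUpper) (f : polLower a) (c d : ℕ → ℂ),
          ExpansionUpper (plusMap r h) c → ExpansionPol a (minusMap r f) d →
            B h f = ∑ n ∈ Finset.range (a + 1), coeff r n * c n * d n) ∧
        (∃ B' : plusHyper holUpper →ₗ[ℂ] minusHyper (diskPolLower a) →ₗ[ℂ] ℂ,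
          (∀ (α : plusHyper holUpper) (β : minusHyper (diskPolLower a))
            (hp : ℍ → ℂ) (fm : LHP → ℂ),
            RepPlus holUpper α hp → RepMinus (diskPolLower a) β fm → PolContourFormula a hp fm (B' α β)) ∧
          (B' ∘ₗ Submodule.inclusion
            (plusHyper_mono (diskPolUpper_le_holUpper a))).Nondegenerate ∧
          (∀ (k : ℤ) (g : SL(2, ℝ)), g ∈ G0 →
            ∀ (α : plusHyper (diskPolUpper a)) (β : minusHyper (diskPolLower a))
              (hp : ℍ → ℂ) (fm : LHP → ℂ), RepPlus (diskPolUpper a) α hp → RepMinus (diskPolLower a) β fm →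
              ∃ (α' : plusHyper (diskPolUpper a)) (β' : minusHyper (diskPolLower a)),
                RepPlus (diskPolUpper a) α' (psUpper r k g hp) ∧ RepMinus (diskPolLower a) β' (psLower r k g fm) ∧
                B' (Submodule.inclusion (plusHyper_mono (diskPolUpper_le_holUpper a)) α') β' =
                  B' (Submodule.inclusion (plusHyper_mono (diskPolUpper_le_holUpper a)) α) β) ∧
          (∀ (h : holUpper) (f : polLower a) (α : plusHyper holUpper)
            (β : minusHyper (diskPolLower a)),
            RepPlus holUpper α (plusMap r h) → RepMinus (diskPolLower a) β (minusMap r f) → B' α β = B h f))) := by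
  refine ⟨fun hr => ?_, ?_⟩
  · refine ⟨weightPairing r, fun h f => contourFormula_pairing r (plusEquiv r h) (minusEquiv r f),
      weightPairing_nondegenerate hr, fun γ h f => weightPairing_slash hr v γ h f,
      fun h f c d hc hd => hasSum_pairing r (plusEquiv r h) (minusEquiv r f) hc hd,
      fun h hg => exists_continuous_extension r hg,
      hyperPairing r, fun α β hp fm hα hβ => ?_, hyperPairing_nondegenerate hr,
      fun k g hg α β hp fm hα hβ => hyperPairing_ps hr k hg hα hβ,
      fun h f α β hα hβ => hyperPairing_apply (h := plusEquiv r h) (f := minusEquiv r f) hα hβ⟩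
    rw [hyperPairing_apply (h := ⟨hp, hα.1⟩) (f := ⟨fm, hβ.1⟩) hα hβ]
    exact contourFormula_pairing r ⟨hp, hα.1⟩ ⟨fm, hβ.1⟩
  · rintro a rfl
    refine ⟨weightPolPairing a, fun h f => polContourFormula_pairing a (plusEquiv _ h)
        (Submodule.inclusion (diskPolLower_le_analyticLower a) (minusPolEquiv a f))
        (exists_expansionPol (minusPolEquiv a f).2),
      weightPolPairing_nondegenerate a, fun γ h f => weightPolPairing_slash a v γ h f,
      fun h f c d hc hd => weightPolPairing_eq_sum a h f hc hd,
      hyperPolPairing a, fun α β hp fm hα hβ => ?_, hyperPolPairing_nondegenerate a,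
      fun k g hg α β hp fm hα hβ => hyperPolPairing_ps k hg hα hβ,
      fun h f α β hα hβ => hyperPolPairing_apply le_rfl (h := plusEquiv _ h)
        (f := minusPolEquiv a f) hα hβ⟩
    rw [hyperPolPairing_apply le_rfl (h := ⟨hp, hα.1⟩) (f := ⟨fm, hβ.1⟩) hα hβ]
    exact polContourFormula_pairing a ⟨hp, hα.1⟩
      (Submodule.inclusion (diskPolLower_le_analyticLower a) ⟨fm, hβ.1⟩) (exists_expansionPol hβ.1)
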